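/- A cube complex is a complex of cubes $[0,1]^n$ ($n\ge 0$ finite, no bound on the dimension) in which cubes are embedded and any two cubes that meet do so in a common face; it is CAT(0) if it is non-positively curved (the link of every vertex is a flag complex) and simply connected. Let $X$ be a CAT(0) cube complex, with $d$ the combinatorial (edge-path) distance on its vertices. A half-space is a component $H$ of the complement of a hyperplane, and $\overline H$ denotes the opposite one; half-spaces are recorded by their sets of vertices. Let $g$ be a hyperbolic automorphism of $X$: no power of $g$ maps a half-space $H$ to $\overline H$, and the translation distance $\ell_g=\min_x d(x,gx)$ over the vertices $x$ of $X$ is positive. The minimal set $M_g\subseteq X$ is the full subcomplex spanned by the vertices $x$ with $d(x,gx)=\ell_g$. A combinatorial axis of $g$ is a bi-infinite edge geodesic $(x_i)_{i\in\mathbb Z}$ with $g x_i=x_{i+\ell_g}$ for all $i$. Let $A_g^+$ be the set of half-spaces $H$ such that $x_i\notin H$ and $x_{i+1}\in H$ for some axis $(x_i)$ of $g$ and some $i$, and let $A_g=A_g^+\cup\{\overline H : H\in A_g^+\}$. The essential characteristic set $X^{\mathrm{ess}}_g=X(A_g)$ is the cube complex given by the Sageev construction: its vertices are the subsets $\sigma\subseteq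 A_g$ containing exactly one of $H,\overline H$ for each $H\in A_g$, no two of whose elements are disjoint, and satisfying the descending chain condition; two vertices are adjacent if they differ on exactly one pair $\{H,\overline H\}$; and a cube is present whenever its $1$-skeleton is. Sending a vertex $x$ to $\{H\in A_g : x\in H\}$ projects $M_g$ to $X^{\mathrm{ess}}_g$, and the essential minimal set $M^{\mathrm{ess}}_g\subseteq X^{\mathrm{ess}}_g$ is the image: the subcomplex whose cubes are the projections of the cubes of $M_g$. **Proposition.** For every hyperbolic automorphism $g$ of a CAT(0) cube complex $X$, the essential minimal set $M^{\mathrm{ess}}_g$ is a CAT(0) cube complex. -/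

import Mathlib

/-! Cube complexes are described combinatorially: a cube is recorded by its set of vertices, and a
cube complex by the family `K` of the vertex sets of all its cubes (of all dimensions). -/

namespace CubeCpx

universe u

/-- The face of the standard cube with vertex set `{0,1}ⁿ` obtained by fixing the coordinates in `S`
to be those of `a`. -/
def cubeFace {n : ℕ} (S : Set (Fin n)) (a : Fin n → Bool) : Set (Fin n → Bool) :=
  {x | ∀ i ∈ S, x i = a i}

/-- `K` is the family of (vertex sets of) cubes of a cube complex with vertex set `V`: every vertex
is a cube; every member of `K` is a copy of a standard cube `{0,1}ⁿ`, and the members of `K` that it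
contains are exactly its faces; two cubes that meet do so in a cube (hence in a common face). -/
structure IsCubeComplex {V : Type u} (K : Set (Set V)) : Prop where
  vertex_mem : ∀ v : V, {v} ∈ K
  isCube : ∀ C ∈ K, ∃ (n : ℕ) (φ : (Fin n → Bool) → V), Function.Injective φ ∧ Set.range φ = C ∧
    ∀ D : Set V, D ⊆ C → (D ∈ K ↔ ∃ (S : Set (Fin n)) (a : Fin n → Bool), D = φ '' cubeFace S a)
  inter_mem : ∀ C ∈ K, ∀ D ∈ K, (C ∩ D).Nonempty → C ∩ D ∈ K

/-- The `1`-skeleton. -/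
def skeleton {V : Type u} (K : Set (Set V)) : SimpleGraph V where
  Adj x y := x ≠ y ∧ {x, y} ∈ K
  symm := ⟨fun x y h => ⟨h.1.symm, Set.pair_comm x y ▸ h.2⟩⟩
  loopless := ⟨fun _ h => h.1 rfl⟩

/-- `a, b, c, d` are the vertices of a square of the complex, in cyclic order. -/
structure IsSquare {V : Type u} (K : Set (Set V)) (a b c d : V) : Prop where
  mem : {a, b, c, d} ∈ K
  adj_ab : (skeleton K).Adj a b
  adj_bc : (skeleton K).Adj b c
  adj_cd : (skeleton K).Adj c d
  adj_da : (skeleton K).Adj d a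
  ne_ac : a ≠ c
  ne_bd : b ≠ d

/-- The link of the vertex `v`, as a family of simplices. Its vertices are the edges at `v`, recorded
by their other endpoint; every cube containing `v` contributes the simplex spanned by its edges
at `v`. -/
def link {V : Type u} (K : Set (Set V)) (v : V) : Set (Set V) :=
  {A | ∃ C ∈ K, v ∈ C ∧ A = {w | w ∈ C ∧ (skeleton K).Adj v w}}

/-- Non-positive curvature: the link of every vertex is a flag complex, that is, finitely many
vertices of the link that are pairwise joined by edges of the link span a simplex of the link. -/
def IsNonpositivelyCurved {V : Type u} (K : Set (Set V)) : Prop :=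
  ∀ (v : V) (A : Set V), A.Finite → (∀ a ∈ A, (skeleton K).Adj v a) →
    (∀ a ∈ A, ∀ b ∈ A, a ≠ b → {a, b} ∈ link K v) → A ∈ link K v

/-- Homotopy of edge paths relative to endpoints: the congruence on edge paths (with respect to
concatenation) generated by cancelling backtracks and by pushing a path across a square. -/
inductive Homotopic {V : Type u} (K : Set (Set V)) :
    ∀ {x y : V}, (skeleton K).Walk x y → (skeleton K).Walk x y → Prop
  | refl {x y : V} (p : (skeleton K).Walk x y) : Homotopic K p p
  | symm {x y : V} {p q : (skeleton K).Walk x y} : Homotopic K p q → Homotopic K q p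
  | trans {x y : V} {p q r : (skeleton K).Walk x y} :
      Homotopic K p q → Homotopic K q r → Homotopic K p r
  | append {x y z : V} {p p' : (skeleton K).Walk x y} {q q' : (skeleton K).Walk y z} :
      Homotopic K p p' → Homotopic K q q' → Homotopic K (p.append q) (p'.append q')
  | backtrack {x y : V} (h : (skeleton K).Adj x y) :
      Homotopic K (.cons h (.cons h.symm .nil)) (.nil : (skeleton K).Walk x x)
  | square {a b c d : V} (h : IsSquare K a b c d) :
      Homotopic K (.cons h.adj_ab (.cons h.adj_bc .nil))
        (.cons h.adj_da.symm (.cons h.adj_cd.symm .nil))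

/-- The complex is (non-empty and) connected and every closed edge path is null-homotopic. -/
def IsSimplyConnected {V : Type u} (K : Set (Set V)) : Prop :=
  (skeleton K).Connected ∧
    ∀ (x : V) (p : (skeleton K).Walk x x), Homotopic K p .nil

/-- A CAT(0) cube complex: a cube complex that is non-positively curved and simply connected. -/
structure IsCAT0CubeComplex {V : Type u} (K : Set (Set V)) : Prop where
  isCubeComplex : IsCubeComplex K
  nonpositivelyCurved : IsNonpositivelyCurved K
  simplyConnected : IsSimplyConnected K

/-! ### Hyperplanes and half-spaces -/

/-- `e` and `f` are opposite edges of a square. -/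
def Opposite {V : Type u} (K : Set (Set V)) (e f : Sym2 V) : Prop :=
  ∃ a b c d : V, IsSquare K a b c d ∧ e = s(a, b) ∧ f = s(d, c)

/-- A hyperplane, recorded by the set of edges dual to it: a class of edges for the equivalence
relation generated by being opposite edges of a square. -/
def IsHyperplane {V : Type u} (K : Set (Set V)) (h : Set (Sym2 V)) : Prop :=
  ∃ e ∈ (skeleton K).edgeSet, h = {f | Relation.EqvGen (Opposite K) e f}

/-- The half-spaces, recorded by their vertex sets: the components of the complement of a
hyperplane. The opposite half-space of `H` is the complement `Hᶜ`. -/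
def halfSpaces {V : Type u} (K : Set (Set V)) : Set (Set V) :=
  {H | ∃ h, IsHyperplane K h ∧
    ∃ c : ((skeleton K).deleteEdges h).ConnectedComponent, H = c.supp}

/-- The interval `[x, y]`: the half-spaces containing `y` but not `x`. -/
def interval {V : Type u} (K : Set (Set V)) (x y : V) : Set (Set V) :=
  {H | H ∈ halfSpaces K ∧ y ∈ H ∧ x ∉ H}

/-! ### Automorphisms -/

/-- The permutation `g` of the vertices is an automorphism of the cube complex. -/
def IsAutomorphism {V : Type u} (K : Set (Set V)) (g : Equiv.Perm V) : Prop :=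
  ∀ C : Set V, g '' C ∈ K ↔ C ∈ K

/-- `g` acts with inversion: it maps some half-space to the opposite one. -/
def ActsWithInversion {V : Type u} (K : Set (Set V)) (g : Equiv.Perm V) : Prop :=
  ∃ H ∈ halfSpaces K, g '' H = Hᶜ

/-- The translation distance `min d(x, g x)`, for the combinatorial distance. -/
noncomputable def translationDistance {V : Type u} (K : Set (Set V)) (g : Equiv.Perm V) : ℕ :=
  sInf (Set.range fun x : V => (skeleton K).dist x (g x))

/-- `g` is a hyperbolic automorphism: all its powers act without inversion, and its translation
distance is positive. -/
structure IsHyperbolic {V : Type u} (K : Set (Set V)) (g : Equiv.Perm V) : Prop where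
  isAutomorphism : IsAutomorphism K g
  noInversion : ∀ n : ℤ, ¬ ActsWithInversion K (g ^ n)
  pos : 0 < translationDistance K g

/-- The vertices of the minimal set of `g`. The minimal set is the full subcomplex that they span:
its cubes are the cubes of the complex all of whose vertices lie in this set. -/
def minVertices {V : Type u} (K : Set (Set V)) (g : Equiv.Perm V) : Set V :=
  {x | (skeleton K).dist x (g x) = translationDistance K g}

/-- `γ` is a combinatorial axis of `g`, with its natural orientation: a bi-infinite geodesic along
which `g` translates forward by its translation distance. -/
def IsAxis {V : Type u} (K : Set (Set V)) (g : Equiv.Perm V) (γ : ℤ → V) : Prop :=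
  (∀ i j : ℤ, (skeleton K).dist (γ i) (γ j) = (i - j).natAbs) ∧
    ∀ i : ℤ, g (γ i) = γ (i + translationDistance K g)

/-- The positive half-space axis: the half-spaces dual to a positively oriented edge of an axis. -/
def posHalfSpaceAxis {V : Type u} (K : Set (Set V)) (g : Equiv.Perm V) : Set (Set V) :=
  {H | ∃ γ : ℤ → V, IsAxis K g γ ∧ ∃ i : ℤ, H ∈ interval K (γ i) (γ (i + 1))}

/-- The full half-space axis: the half-spaces in the positive half-space axis and their opposites. -/
def halfSpaceAxis {V : Type u} (K : Set (Set V)) (g : Equiv.Perm V) : Set (Set V) :=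
  {H | H ∈ posHalfSpaceAxis K g ∨ Hᶜ ∈ posHalfSpaceAxis K g}

/-! ### The Sageev construction -/

/-- `σ` is an ultrafilter on the family `𝓗` of half-spaces satisfying the descending chain
condition. -/
structure IsPrincipalUltrafilter {V : Type u} (𝓗 σ : Set (Set V)) : Prop where
  subset : σ ⊆ 𝓗
  choice : ∀ H ∈ 𝓗, (H ∈ σ ↔ Hᶜ ∉ σ)
  inter_nonempty : ∀ H ∈ σ, ∀ H' ∈ σ, (H ∩ H').Nonempty
  descending : σ.IsWF

/-- The vertices of the complex `X(𝓗)` given by the Sageev construction. -/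
def SageevVertex {V : Type u} (𝓗 : Set (Set V)) : Type u :=
  {σ : Set (Set V) // IsPrincipalUltrafilter 𝓗 σ}

/-- Two vertices of `X(𝓗)` are adjacent if they differ on exactly one pair `{H, Hᶜ}`. -/
def SageevAdj {V : Type u} {𝓗 : Set (Set V)} (σ τ : SageevVertex 𝓗) : Prop :=
  ∃ H : Set V, σ.1 \ τ.1 = {H} ∧ τ.1 \ σ.1 = {Hᶜ}

/-- The cubes of `X(𝓗)`: a cube is present whenever its `1`-skeleton is present. -/
def sageevCubes {V : Type u} (𝓗 : Set (Set V)) : Set (Set (SageevVertex 𝓗)) :=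
  {Q | ∃ (n : ℕ) (φ : (Fin n → Bool) → SageevVertex 𝓗), Function.Injective φ ∧ Set.range φ = Q ∧
    ∀ a b : Fin n → Bool, (∃! i, a i ≠ b i) → SageevAdj (φ a) (φ b)}

/-! ### The essential minimal set -/

/-- The projection of the vertex `x` to the factor `X(𝓗)`: the restriction to `𝓗` of the principal
ultrafilter of `x`. -/
def projection {V : Type u} (𝓗 : Set (Set V)) (x : V) : Set (Set V) :=
  {H | H ∈ 𝓗 ∧ x ∈ H}

/-- The vertices of the essential minimal set of `g`: those vertices of the essential characteristic
set `X(halfSpaceAxis K g)` that are projections of vertices of the minimal set. -/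
def EssMinVertex {V : Type u} (K : Set (Set V)) (g : Equiv.Perm V) : Type u :=
  {σ : SageevVertex (halfSpaceAxis K g) //
    ∃ x ∈ minVertices K g, σ.1 = projection (halfSpaceAxis K g) x}

/-- The essential minimal set of `g`: the subcomplex of the essential characteristic set whose cubes
are the projections of the cubes of the minimal set. -/
def essMinSet {V : Type u} (K : Set (Set V)) (g : Equiv.Perm V) : Set (Set (EssMinVertex K g)) :=
  {Q | Subtype.val '' Q ∈ sageevCubes (halfSpaceAxis K g) ∧
    ∃ C ∈ K, C ⊆ minVertices K g ∧
      (fun q : EssMinVertex K g => q.1.1) '' Q = projection (halfSpaceAxis K g) '' C}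

end CubeCpx

/-!
The proof embeds the essential minimal set in the lattice of subsets of the positive half-space
axis `A⁺`, and recognizes it there as the cube complex of a discrete distributive lattice.

*CAT(0) cube complexes.* The geometry of `K` rests on the quadrangle condition
(`IsCAT0CubeComplex.quadrangle`): two neighbours of `v` nearer to `x` than `v` are opposite corners
of a square, whose remaining corner is nearer still. For edge paths up to square moves the
corresponding statement (`SqEquiv.lastEdges`) is local, a consequence of the flag condition in
dimension three. To transfer it to distances, edges act on reduced paths by cancelling or appending
(`stepTo`); homotopic paths act in the same way (`IsLocallyCAT0.act_homotopic`), so in a simply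
connected complex two geodesics with the same endpoints differ by square moves. The quadrangle
condition shows that the set of vertices closer to one endpoint of an edge than to the other depends
only on the hyperplane dual to the edge. These sets are therefore the half-spaces, only finitely
many of them separate two given vertices, they have gates, and the carriers of hyperplanes are
convex.

*Axes.* By Haglund's theorem (`IsCAT0CubeComplex.exists_axis`) every vertex `x` of the minimal set
lies on an axis. So all half-spaces that separate `x` from `g x` and contain `g x` lie in `A⁺`.
Moreover, if `x` lies in a half-space of `A⁺` then so does `g x`, and for every half-space of `A⁺`
the points `gⁿ x` lie in it for large `n` and outside it for large `-n`.

*The lattice.* A vertex of the essential minimal set is determined by the set of half-spaces of `A⁺`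
that contain it. If `y` lies in more half-spaces of `A⁺` than `x`, then among the half-spaces
containing `y` and `g x` but not `x` a maximal one is adjacent to `x`, and crossing it keeps `x` in
the minimal set (`IsCAT0CubeComplex.exists_move_up`). Hence the sets that occur are closed under
unions, dually under intersections, and can be joined by adding one half-space at a time. The cubes
of the essential minimal set are all the finite intervals among these sets, because such intervals
lift to cubes of the minimal set (`IsCAT0CubeComplex.exists_cube`).

*Lattices of sets.* The cube complex of such a family is CAT(0)
(`IsDiscreteLattice.isCAT0CubeComplex`): closure under medians gives the flag condition, and unions
serve to deform every edge path into an ascending path followed by a descending one.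
-/

namespace CubeCpx

variable {V : Type*} {K : Set (Set V)}

/-! ### Cubes, edges and squares -/

/-- The vertex of the standard cube `{0,1}ⁿ` obtained from `a` by changing the coordinate `i`. -/
def flipAt {n : ℕ} (a : Fin n → Bool) (i : Fin n) : Fin n → Bool :=
  Function.update a i (!(a i))

lemma flipAt_self {n : ℕ} (a : Fin n → Bool) (i : Fin n) : flipAt a i i = !(a i) := by
  simp [flipAt]

lemma flipAt_of_ne {n : ℕ} (a : Fin n → Bool) {i j : Fin n} (h : j ≠ i) : flipAt a i j = a j := by
  simp [flipAt, h]

lemma flipAt_ne {n : ℕ} (a : Fin n → Bool) (i : Fin n) : flipAt a i ≠ a := fun h => by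
  have := congrFun h i
  simp [flipAt_self] at this

lemma flipAt_injective {n : ℕ} (a : Fin n → Bool) : Function.Injective (flipAt a) := by
  intro i j h
  by_contra hij
  have := congrFun h i
  rw [flipAt_self, flipAt_of_ne _ hij] at this
  simp at this

lemma flipAt_flipAt {n : ℕ} (a : Fin n → Bool) (i : Fin n) : flipAt (flipAt a i) i = a := by
  ext j
  by_cases h : j = i
  · subst h; simp [flipAt_self]
  · simp [flipAt_of_ne _ h]

lemma flipAt_comm {n : ℕ} (a : Fin n → Bool) (i j : Fin n) :
    flipAt (flipAt a i) j = flipAt (flipAt a j) i := by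
  ext k
  by_cases hi : k = i <;> by_cases hj : k = j
  · subst hi; subst hj; rfl
  · subst hi; rw [flipAt_of_ne _ hj, flipAt_self, flipAt_self, flipAt_of_ne _ hj]
  · subst hj; rw [flipAt_self, flipAt_of_ne _ hi, flipAt_of_ne _ hi, flipAt_self]
  · rw [flipAt_of_ne _ hj, flipAt_of_ne _ hi, flipAt_of_ne _ hi, flipAt_of_ne _ hj]

lemma existsUnique_ne_iff {n : ℕ} (a b : Fin n → Bool) :
    (∃! i, a i ≠ b i) ↔ ∃ i, b = flipAt a i := by
  constructor
  · rintro ⟨i, hi, hu⟩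
    refine ⟨i, ?_⟩
    ext j
    by_cases h : j = i
    · subst h
      rw [flipAt_self]
      revert hi
      cases a j <;> cases b j <;> simp
    · rw [flipAt_of_ne _ h]
      by_contra hne
      exact h (hu j (Ne.symm hne))
  · rintro ⟨i, rfl⟩
    refine ⟨i, by simp [flipAt_self], fun j hj => ?_⟩
    by_contra h
    exact hj (flipAt_of_ne _ h).symm

lemma cubeFace_compl_singleton {n : ℕ} (i : Fin n) (a : Fin n → Bool) :
    cubeFace {i}ᶜ a = {a, flipAt a i} := by
  ext x
  simp only [cubeFace, Set.mem_compl_iff, Set.mem_singleton_iff, Set.mem_ofPred_eq,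
    Set.mem_insert_iff]
  constructor
  · intro h
    by_cases hi : x i = a i
    · left
      ext j
      by_cases hj : j = i
      · rw [hj, hi]
      · rw [h j hj]
    · right
      ext j
      by_cases hj : j = i
      · subst hj
        rw [flipAt_self]
        revert hi
        cases x j <;> cases a j <;> simp
      · rw [flipAt_of_ne _ hj, h j hj]
  · rintro (rfl | rfl) j hj
    · rfl
    · exact flipAt_of_ne _ hj

lemma cubeFace_compl_pair {n : ℕ} (i j : Fin n) (a : Fin n → Bool) :
    cubeFace {i, j}ᶜ a = {a, flipAt a i, flipAt (flipAt a i) j, flipAt a j} := by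
  ext x
  simp only [cubeFace, Set.mem_compl_iff, Set.mem_singleton_iff, Set.mem_ofPred_eq,
    Set.mem_insert_iff, not_or]
  constructor
  · intro h
    by_cases hi : x i = a i
    · have : x ∈ cubeFace {j}ᶜ a := by
        intro k hk
        by_cases hki : k = i
        · rw [hki, hi]
        · exact h k ⟨hki, hk⟩
      rw [cubeFace_compl_singleton] at this
      rcases this with h | h
      · exact Or.inl h
      · exact Or.inr (Or.inr (Or.inr h))
    · have : x ∈ cubeFace {j}ᶜ (flipAt a i) := by
        intro k hk
        by_cases hki : k = i
        · subst hki
          rw [flipAt_self]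
          revert hi
          cases x k <;> cases a k <;> simp
        · rw [flipAt_of_ne _ hki]
          exact h k ⟨hki, hk⟩
      rw [cubeFace_compl_singleton] at this
      rcases this with h | h
      · exact Or.inr (Or.inl h)
      · exact Or.inr (Or.inr (Or.inl h))
  · rintro (rfl | rfl | rfl | rfl) k ⟨hki, hkj⟩
    · rfl
    · exact flipAt_of_ne _ hki
    · rw [flipAt_of_ne _ hkj, flipAt_of_ne _ hki]
    · exact flipAt_of_ne _ hkj

/-- `φ` parametrizes the cube `C` of `K` by a standard cube, with the same faces. -/
structure IsParam (K : Set (Set V)) (C : Set V) {n : ℕ} (φ : (Fin n → Bool) → V) : Prop where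
  inj : Function.Injective φ
  range : Set.range φ = C
  faces : ∀ D : Set V, D ⊆ C →
    (D ∈ K ↔ ∃ (S : Set (Fin n)) (a : Fin n → Bool), D = φ '' cubeFace S a)

lemma IsCubeComplex.exists_param (hK : IsCubeComplex K) {C : Set V} (hC : C ∈ K) :
    ∃ (n : ℕ) (φ : (Fin n → Bool) → V), IsParam K C φ := by
  obtain ⟨n, φ, h1, h2, h3⟩ := hK.isCube C hC
  exact ⟨n, φ, h1, h2, h3⟩

namespace IsParam

variable {C : Set V} {n : ℕ} {φ : (Fin n → Bool) → V}

lemma image_face_mem (h : IsParam K C φ) (S : Set (Fin n)) (a : Fin n → Bool) :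
    φ '' cubeFace S a ∈ K := by
  refine (h.faces _ ?_).2 ⟨S, a, rfl⟩
  rw [← h.range]
  exact Set.image_subset_range _ _

lemma adj_iff (h : IsParam K C φ) (a b : Fin n → Bool) :
    (skeleton K).Adj (φ a) (φ b) ↔ ∃ i, b = flipAt a i := by
  constructor
  · rintro ⟨hne, hmem⟩
    have hsub : ({φ a, φ b} : Set V) ⊆ C := by
      rw [← h.range]
      rintro x (rfl | rfl) <;> exact Set.mem_range_self _
    obtain ⟨S, c, hS⟩ := (h.faces _ hsub).1 hmem
    rw [← Set.image_pair, h.inj.image_injective.eq_iff] at hS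
    have hab : a ≠ b := fun hab => hne (by rw [hab])
    have ha : a ∈ cubeFace S c := hS ▸ Set.mem_insert _ _
    have hb : b ∈ cubeFace S c := hS ▸ Set.mem_insert_of_mem _ rfl
    obtain ⟨i, hi⟩ := Function.ne_iff.1 hab
    have hiS : i ∉ S := fun hiS => hi ((ha i hiS).trans (hb i hiS).symm)
    have hf : flipAt a i ∈ cubeFace S c := by
      intro j hj
      rw [flipAt_of_ne _ (fun hji : j = i => hiS (hji ▸ hj))]
      exact ha j hj
    rw [← hS] at hf
    rcases hf with hf | hf
    · exact absurd hf (flipAt_ne a i)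
    · exact ⟨i, hf.symm⟩
  · rintro ⟨i, rfl⟩
    refine ⟨fun hne => flipAt_ne a i (h.inj hne).symm, ?_⟩
    have := h.image_face_mem {i}ᶜ a
    rwa [cubeFace_compl_singleton, Set.image_pair] at this

lemma isSquare (h : IsParam K C φ) (a : Fin n → Bool) {i j : Fin n} (hij : i ≠ j) :
    IsSquare K (φ a) (φ (flipAt a i)) (φ (flipAt (flipAt a i) j)) (φ (flipAt a j)) where
  mem := by
    have := h.image_face_mem {i, j}ᶜ a
    rwa [cubeFace_compl_pair, Set.image_insert_eq, Set.image_insert_eq, Set.image_pair] at this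
  adj_ab := (h.adj_iff _ _).2 ⟨i, rfl⟩
  adj_bc := (h.adj_iff _ _).2 ⟨j, rfl⟩
  adj_cd := (h.adj_iff _ _).2 ⟨i, by rw [flipAt_comm, flipAt_flipAt]⟩
  adj_da := (h.adj_iff _ _).2 ⟨j, by rw [flipAt_flipAt]⟩
  ne_ac := fun he => by
    have := congrFun (h.inj he) j
    rw [flipAt_self, flipAt_of_ne _ hij.symm] at this
    simp at this
  ne_bd := fun he => hij (flipAt_injective a (h.inj he))

end IsParam

namespace IsSquare

variable {a b c d : V}

lemma reverse (h : IsSquare K a b c d) : IsSquare K a d c b where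
  mem := by
    have := h.mem
    rwa [show ({a, b, c, d} : Set V) = {a, d, c, b} by ext; simp; tauto] at this
  adj_ab := h.adj_da.symm
  adj_bc := h.adj_cd.symm
  adj_cd := h.adj_bc.symm
  adj_da := h.adj_ab.symm
  ne_ac := h.ne_ac
  ne_bd := h.ne_bd.symm

lemma rotate (h : IsSquare K a b c d) : IsSquare K b c d a where
  mem := by
    have := h.mem
    rwa [show ({a, b, c, d} : Set V) = {b, c, d, a} by ext; simp; tauto] at this
  adj_ab := h.adj_bc
  adj_bc := h.adj_cd
  adj_cd := h.adj_da
  adj_da := h.adj_ab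
  ne_ac := h.ne_bd
  ne_bd := h.ne_ac.symm

end IsSquare

/-- Two squares sharing two consecutive edges coincide: otherwise they would meet in exactly three
vertices, which is not the number of vertices of a cube. -/
lemma IsCubeComplex.square_unique (hK : IsCubeComplex K) {a b c d d' : V}
    (h : IsSquare K a b c d) (h' : IsSquare K a b c d') : d = d' := by
  by_contra hd
  have hI : ({a, b, c, d} ∩ {a, b, c, d'} : Set V) = {a, b, c} := by
    ext x
    simp only [Set.mem_inter_iff, Set.mem_insert_iff, Set.mem_singleton_iff]
    constructor
    · rintro ⟨h1 | h1 | h1 | h1, h2 | h2 | h2 | h2⟩ <;> first | tauto | skip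
      exact absurd (h1.symm.trans h2) hd
    · tauto
  have hm := hK.inter_mem _ h.mem _ h'.mem ⟨a, by simp⟩
  rw [hI] at hm
  obtain ⟨n, φ, hφ⟩ := hK.exists_param hm
  have hcard : Nat.card (Set.range φ) = 2 ^ n := by
    rw [Nat.card_range_of_injective hφ.inj]
    simp
  rw [hφ.range, Nat.card_coe_set_eq,
    Set.ncard_eq_three.2 ⟨a, b, c, h.adj_ab.ne, h.ne_ac, h.adj_bc.ne, rfl⟩] at hcard
  -- A power of two is not three.
  rcases n with _ | _ | n
  · simp at hcard
  · simp at hcard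
  · have : 2 ∣ 3 := hcard ▸ ⟨2 ^ (n + 1), by ring⟩
    omega

/-- No three vertices are pairwise adjacent. -/
def TriangleFree (K : Set (Set V)) : Prop :=
  ∀ x y z : V, (skeleton K).Adj x y → (skeleton K).Adj y z → ¬ (skeleton K).Adj x z

/-- A square yields an edge of the link at its corner `a`. Triangles have to be excluded, since
simplices of the link are recorded by the neighbours of `a` in a cube, and the vertex opposite to `a`
must not be one of them. -/
lemma pair_mem_link {a b c d : V} (htri : TriangleFree K) (h : IsSquare K a b c d) :
    {b, d} ∈ link K a := by
  refine ⟨{a, b, c, d}, h.mem, by simp, ?_⟩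
  ext w
  simp only [Set.mem_insert_iff, Set.mem_singleton_iff, Set.mem_ofPred_eq]
  constructor
  · rintro (rfl | rfl)
    · exact ⟨by simp, h.adj_ab⟩
    · exact ⟨by simp, h.adj_da.symm⟩
  · rintro ⟨rfl | rfl | rfl | rfl, hw⟩
    · exact absurd rfl hw.ne
    · exact Or.inl rfl
    · exact absurd hw (htri _ _ _ h.adj_ab h.adj_bc)
    · exact Or.inr rfl

/-- The flag condition in dimension three: three squares pairwise sharing an edge at the vertex `u`
are faces of a common `3`-cube, whose vertex opposite to `u` is `t`. -/
lemma exists_threeCube (hK : IsCubeComplex K) (hN : IsNonpositivelyCurved K)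
    (htri : TriangleFree K)
    {u p q r x y z : V} (hpq : IsSquare K u p x q) (hqr : IsSquare K u q y r)
    (hpr : IsSquare K u p z r) :
    ∃ t, IsSquare K p x t z ∧ IsSquare K q x t y ∧ IsSquare K r y t z := by
  have hl : ({p, q, r} : Set V) ∈ link K u := by
    refine hN u _ (by simp) ?_ ?_
    · rintro a (rfl | rfl | rfl)
      · exact hpq.adj_ab
      · exact hqr.adj_ab
      · exact hpr.adj_da.symm
    · have h1 := pair_mem_link htri hpq
      have h2 := pair_mem_link htri hqr
      have h3 := pair_mem_link htri hpr
      have h1' := pair_mem_link htri hpq.reverse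
      have h2' := pair_mem_link htri hqr.reverse
      have h3' := pair_mem_link htri hpr.reverse
      rintro a (rfl | rfl | rfl) b (rfl | rfl | rfl) hab <;>
        first | assumption | exact absurd rfl hab
  obtain ⟨C, hC, huC, hA⟩ := hl
  obtain ⟨n, φ, hφ⟩ := hK.exists_param hC
  rw [← hφ.range] at huC
  obtain ⟨a, rfl⟩ := huC
  have key : ∀ w ∈ ({p, q, r} : Set V), ∃ i, φ (flipAt a i) = w := by
    intro w hw
    rw [hA] at hw
    obtain ⟨hwC, hadj⟩ := hw
    rw [← hφ.range] at hwC
    obtain ⟨b, rfl⟩ := hwC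
    obtain ⟨i, rfl⟩ := (hφ.adj_iff _ _).1 hadj
    exact ⟨i, rfl⟩
  obtain ⟨i, rfl⟩ := key p (by simp)
  obtain ⟨j, rfl⟩ := key q (by simp)
  obtain ⟨k, rfl⟩ := key r (by simp)
  have hij : i ≠ j := fun h => hpq.ne_bd (by rw [h])
  have hjk : j ≠ k := fun h => hqr.ne_bd (by rw [h])
  have hik : i ≠ k := fun h => hpr.ne_bd (by rw [h])
  have hx : φ (flipAt (flipAt a i) j) = x :=
    hK.square_unique (hφ.isSquare a hij).rotate.rotate.rotate hpq.rotate.rotate.rotate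
  have hy : φ (flipAt (flipAt a j) k) = y :=
    hK.square_unique (hφ.isSquare a hjk).rotate.rotate.rotate hqr.rotate.rotate.rotate
  have hz : φ (flipAt (flipAt a i) k) = z :=
    hK.square_unique (hφ.isSquare a hik).rotate.rotate.rotate hpr.rotate.rotate.rotate
  subst hx hy hz
  refine ⟨φ (flipAt (flipAt (flipAt a i) j) k), hφ.isSquare _ hjk, ?_, ?_⟩
  · have := hφ.isSquare (flipAt a j) hik
    rwa [flipAt_comm a j i] at this
  · have := hφ.isSquare (flipAt a k) hij.symm
    rwa [flipAt_comm a k j, flipAt_comm a k i, flipAt_comm (flipAt a j) k i,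
      flipAt_comm a j i] at this

/-! ### Edge paths up to square moves -/

/-- Two edge paths are related if they differ by a sequence of square moves, without any
cancellation of backtracks. A path is recorded by the list of its vertices, starting from its
*last* vertex. -/
inductive SqEquiv (K : Set (Set V)) : List V → List V → Prop
  | refl (l : List V) : SqEquiv K l l
  | symm {l l' : List V} : SqEquiv K l l' → SqEquiv K l' l
  | trans {l l' l'' : List V} : SqEquiv K l l' → SqEquiv K l' l'' → SqEquiv K l l''
  | cons (v : V) {l l' : List V} : SqEquiv K l l' → SqEquiv K (v :: l) (v :: l')
  | square {w u v u' : V} (h : IsSquare K w u v u') (l : List V) :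
      SqEquiv K (v :: u :: w :: l) (v :: u' :: w :: l)

namespace SqEquiv

lemma length_eq {l l' : List V} (h : SqEquiv K l l') : l.length = l'.length := by
  induction h with
  | refl => rfl
  | symm _ ih => exact ih.symm
  | trans _ _ ih ih' => exact ih.trans ih'
  | cons v _ ih => simp [ih]
  | square => rfl

lemma head?_eq {l l' : List V} (h : SqEquiv K l l') : l.head? = l'.head? := by
  induction h with
  | refl => rfl
  | symm _ ih => exact ih.symm
  | trans _ _ ih ih' => exact ih.trans ih'
  | cons v _ ih => rfl
  | square => rfl

lemma getLast?_eq {l l' : List V} (h : SqEquiv K l l') : l.getLast? = l'.getLast? := by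
  induction h with
  | refl => rfl
  | symm _ ih => exact ih.symm
  | trans _ _ ih ih' => exact ih.trans ih'
  | cons v _ ih => simp [List.getLast?_cons, ih]
  | square => simp [List.getLast?_cons]

lemma isChain_iff {l l' : List V} (h : SqEquiv K l l') :
    l.IsChain (skeleton K).Adj ↔ l'.IsChain (skeleton K).Adj := by
  induction h with
  | refl => rfl
  | symm _ ih => exact ih.symm
  | trans _ _ ih ih' => exact ih.trans ih'
  | cons v h ih => rw [List.isChain_cons, List.isChain_cons, ih, h.head?_eq]
  | square h l =>
    simp [List.isChain_cons_cons, h.adj_bc.symm, h.adj_ab.symm, h.adj_cd, h.adj_da]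

end SqEquiv

/-- The possible relations between the last edges of two paths `v :: u :: l` and `v :: u' :: l'`
that differ by square moves: the last edges agree, or they are two sides of a square and both paths
can be deformed so as to reach `v` across that square. -/
def LastEdges (K : Set (Set V)) (v u : V) (l : List V) (u' : V) (l' : List V) : Prop :=
  (u = u' ∧ SqEquiv K (u :: l) (u' :: l')) ∨
    ∃ w m, IsSquare K w u v u' ∧ SqEquiv K (u :: l) (u :: w :: m) ∧
      SqEquiv K (u' :: l') (u' :: w :: m)

lemma LastEdges.symm {v u u' : V} {l l' : List V} (h : LastEdges K v u l u' l') :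
    LastEdges K v u' l' u l := by
  rcases h with ⟨rfl, h⟩ | ⟨w, m, h1, h2, h3⟩
  · exact Or.inl ⟨rfl, h.symm⟩
  · exact Or.inr ⟨w, m, h1.reverse, h3, h2⟩

/-- The relation `LastEdges` is transitive, if square moves between shorter paths are understood.
The main case produces three squares around a vertex, which the flag condition completes to a
`3`-cube. -/
lemma LastEdges.trans (hK : IsCubeComplex K) (hN : IsNonpositivelyCurved K)
    (htri : TriangleFree K) {n : ℕ}
    (IH : ∀ (l : List V), l.length < n → ∀ (v u : V) (v' u' : V) (l' : List V),
      SqEquiv K (v :: u :: l) (v' :: u' :: l') → LastEdges K v u l u' l')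
    {v u₁ u₂ u₃ : V} {l₁ l₂ l₃ : List V} (hn : l₁.length = n)
    (h : LastEdges K v u₁ l₁ u₂ l₂) (h' : LastEdges K v u₂ l₂ u₃ l₃) :
    LastEdges K v u₁ l₁ u₃ l₃ := by
  rcases h with ⟨rfl, h⟩ | ⟨w, m, hs, h1, h2⟩
  · rcases h' with ⟨rfl, h'⟩ | ⟨w', m', hs', h1', h2'⟩
    · exact Or.inl ⟨rfl, h.trans h'⟩
    · exact Or.inr ⟨w', m', hs', h.trans h1', h2'⟩
  rcases h' with ⟨rfl, h'⟩ | ⟨w', m', hs', h1', h2'⟩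
  · exact Or.inr ⟨w, m, hs, h1, h'.symm.trans h2⟩
  have hm : m.length < n := by
    have := h1.length_eq
    simp at this
    omega
  rcases IH m hm _ _ _ _ _ (h2.symm.trans h1') with ⟨rfl, h⟩ | ⟨t, k, hq, h3, h4⟩
  · obtain rfl : u₁ = u₃ := hK.square_unique hs.rotate.rotate hs'.reverse.rotate.rotate
    exact Or.inl ⟨rfl, (h1.trans (h.cons _)).trans h2'.symm⟩
  · obtain ⟨s, hs1, hs2, hs3⟩ := exists_threeCube hK hN htri (u := u₂) (p := v) (q := w) (r := w')
      (x := u₁) (y := t) (z := u₃) hs.rotate.rotate.rotate.reverse hq.rotate.rotate.reverse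
      hs'.rotate
    refine Or.inr ⟨s, t :: k, hs1.rotate.rotate.reverse, ?_, ?_⟩
    · exact h1.trans ((h3.cons _).trans (.square hs2.rotate.rotate.rotate _))
    · exact h2'.trans ((h4.cons _).trans (.square hs3.reverse.rotate.rotate.rotate _))

/-- The quadrangle condition for edge paths up to square moves. The proof is by induction on the
length: along a sequence of square moves, only those at the end of the path change the last edge, and
they compose by `LastEdges.trans`. -/
theorem SqEquiv.lastEdges (hK : IsCubeComplex K) (hN : IsNonpositivelyCurved K)
    (htri : TriangleFree K) {v u v' u' : V} {l l' : List V}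
    (h : SqEquiv K (v :: u :: l) (v' :: u' :: l')) : LastEdges K v u l u' l' := by
  suffices H : ∀ n : ℕ, ∀ l : List V, l.length < n → ∀ (v u : V) (v' u' : V) (l' : List V),
      SqEquiv K (v :: u :: l) (v' :: u' :: l') → LastEdges K v u l u' l' from
    H _ l (Nat.lt_succ_self _) v u v' u' l' h
  clear h
  intro n
  induction n with
  | zero => intro l hl; omega
  | succ n IH =>
    intro l hl v u v' u' l' h
    rcases Nat.lt_succ_iff_lt_or_eq.1 hl with hl | hl
    · exact IH l hl v u v' u' l' h
    generalize hL : v :: u :: l = L at h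
    generalize hL' : v' :: u' :: l' = L' at h
    induction h generalizing v u l v' u' l' with
    | refl =>
      obtain ⟨rfl, rfl, rfl⟩ : v = v' ∧ u = u' ∧ l = l' := by simpa using hL.trans hL'.symm
      exact Or.inl ⟨rfl, .refl _⟩
    | symm h ih =>
      have hlen := h.length_eq
      rw [← hL, ← hL'] at hlen
      simp at hlen
      have hv := h.head?_eq
      rw [← hL, ← hL'] at hv
      obtain rfl : v' = v := by simpa using hv
      exact (ih l' (by omega) v' u' v' u l (by omega) hL' hL).symm
    | @trans L₁ L₂ L₃ h h' ih ih' =>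
      have hlen := h.length_eq
      obtain ⟨v₂, u₂, l₂, rfl⟩ : ∃ v₂ u₂ l₂, L₂ = v₂ :: u₂ :: l₂ := by
        rw [← hL] at hlen
        match L₂, hlen with
        | a :: b :: l₂, _ => exact ⟨a, b, l₂, rfl⟩
      rw [← hL] at hlen
      simp at hlen
      have hv := h.head?_eq
      rw [← hL] at hv
      obtain rfl : v = v₂ := by simpa using hv
      exact (ih l (by omega) v u v u₂ l₂ hl hL rfl).trans hK hN htri IH hl
        (ih' l₂ (by omega) v u₂ v' u' l' (by omega) rfl hL')
    | cons x h ih =>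
      simp only [List.cons.injEq] at hL hL'
      obtain ⟨rfl, rfl⟩ := hL
      obtain ⟨rfl, rfl⟩ := hL'
      have hv := h.head?_eq
      obtain rfl : u = u' := by simpa using hv
      exact Or.inl ⟨rfl, h⟩
    | @square w₀ u₀ v₀ u₀' hs k =>
      simp only [List.cons.injEq] at hL hL'
      obtain ⟨rfl, rfl, rfl⟩ := hL
      obtain ⟨rfl, rfl, rfl⟩ := hL'
      exact Or.inr ⟨w₀, k, hs, .refl _, .refl _⟩

/-- Edge paths up to square moves are right cancellative. -/
lemma SqEquiv.cancel (hK : IsCubeComplex K) (hN : IsNonpositivelyCurved K)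
    (htri : TriangleFree K) {v u : V} {l l' : List V}
    (h : SqEquiv K (v :: u :: l) (v :: u :: l')) : SqEquiv K (u :: l) (u :: l') := by
  rcases h.lastEdges hK hN htri with ⟨_, h⟩ | ⟨w, m, hs, _⟩
  · exact h
  · exact absurd rfl hs.ne_bd

/-! ### Reduced edge paths and the action of edge paths on them -/

/-- The path contains a backtrack. -/
def HasBacktrack (l : List V) : Prop :=
  ∃ (p : List V) (a b : V) (q : List V), l = p ++ a :: b :: a :: q

/-- No sequence of square moves creates a backtrack. -/
def IsReduced (K : Set (Set V)) (l : List V) : Prop :=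
  ∀ l', SqEquiv K l l' → ¬ HasBacktrack l'

lemma HasBacktrack.cons {l : List V} (h : HasBacktrack l) (v : V) : HasBacktrack (v :: l) := by
  obtain ⟨p, a, b, q, rfl⟩ := h
  exact ⟨v :: p, a, b, q, rfl⟩

lemma IsReduced.of_cons {v : V} {l : List V} (h : IsReduced K (v :: l)) : IsReduced K l :=
  fun _ hl hb => h _ (hl.cons v) (hb.cons v)

lemma IsReduced.congr {l l' : List V} (h : IsReduced K l) (hl : SqEquiv K l l') :
    IsReduced K l' :=
  fun _ hm => h _ (hl.trans hm)

/-- If lengthening a reduced path by the edge from `x` to `v` creates a backtrack, then the path can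
be deformed so as to end with the inverse edge. The backtrack either is at the end, or can be moved
across a square to a shorter path. -/
lemma exists_cancel_of_hasBacktrack (hK : IsCubeComplex K) (hN : IsNonpositivelyCurved K)
    (htri : TriangleFree K) :
    ∀ (r : List V) (v x : V) (l : List V), IsReduced K (x :: r) → SqEquiv K (v :: x :: r) l →
      HasBacktrack l → ∃ t, SqEquiv K (x :: r) (x :: v :: t) := by
  intro r
  induction hn : r.length using Nat.strong_induction_on generalizing r with
  | _ n IH =>
    intro v x l hr hl hb
    obtain ⟨p, a, b, q, rfl⟩ := hb
    rcases p with _ | ⟨c, p⟩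
    · obtain rfl : v = a := by simpa using hl.head?_eq
      rcases hl.lastEdges hK hN htri with ⟨rfl, h⟩ | ⟨w, m, hs, h1, h2⟩
      · exact ⟨q, h⟩
      rcases h2.lastEdges hK hN htri with ⟨rfl, _⟩ | ⟨w', m', hs', h3, h4⟩
      · exact absurd rfl hs.ne_ac
      · obtain rfl : x = w' := hK.square_unique hs.rotate.rotate hs'.rotate
        exact absurd ⟨[], x, w, m', rfl⟩ (hr _ (h1.trans (h4.cons x)))
    · obtain ⟨y, k, hy⟩ : ∃ y k, p ++ a :: b :: a :: q = y :: k := by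
        cases p <;> simp
      have hyb : HasBacktrack (y :: k) := ⟨p, a, b, q, hy.symm⟩
      rw [List.cons_append, hy] at hl
      obtain rfl : v = c := by simpa using hl.head?_eq
      rcases hl.lastEdges hK hN htri with ⟨rfl, h⟩ | ⟨w, m, hs, h1, h2⟩
      · exact absurd hyb (hr _ h)
      have hlen := h1.length_eq
      simp at hlen
      obtain ⟨t, ht⟩ := IH m.length (by omega) m rfl y w (y :: k)
        (hr.congr h1).of_cons h2.symm hyb
      exact ⟨y :: t, h1.trans ((ht.cons x).trans (.square hs.rotate.rotate.rotate _))⟩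

/-- The path can be deformed by square moves so that its last edge comes from `v`. -/
def EndsFrom (K : Set (Set V)) (v : V) (r : List V) : Prop :=
  ∃ x t, SqEquiv K r (x :: v :: t)

lemma EndsFrom.congr {v : V} {r r' : List V} (h : EndsFrom K v r) (hr : SqEquiv K r r') :
    EndsFrom K v r' := by
  obtain ⟨x, t, h⟩ := h
  exact ⟨x, t, hr.symm.trans h⟩

open Classical in
/-- The action on paths of an edge with endpoint `v`: if the path can be deformed so that it ends
with the inverse edge, that edge is deleted; otherwise the new edge is appended. -/
noncomputable def stepTo (K : Set (Set V)) (v : V) (r : List V) : List V :=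
  if h : EndsFrom K v r then v :: h.choose_spec.choose else v :: r

lemma stepTo_of_not {v : V} {r : List V} (h : ¬ EndsFrom K v r) : stepTo K v r = v :: r := by
  simp [stepTo, h]

lemma exists_stepTo_eq (v : V) (r : List V) : ∃ t, stepTo K v r = v :: t := by
  unfold stepTo
  split <;> exact ⟨_, rfl⟩

lemma exists_of_endsFrom {v : V} {r : List V} (h : EndsFrom K v r) :
    ∃ x t, SqEquiv K r (x :: v :: t) ∧ stepTo K v r = v :: t :=
  ⟨h.choose, h.choose_spec.choose, h.choose_spec.choose_spec, by simp [stepTo, h]⟩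

/-- The local properties of a cube complex under which the action of edges on reduced paths is
analysed. -/
structure IsLocallyCAT0 (K : Set (Set V)) : Prop where
  isCubeComplex : IsCubeComplex K
  nonpositivelyCurved : IsNonpositivelyCurved K
  triangleFree : TriangleFree K

namespace IsLocallyCAT0

variable (hK : IsLocallyCAT0 K)

include hK

lemma stepTo_equiv {x v : V} {r t : List V} (h : SqEquiv K r (x :: v :: t)) :
    SqEquiv K (stepTo K v r) (v :: t) := by
  obtain ⟨x', t', h', he⟩ := exists_of_endsFrom ⟨x, t, h⟩
  rw [he]
  have h2 := h'.symm.trans h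
  obtain rfl : x' = x := by simpa using h2.head?_eq
  exact h2.cancel hK.1 hK.2 hK.3

lemma stepTo_congr {v : V} {r r' : List V} (h : SqEquiv K r r') :
    SqEquiv K (stepTo K v r) (stepTo K v r') := by
  by_cases hr : EndsFrom K v r
  · obtain ⟨x, t, h1⟩ := hr
    exact (hK.stepTo_equiv h1).trans (hK.stepTo_equiv (h.symm.trans h1)).symm
  · rw [stepTo_of_not hr, stepTo_of_not fun hr' => hr (hr'.congr h.symm)]
    exact h.cons v

lemma isReduced_stepTo {x v : V} {r : List V} (h : IsReduced K (x :: r)) :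
    IsReduced K (stepTo K v (x :: r)) := by
  by_cases hr : EndsFrom K v (x :: r)
  · obtain ⟨y, t, h1, h2⟩ := exists_of_endsFrom hr
    rw [h2]
    exact (h.congr h1).of_cons
  · rw [stepTo_of_not hr]
    intro l hl hb
    obtain ⟨t, ht⟩ := exists_cancel_of_hasBacktrack hK.1 hK.2 hK.3 r v x l h hl hb
    exact hr ⟨x, t, ht⟩

lemma stepTo_stepTo {x v : V} {r : List V} (h : IsReduced K (x :: r)) :
    SqEquiv K (stepTo K x (stepTo K v (x :: r))) (x :: r) := by
  by_cases hr : EndsFrom K v (x :: r)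
  · obtain ⟨y, t, h1, h2⟩ := exists_of_endsFrom hr
    obtain rfl : x = y := by simpa using h1.head?_eq
    rw [h2, stepTo_of_not]
    · exact h1.symm
    · rintro ⟨z, s, hs⟩
      obtain rfl : v = z := by simpa using hs.head?_eq
      exact h _ (h1.trans (hs.cons x)) ⟨[], x, v, s, rfl⟩
  · rw [stepTo_of_not hr]
    exact hK.stepTo_equiv (.refl _)

lemma stepTo_square_aux {a b c d : V} (hs : IsSquare K a b c d) {r : List V}
    (hb : EndsFrom K b (a :: r)) (hd : ¬ EndsFrom K d (a :: r)) :
    SqEquiv K (stepTo K c (stepTo K b (a :: r))) (stepTo K c (stepTo K d (a :: r))) := by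
  obtain ⟨y, t, h1, h2⟩ := exists_of_endsFrom hb
  obtain rfl : a = y := by simpa using h1.head?_eq
  rw [h2, stepTo_of_not hd, stepTo_of_not]
  · have h3 : SqEquiv K (d :: a :: r) (d :: c :: b :: t) :=
      (h1.cons d).trans (.square hs.reverse.rotate.rotate.rotate t)
    exact (hK.stepTo_equiv h3).symm
  · rintro ⟨z, s, h3⟩
    obtain rfl : b = z := by simpa using h3.head?_eq
    exact hd ⟨a, _, h1.trans ((h3.cons a).trans (.square hs.rotate.rotate.reverse s))⟩

lemma stepTo_square {a b c d : V} (hs : IsSquare K a b c d) (r : List V) :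
    SqEquiv K (stepTo K c (stepTo K b (a :: r))) (stepTo K c (stepTo K d (a :: r))) := by
  by_cases hb : EndsFrom K b (a :: r) <;> by_cases hd : EndsFrom K d (a :: r)
  · obtain ⟨y, t, h1, h2⟩ := exists_of_endsFrom hb
    obtain rfl : a = y := by simpa using h1.head?_eq
    obtain ⟨y', t', h1', h2'⟩ := exists_of_endsFrom hd
    obtain rfl : a = y' := by simpa using h1'.head?_eq
    rcases (h1.symm.trans h1').lastEdges hK.1 hK.2 hK.3 with ⟨rfl, _⟩ | ⟨w, m, hs', h3, h4⟩
    · exact absurd rfl hs.ne_bd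
    obtain rfl : c = w := hK.1.square_unique hs.rotate.rotate.rotate hs'.reverse.rotate
    rw [h2, h2']
    exact (hK.stepTo_equiv h3).trans (hK.stepTo_equiv h4).symm
  · exact hK.stepTo_square_aux hs hb hd
  · exact (hK.stepTo_square_aux hs.reverse hd hb).symm
  · have key : ∀ {b d : V}, IsSquare K a b c d → ¬ EndsFrom K d (a :: r) →
        ¬ EndsFrom K c (b :: a :: r) := by
      rintro b d hs hd ⟨z, s, h3⟩
      obtain rfl : b = z := by simpa using h3.head?_eq
      rcases h3.lastEdges hK.1 hK.2 hK.3 with ⟨rfl, _⟩ | ⟨w, m, hs', h4, _⟩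
      · exact absurd rfl hs.ne_ac
      · obtain rfl : d = w := hK.1.square_unique hs hs'.rotate
        exact hd ⟨a, m, h4⟩
    rw [stepTo_of_not hb, stepTo_of_not hd, stepTo_of_not (key hs hd),
      stepTo_of_not (key hs.reverse hb)]
    exact .square hs r

end IsLocallyCAT0

/-- The action of an edge path on paths, one edge at a time. -/
noncomputable def act (K : Set (Set V)) :
    ∀ {x y : V}, (skeleton K).Walk x y → List V → List V
  | _, _, .nil, r => r
  | _, _, .cons (v := v) _ p, r => act K p (stepTo K v r)

lemma act_append {x y z : V} (p : (skeleton K).Walk x y) (q : (skeleton K).Walk y z)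
    (r : List V) : act K (p.append q) r = act K q (act K p r) := by
  induction p generalizing r with
  | nil => rfl
  | cons h p ih => exact ih q _

lemma exists_act_eq {x y : V} (p : (skeleton K).Walk x y) (r : List V) :
    ∃ t, act K p (x :: r) = y :: t := by
  induction p generalizing r with
  | nil => exact ⟨r, rfl⟩
  | @cons u v w h p ih =>
    obtain ⟨t, ht⟩ := exists_stepTo_eq (K := K) v (u :: r)
    rw [act, ht]
    exact ih t

lemma length_stepTo (v : V) (r : List V) : (stepTo K v r).length = r.length + 1 ∧
    stepTo K v r = v :: r ∨ (stepTo K v r).length + 1 = r.length := by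
  by_cases h : EndsFrom K v r
  · obtain ⟨x, t, h1, h2⟩ := exists_of_endsFrom h
    rw [h2, h1.length_eq]
    simp
  · rw [stepTo_of_not h]
    simp

lemma length_act_le {x y : V} (p : (skeleton K).Walk x y) (r : List V) :
    (act K p r).length ≤ r.length + p.length := by
  induction p generalizing r with
  | nil => simp [act]
  | @cons u v w h p ih =>
    have h1 := length_stepTo (K := K) v r
    have h2 := ih (stepTo K v r)
    rw [act, SimpleGraph.Walk.length_cons]
    omega

/-- The list is an edge path from `x` to `y`. -/
def IsPathFromTo (K : Set (Set V)) (x y : V) (r : List V) : Prop :=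
  r.IsChain (skeleton K).Adj ∧ r.head? = some y ∧ r.getLast? = some x

lemma IsPathFromTo.congr {x y : V} {r r' : List V} (h : IsPathFromTo K x y r)
    (hr : SqEquiv K r r') : IsPathFromTo K x y r' :=
  ⟨hr.isChain_iff.1 h.1, hr.head?_eq ▸ h.2.1, hr.getLast?_eq ▸ h.2.2⟩

lemma IsPathFromTo.tail {x y z : V} {r : List V} (h : IsPathFromTo K x y (y :: z :: r)) :
    IsPathFromTo K x z (z :: r) :=
  ⟨h.1.tail, rfl, by have := h.2.2; simpa [List.getLast?_cons] using this⟩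

lemma IsPathFromTo.stepTo {x y z : V} {r : List V} (h : IsPathFromTo K x y r)
    (hz : (skeleton K).Adj y z) : IsPathFromTo K x z (stepTo K z r) := by
  by_cases hr : EndsFrom K z r
  · obtain ⟨w, t, h1, h2⟩ := exists_of_endsFrom hr
    have h3 := h.congr h1
    obtain rfl : w = y := by simpa using h3.2.1
    rw [h2]
    exact h3.tail
  · rw [stepTo_of_not hr]
    obtain ⟨hc, hh, hl⟩ := h
    refine ⟨List.isChain_cons.2 ⟨fun w hw => ?_, hc⟩, rfl, by simp [List.getLast?_cons, hl]⟩
    rw [hh] at hw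
    obtain rfl : y = w := by simpa using hw
    exact hz.symm

lemma IsPathFromTo.act {x y z : V} {r : List V} (h : IsPathFromTo K x y r)
    (p : (skeleton K).Walk y z) : IsPathFromTo K x z (act K p r) := by
  induction p generalizing r with
  | nil => exact h
  | cons hz p ih => exact ih (h.stepTo hz)

lemma IsPathFromTo.exists_walk {x y : V} {r : List V} (h : IsPathFromTo K x y r) :
    ∃ p : (skeleton K).Walk y x, p.length + 1 = r.length := by
  induction r generalizing y with
  | nil => simp [IsPathFromTo] at h
  | cons z r ih =>
    obtain rfl : z = y := by simpa using h.2.1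
    cases r with
    | nil =>
      obtain rfl : z = x := by simpa using h.2.2
      exact ⟨.nil, rfl⟩
    | cons w r =>
      obtain ⟨p, hp⟩ := ih h.tail
      exact ⟨.cons (List.isChain_cons_cons.1 h.1).1 p, by simp [hp]⟩

lemma IsPathFromTo.dist_lt {x y : V} {r : List V} (h : IsPathFromTo K x y r) :
    (skeleton K).dist x y < r.length := by
  obtain ⟨p, hp⟩ := h.exists_walk
  have := SimpleGraph.dist_le p
  rw [SimpleGraph.dist_comm]
  omega

namespace IsLocallyCAT0

variable (hK : IsLocallyCAT0 K)

include hK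

lemma act_congr {x y : V} (p : (skeleton K).Walk x y) {r r' : List V} (h : SqEquiv K r r') :
    SqEquiv K (act K p r) (act K p r') := by
  induction p generalizing r r' with
  | nil => exact h
  | cons _ p ih => exact ih (hK.stepTo_congr h)

lemma isReduced_act {x y : V} (p : (skeleton K).Walk x y) {r : List V}
    (h : IsReduced K (x :: r)) : IsReduced K (act K p (x :: r)) := by
  induction p generalizing r with
  | nil => exact h
  | @cons u v w _ p ih =>
    have h1 := hK.isReduced_stepTo (v := v) h
    obtain ⟨t, ht⟩ := exists_stepTo_eq (K := K) v (u :: r)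
    rw [act, ht]
    rw [ht] at h1
    exact ih h1

/-- Homotopic paths act in the same way on reduced paths, up to square moves. -/
lemma act_homotopic {x y : V} {p q : (skeleton K).Walk x y} (h : Homotopic K p q) :
    ∀ r : List V, IsReduced K (x :: r) → SqEquiv K (act K p (x :: r)) (act K q (x :: r)) := by
  induction h with
  | refl p => exact fun r _ => .refl _
  | symm _ ih => exact fun r hr => (ih r hr).symm
  | trans _ _ ih ih' => exact fun r hr => (ih r hr).trans (ih' r hr)
  | @append x y z p p' q q' _ _ ih ih' =>
    intro r hr
    rw [act_append, act_append]
    refine (hK.act_congr q (ih r hr)).trans ?_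
    obtain ⟨t, ht⟩ := exists_act_eq p' r
    have h1 := hK.isReduced_act p' hr
    rw [ht] at h1 ⊢
    exact ih' t h1
  | backtrack h => exact fun r hr => hK.stepTo_stepTo hr
  | square h => exact fun r _ => hK.stepTo_square h r

end IsLocallyCAT0

/-! ### The quadrangle condition -/

lemma Homotopic.even_iff {x y : V} {p q : (skeleton K).Walk x y} (h : Homotopic K p q) :
    Even p.length ↔ Even q.length := by
  induction h with
  | refl => rfl
  | symm _ ih => exact ih.symm
  | trans _ _ ih ih' => exact ih.trans ih'
  | append _ _ ih ih' =>
    rw [SimpleGraph.Walk.length_append, SimpleGraph.Walk.length_append, Nat.even_add,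
      Nat.even_add, ih, ih']
  | backtrack => simp
  | square => simp

lemma homotopic_reverse_append {x y : V} (p : (skeleton K).Walk x y) :
    Homotopic K (p.reverse.append p) .nil := by
  induction p with
  | nil => exact .refl _
  | @cons u v w h p ih =>
    have h1 : Homotopic K (p.reverse.append
        ((SimpleGraph.Walk.cons h.symm (.cons h .nil)).append p)) (p.reverse.append p) :=
      .append (.refl _) (.append (.backtrack h.symm) (.refl p))
    have h2 : (SimpleGraph.Walk.cons h p).reverse.append (.cons h p) = p.reverse.append
        ((SimpleGraph.Walk.cons h.symm (.cons h .nil)).append p) := by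
      rw [SimpleGraph.Walk.reverse_cons, ← SimpleGraph.Walk.append_assoc]
      rfl
    rw [h2]
    exact h1.trans ih

namespace IsCAT0CubeComplex

variable (hK : IsCAT0CubeComplex K)

include hK

lemma homotopic {x y : V} (p q : (skeleton K).Walk x y) : Homotopic K p q := by
  have h1 : Homotopic K ((p.append q.reverse).append q) q :=
    .append (hK.simplyConnected.2 x (p.append q.reverse)) (.refl q)
  have h2 : Homotopic K (p.append (q.reverse.append q)) (p.append .nil) :=
    .append (.refl p) (homotopic_reverse_append q)
  rw [SimpleGraph.Walk.append_nil] at h2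
  rw [← SimpleGraph.Walk.append_assoc] at h1
  exact h2.symm.trans h1

lemma even_length {x : V} (p : (skeleton K).Walk x x) : Even p.length :=
  (hK.simplyConnected.2 x p).even_iff.2 (by simp)

lemma connected : (skeleton K).Connected := hK.simplyConnected.1

lemma dist_ne_of_adj (x : V) {u v : V} (h : (skeleton K).Adj u v) :
    (skeleton K).dist x u ≠ (skeleton K).dist x v := by
  intro he
  obtain ⟨p, hp⟩ := hK.connected.exists_walk_length_eq_dist x u
  obtain ⟨q, hq⟩ := hK.connected.exists_walk_length_eq_dist x v
  have := hK.even_length ((p.concat h).append q.reverse)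
  rw [SimpleGraph.Walk.length_append, SimpleGraph.Walk.length_concat,
    SimpleGraph.Walk.length_reverse, hp, hq, he] at this
  rcases this with ⟨k, hk⟩
  omega

lemma dist_succ_or (x : V) {u v : V} (h : (skeleton K).Adj u v) :
    (skeleton K).dist x u + 1 = (skeleton K).dist x v ∨
      (skeleton K).dist x v + 1 = (skeleton K).dist x u := by
  have h1 := hK.dist_ne_of_adj x h
  have h2 := hK.connected.dist_triangle (u := x) (v := u) (w := v)
  have h3 := hK.connected.dist_triangle (u := x) (v := v) (w := u)
  rw [SimpleGraph.dist_eq_one_iff_adj.2 h] at h2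
  rw [SimpleGraph.dist_eq_one_iff_adj.2 h.symm] at h3
  omega

lemma isLocallyCAT0 : IsLocallyCAT0 K where
  isCubeComplex := hK.isCubeComplex
  nonpositivelyCurved := hK.nonpositivelyCurved
  triangleFree x y z hxy hyz hxz := by
    have := hK.even_length (.cons hxy (.cons hyz (.cons hxz.symm .nil)))
    revert this
    simp
    decide

/-- The quadrangle condition: two distinct neighbours of `v` that are closer to `x` than `v` lie
in a square whose fourth vertex is closer still. -/
theorem quadrangle {x v u₁ u₂ : V} (h₁ : (skeleton K).Adj u₁ v) (h₂ : (skeleton K).Adj u₂ v)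
    (hd₁ : (skeleton K).dist x u₁ + 1 = (skeleton K).dist x v)
    (hd₂ : (skeleton K).dist x u₂ + 1 = (skeleton K).dist x v) (hne : u₁ ≠ u₂) :
    ∃ w, IsSquare K w u₁ v u₂ ∧ (skeleton K).dist x w + 1 = (skeleton K).dist x u₁ := by
  have hL := hK.isLocallyCAT0
  have hx : IsPathFromTo K x x [x] := ⟨List.isChain_singleton x, rfl, rfl⟩
  have hxr : IsReduced K [x] := by
    rintro l hl ⟨p, a, b, q, rfl⟩
    have := hl.length_eq
    simp at this
    omega
  -- A geodesic acts on the constant path without any cancellation.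
  have key : ∀ u, (skeleton K).Adj u v → (skeleton K).dist x u + 1 = (skeleton K).dist x v →
      ∃ (p : (skeleton K).Walk x v) (l : List V), act K p [x] = v :: u :: l ∧
        IsPathFromTo K x u (u :: l) ∧ l.length = (skeleton K).dist x u := by
    intro u hu hd
    obtain ⟨p, hp⟩ := hK.connected.exists_walk_length_eq_dist x u
    obtain ⟨l, hl⟩ := exists_act_eq p []
    have h1 := length_act_le p [x]
    have h2 := hx.act p
    have h3 := h2.stepTo hu
    have h4 := h2.dist_lt
    have h5 := h3.dist_lt
    rw [hl] at h1 h2 h3 h4 h5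
    simp only [List.length_cons, List.length_nil] at h1 h4
    refine ⟨p.concat hu, l, ?_, h2, by omega⟩
    rw [SimpleGraph.Walk.concat_eq_append, act_append, hl]
    rcases length_stepTo (K := K) v (u :: l) with ⟨_, h⟩ | h
    · exact h
    · simp only [List.length_cons] at h
      omega
  obtain ⟨p₁, l₁, hp₁, hl₁, hn₁⟩ := key u₁ h₁ hd₁
  obtain ⟨p₂, l₂, hp₂, hl₂, hn₂⟩ := key u₂ h₂ hd₂
  have h := hL.act_homotopic (hK.homotopic p₁ p₂) [] hxr
  rw [hp₁, hp₂] at h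
  rcases h.lastEdges hL.1 hL.2 hL.3 with ⟨he, _⟩ | ⟨w, m, hs, h3, _⟩
  · exact absurd he hne
  refine ⟨w, hs, ?_⟩
  have h4 := (hl₁.congr h3).tail.dist_lt
  have h5 := h3.length_eq
  simp only [List.length_cons] at h4 h5
  rcases hK.dist_succ_or x hs.adj_ab with h | h <;> omega

end IsCAT0CubeComplex

/-! ### Half-spaces -/

/-- The vertices that are closer to `a` than to `b`. For an edge `{a, b}` this is the half-space
containing `a` that is bounded by the hyperplane dual to the edge. -/
def side (K : Set (Set V)) (a b : V) : Set V :=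
  {x | (skeleton K).dist x a < (skeleton K).dist x b}

/-- The two sides of an edge. -/
def sides (K : Set (Set V)) (e : Sym2 V) : Set (Set V) :=
  {H | ∃ a b, e = s(a, b) ∧ H = side K a b}

lemma left_mem_side {a b : V} (h : (skeleton K).Adj a b) : a ∈ side K a b := by
  simp [side, SimpleGraph.dist_eq_one_iff_adj.2 h]

lemma right_notMem_side (a b : V) : b ∉ side K a b := by
  simp [side]

lemma opposite_symm {e f : Sym2 V} (h : Opposite K e f) : Opposite K f e := by
  obtain ⟨a, b, c, d, hs, rfl, rfl⟩ := h
  exact ⟨d, c, b, a, hs.rotate.rotate.rotate.reverse, rfl, rfl⟩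

namespace IsCAT0CubeComplex

variable (hK : IsCAT0CubeComplex K)

include hK

lemma mem_side_iff {a b : V} (h : (skeleton K).Adj a b) (x : V) :
    x ∈ side K a b ↔ (skeleton K).dist x a + 1 = (skeleton K).dist x b := by
  have := hK.dist_succ_or x h
  change (skeleton K).dist x a < (skeleton K).dist x b ↔ _
  omega

lemma compl_side {a b : V} (h : (skeleton K).Adj a b) : (side K a b)ᶜ = side K b a := by
  ext x
  have := hK.dist_ne_of_adj x h
  change ¬ (skeleton K).dist x a < (skeleton K).dist x b ↔
    (skeleton K).dist x b < (skeleton K).dist x a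
  omega

lemma notMem_side_iff {a b : V} (h : (skeleton K).Adj a b) (x : V) :
    x ∉ side K a b ↔ (skeleton K).dist x b + 1 = (skeleton K).dist x a := by
  rw [← Set.mem_compl_iff, hK.compl_side h, hK.mem_side_iff h.symm]

lemma exists_closer {x y : V} (h : x ≠ y) :
    ∃ z, (skeleton K).Adj z y ∧ (skeleton K).dist x z + 1 = (skeleton K).dist x y := by
  obtain ⟨p, hp⟩ := hK.connected.exists_walk_length_eq_dist y x
  cases p with
  | nil => exact absurd rfl h
  | @cons _ z _ hz p =>
    refine ⟨z, hz.symm, ?_⟩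
    have h1 := SimpleGraph.dist_le p
    have h2 := hK.dist_succ_or x hz
    rw [SimpleGraph.dist_comm] at h1
    rw [SimpleGraph.dist_comm, SimpleGraph.Walk.length_cons] at hp
    omega

lemma dist_eq_zero {x y : V} : (skeleton K).dist x y = 0 ↔ x = y := hK.connected.dist_eq_zero_iff

/-- If the conclusion fails at `x`, then the quadrangle condition at `b` gives a second square on
three of the vertices. -/
lemma side_subset_of_square {a b c d : V} (h : IsSquare K a b c d) : side K a b ⊆ side K d c := by
  intro x hx
  by_contra hx'
  rw [hK.mem_side_iff h.adj_ab] at hx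
  rw [hK.notMem_side_iff h.adj_cd.symm] at hx'
  have h1 := hK.dist_succ_or x h.adj_bc
  have h2 := hK.dist_succ_or x h.adj_da
  obtain ⟨w, hw, hd⟩ := hK.quadrangle (x := x) h.adj_ab h.adj_bc.symm hx (by omega) h.ne_ac
  obtain rfl : d = w := hK.isCubeComplex.square_unique h hw.rotate
  omega

/-- Opposite edges of a square have the same sides. -/
lemma side_eq_of_square {a b c d : V} (h : IsSquare K a b c d) : side K a b = side K d c :=
  (hK.side_subset_of_square h).antisymm
    (hK.side_subset_of_square h.rotate.rotate.rotate.reverse)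

lemma sides_eq_of_eqvGen {e f : Sym2 V} (h : Relation.EqvGen (Opposite K) e f) :
    sides K e = sides K f ∧ (e ∈ (skeleton K).edgeSet ↔ f ∈ (skeleton K).edgeSet) := by
  have key : ∀ e f : Sym2 V, Opposite K e f → sides K e ⊆ sides K f ∧
      f ∈ (skeleton K).edgeSet := by
    rintro _ _ ⟨a, b, c, d, hs, rfl, rfl⟩
    refine ⟨?_, hs.adj_cd.symm⟩
    rintro H ⟨a', b', he, rfl⟩
    rcases Sym2.eq_iff.1 he with ⟨rfl, rfl⟩ | ⟨rfl, rfl⟩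
    · exact ⟨d, c, rfl, hK.side_eq_of_square hs⟩
    · exact ⟨c, d, Sym2.eq_swap, hK.side_eq_of_square hs.reverse.rotate.rotate.rotate⟩
  induction h with
  | rel e f h =>
    have h1 := key e f h
    have h2 := key f e (opposite_symm h)
    exact ⟨h1.1.antisymm h2.1, iff_of_true h2.2 h1.2⟩
  | refl => exact ⟨rfl, Iff.rfl⟩
  | symm _ _ _ ih => exact ⟨ih.1.symm, ih.2.symm⟩
  | trans _ _ _ _ _ ih ih' => exact ⟨ih.1.trans ih'.1, ih.2.trans ih'.2⟩

/-- The edges that join the two sides of the edge `{a, b}` are dual to the same hyperplane: the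
quadrangle condition gives a square through which such an edge can be moved towards `{a, b}`. -/
lemma crossing {a b c e : V} (hab : (skeleton K).Adj a b) (hce : (skeleton K).Adj c e)
    (hc : c ∈ side K a b) (he : e ∉ side K a b) :
    side K c e = side K a b ∧ Relation.EqvGen (Opposite K) s(a, b) s(c, e) := by
  induction hn : (skeleton K).dist a c using Nat.strong_induction_on generalizing c e with
  | _ n IH =>
    have hc1 := (hK.mem_side_iff hab c).1 hc
    have he1 := (hK.notMem_side_iff hab e).1 he
    have hca := hK.dist_succ_or a hce
    have hcb := hK.dist_succ_or b hce
    simp only [SimpleGraph.dist_comm (u := c), SimpleGraph.dist_comm (u := e)] at hc1 he1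
    by_cases hac : a = c
    · subst hac
      rw [SimpleGraph.dist_self] at hc1 hca
      obtain rfl : b = e := hK.dist_eq_zero.1 (by omega)
      exact ⟨rfl, .refl _⟩
    · obtain ⟨c', hc', hd⟩ := hK.exists_closer hac
      have h1 := hK.dist_succ_or b hc'
      have h2 := hK.dist_succ_or a hab
      have h3 := hK.dist_succ_or c' hab
      simp only [SimpleGraph.dist_comm (u := c')] at h3
      have hc's : c' ∈ side K a b := by
        rw [hK.mem_side_iff hab, SimpleGraph.dist_comm, SimpleGraph.dist_comm (u := c')]
        omega
      have hne : e ≠ c' := fun h => he (h ▸ hc's)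
      obtain ⟨w, hw, hdw⟩ := hK.quadrangle (x := b) hce.symm hc' (by omega) (by omega) hne
      have hws : w ∉ side K a b := by
        have h4 := hK.dist_succ_or a hw.adj_ab
        have h5 := hK.dist_succ_or w hab
        simp only [SimpleGraph.dist_comm (u := w)] at h5
        rw [hK.notMem_side_iff hab, SimpleGraph.dist_comm, SimpleGraph.dist_comm (u := w)]
        omega
      obtain ⟨h6, h7⟩ := IH _ (by omega) hw.adj_da hc's hws rfl
      have hsq := hw.rotate.rotate.rotate
      exact ⟨by rw [← h6, hK.side_eq_of_square hsq],
        h7.trans _ _ _ (.rel _ _ ⟨_, _, _, _, hsq, rfl, rfl⟩)⟩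

/-- Edges dual to the hyperplane of `{a, b}` do not have both endpoints on one side of it. -/
lemma notMem_hyperplane {a b c e : V} (hc : c ∈ side K a b)
    (he : e ∈ side K a b) : ¬ Relation.EqvGen (Opposite K) s(a, b) s(c, e) := by
  intro h
  obtain ⟨h1, _⟩ := hK.sides_eq_of_eqvGen h
  have h2 : side K a b ∈ sides K s(c, e) := h1 ▸ ⟨a, b, rfl, rfl⟩
  obtain ⟨a', b', h3, h4⟩ := h2
  rw [h4] at hc he
  rcases Sym2.eq_iff.1 h3 with ⟨rfl, rfl⟩ | ⟨rfl, rfl⟩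
  · exact right_notMem_side _ _ he
  · exact right_notMem_side _ _ hc

/-- A side of an edge is a component of the complement of the dual hyperplane: geodesics to `a` stay
in it, and the edges that leave it are dual to the hyperplane. -/
lemma supp_eq_side {a b x : V} (hab : (skeleton K).Adj a b) (hx : x ∈ side K a b) :
    (((skeleton K).deleteEdges {f | Relation.EqvGen (Opposite K) s(a, b) f}).connectedComponentMk
      x).supp = side K a b := by
  set G := (skeleton K).deleteEdges {f | Relation.EqvGen (Opposite K) s(a, b) f} with hG
  have hreach : ∀ n, ∀ y ∈ side K a b, (skeleton K).dist a y = n → G.Reachable y a := by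
    intro n
    induction n with
    | zero =>
      intro y _ hn
      rw [hK.dist_eq_zero.1 hn]
    | succ n ih =>
      intro y hy hn
      obtain ⟨z, hz, hd⟩ := hK.exists_closer (x := a) (y := y) (by
        rintro rfl
        simp at hn)
      have hzs : z ∈ side K a b := by
        by_contra hzs
        have h1 := (hK.crossing hab hz.symm hy hzs).1
        have h2 : a ∈ side K y z := h1 ▸ left_mem_side hab
        rw [hK.mem_side_iff hz.symm] at h2
        omega
      refine SimpleGraph.Reachable.trans (SimpleGraph.Adj.reachable ?_) (ih z hzs (by omega))
      rw [hG, SimpleGraph.deleteEdges_adj]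
      exact ⟨hz.symm, hK.notMem_hyperplane hy hzs⟩
  ext y
  rw [SimpleGraph.ConnectedComponent.mem_supp_iff, SimpleGraph.ConnectedComponent.eq]
  constructor
  · rintro ⟨p⟩
    induction p with
    | nil => exact hx
    | @cons u v w h p ih =>
      have hw := ih hx
      by_contra hu
      rw [hG, SimpleGraph.deleteEdges_adj] at h
      refine h.2 ?_
      have := (hK.crossing hab h.1.symm hw hu).2
      rwa [Sym2.eq_swap (a := v)] at this
  · exact fun hy => (hreach _ y hy rfl).trans (hreach _ x hx rfl).symm

/-- The half-spaces are the sides of the edges. -/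
theorem mem_halfSpaces_iff {H : Set V} :
    H ∈ halfSpaces K ↔ ∃ a b, (skeleton K).Adj a b ∧ H = side K a b := by
  constructor
  · rintro ⟨h, ⟨e, he, rfl⟩, c, rfl⟩
    induction e with
    | _ a b =>
      have hab : (skeleton K).Adj a b := he
      induction c using SimpleGraph.ConnectedComponent.ind with
      | _ x =>
        by_cases hx : x ∈ side K a b
        · exact ⟨a, b, hab, hK.supp_eq_side hab hx⟩
        · rw [← Set.mem_compl_iff, hK.compl_side hab] at hx
          have := hK.supp_eq_side hab.symm hx
          rw [Sym2.eq_swap] at this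
          exact ⟨b, a, hab.symm, this⟩
  · rintro ⟨a, b, hab, rfl⟩
    exact ⟨_, ⟨s(a, b), hab, rfl⟩, _, (hK.supp_eq_side hab (left_mem_side hab)).symm⟩

lemma side_mem {a b : V} (h : (skeleton K).Adj a b) : side K a b ∈ halfSpaces K :=
  hK.mem_halfSpaces_iff.2 ⟨a, b, h, rfl⟩

lemma compl_mem {H : Set V} (h : H ∈ halfSpaces K) : Hᶜ ∈ halfSpaces K := by
  obtain ⟨a, b, hab, rfl⟩ := hK.mem_halfSpaces_iff.1 h
  rw [hK.compl_side hab]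
  exact hK.side_mem hab.symm

lemma eq_side {H : Set V} (hH : H ∈ halfSpaces K) {x y : V} (h : (skeleton K).Adj x y)
    (hx : x ∈ H) (hy : y ∉ H) : H = side K x y := by
  obtain ⟨a, b, hab, rfl⟩ := hK.mem_halfSpaces_iff.1 hH
  exact (hK.crossing hab h hx hy).1.symm

/-- Half-spaces are convex. -/
lemma mem_of_closer {H : Set V} (hH : H ∈ halfSpaces K) {x y z : V} (hx : x ∈ H) (hy : y ∈ H)
    (hz : (skeleton K).Adj z y) (hd : (skeleton K).dist x z + 1 = (skeleton K).dist x y) :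
    z ∈ H := by
  by_contra hzH
  rw [hK.eq_side hH hz.symm hy hzH, hK.mem_side_iff hz.symm] at hx
  omega

lemma mem_of_square {H : Set V} (hH : H ∈ halfSpaces K) {a b c d : V} (h : IsSquare K a b c d)
    (hb : b ∈ H) (hd : d ∈ H) : a ∈ H := by
  by_contra ha
  rw [hK.eq_side hH h.adj_ab.symm hb ha, hK.mem_side_iff h.adj_ab.symm,
    SimpleGraph.dist_eq_one_iff_adj.2 h.adj_da] at hd
  exact h.ne_bd (hK.dist_eq_zero.1 (by omega)).symm

lemma interval_finite (x y : V) : (interval K x y).Finite := by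
  obtain ⟨p⟩ := hK.connected.preconnected x y
  induction p with
  | nil =>
    convert Set.finite_empty
    ext H
    simp [interval]
  | @cons u v w h p ih =>
    refine (ih.insert (side K v u)).subset ?_
    rintro H ⟨hH, hw, hu⟩
    by_cases hv : v ∈ H
    · exact Or.inl (hK.eq_side hH h.symm hv hu)
    · exact Or.inr ⟨hH, hw, hv⟩

lemma ext_halfSpaces {x y : V} (h : ∀ H ∈ halfSpaces K, x ∈ H ↔ y ∈ H) : x = y := by
  by_contra hne
  obtain ⟨z, hz, hd⟩ := hK.exists_closer hne
  have h1 := h _ (hK.side_mem hz)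
  rw [hK.mem_side_iff hz] at h1
  exact right_notMem_side z y (h1.1 hd)

/-- A vertex of a half-space nearest to `x` is a gate for `x`. Along a geodesic from `y` in the
half-space, the distance to `x` cannot start to decrease, for the quadrangle condition would then
provide a vertex of the half-space that is too close to `x`. -/
lemma dist_gate {H : Set V} (hH : H ∈ halfSpaces K) {x y : V} (hy : y ∈ H)
    (hmin : ∀ y' ∈ H, (skeleton K).dist x y ≤ (skeleton K).dist x y') {z : V} (hz : z ∈ H) :
    (skeleton K).dist x z = (skeleton K).dist x y + (skeleton K).dist y z := by
  induction hn : (skeleton K).dist y z using Nat.strong_induction_on generalizing z with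
  | _ n IH =>
    by_cases hyz : y = z
    · subst hyz
      simp at hn
      omega
    obtain ⟨z₁, hz₁, hd₁⟩ := hK.exists_closer hyz
    have hz₁H := hK.mem_of_closer hH hy hz hz₁ hd₁
    have h1 := IH _ (by omega) hz₁H rfl
    rcases hK.dist_succ_or x hz₁ with h | h
    · omega
    by_cases hyz₁ : y = z₁
    · subst hyz₁
      have := hmin z hz
      omega
    obtain ⟨z₂, hz₂, hd₂⟩ := hK.exists_closer hyz₁
    have hz₂H := hK.mem_of_closer hH hy hz₁H hz₂ hd₂
    have h2 := IH _ (by omega) hz₂H rfl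
    obtain ⟨w, hw, hdw⟩ := hK.quadrangle (x := x) hz₁.symm hz₂ h (by omega) (by
      rintro rfl
      omega)
    have hwH := hK.mem_of_square hH hw hz hz₂H
    have h3 := hK.dist_succ_or y hw.adj_da
    have h4 := hK.dist_succ_or y hw.adj_ab
    have h5 := IH _ (by omega) hwH rfl
    omega

/-- A half-space not containing `x` either is bounded by a hyperplane adjacent to `x`, or is
properly contained in another half-space not containing `x`. -/
lemma adjacent_or_exists_ssuperset {H : Set V} (hH : H ∈ halfSpaces K) {x : V} (hx : x ∉ H) :
    (∃ x', (skeleton K).Adj x x' ∧ H = side K x' x) ∨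
      ∃ H' ∈ halfSpaces K, H ⊂ H' ∧ x ∉ H' := by
  have hne : H.Nonempty := by
    obtain ⟨a, b, hab, rfl⟩ := hK.mem_halfSpaces_iff.1 hH
    exact ⟨a, left_mem_side hab⟩
  obtain ⟨y, hy, hmin⟩ : ∃ y ∈ H, ∀ y' ∈ H, (skeleton K).dist x y ≤ (skeleton K).dist x y' := by
    have := Function.argminOn_mem (fun y => (skeleton K).dist x y) H hne
    exact ⟨_, this, fun y' hy' => Function.argminOn_le (fun y => (skeleton K).dist x y) H hy'⟩
  have hxy : y ≠ x := fun h => hx (h ▸ hy)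
  obtain ⟨x₁, hx₁, hd⟩ := hK.exists_closer hxy
  by_cases h1 : x₁ ∈ H
  · exact Or.inl ⟨x₁, hx₁.symm, hK.eq_side hH hx₁ h1 hx⟩
  · refine Or.inr ⟨side K x₁ x, hK.side_mem hx₁, ⟨?_, fun h => h1 (h (left_mem_side hx₁))⟩,
      right_notMem_side _ _⟩
    -- Since `y` is a gate, the first edge of a geodesic from `x` to `y` leads closer to all of `H`.
    intro z hz
    have h2 := hK.dist_gate hH hy hmin hz
    have h3 := hK.connected.dist_triangle (u := x₁) (v := y) (w := z)
    have h4 := hK.dist_succ_or z hx₁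
    rw [SimpleGraph.dist_comm, SimpleGraph.dist_comm (v := x)] at hd
    rw [SimpleGraph.dist_comm, SimpleGraph.dist_comm (v := x)] at h4
    rw [hK.mem_side_iff hx₁, SimpleGraph.dist_comm, SimpleGraph.dist_comm (v := x)]
    omega

/-- Carriers of hyperplanes are convex: a geodesic between two vertices on the same side of the
carrier starts with an edge that spans a square with an edge dual to the hyperplane. -/
lemma exists_square_of_side_eq {a b c e a' : V} (hab : (skeleton K).Adj a b)
    (hce : (skeleton K).Adj c e) (hs : side K a b = side K c e) (ha' : (skeleton K).Adj a' a)
    (hd : (skeleton K).dist c a' + 1 = (skeleton K).dist c a) :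
    ∃ b', IsSquare K a b b' a' := by
  have hcs : c ∈ side K a b := hs ▸ left_mem_side hce
  have h0 := hK.mem_of_closer (hK.side_mem hab) hcs (left_mem_side hab) ha' hd
  have h1 : a ∈ side K c e := hs ▸ left_mem_side hab
  have h2 : b ∉ side K c e := hs ▸ right_notMem_side _ _
  have h3 : a' ∈ side K c e := hs ▸ h0
  have hba : b ≠ a' := fun h => right_notMem_side a b (by rw [h] at h0 ⊢; exact h0)
  rw [hK.mem_side_iff hab] at hcs
  rw [hK.mem_side_iff hce] at h1 h3
  rw [hK.notMem_side_iff hce] at h2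
  simp only [SimpleGraph.dist_comm (v := c), SimpleGraph.dist_comm (v := e)] at h1 h2 h3
  obtain ⟨w, hw, _⟩ := hK.quadrangle (x := e) hab.symm ha' (by omega) (by omega) hba
  exact ⟨w, hw.rotate.reverse.rotate.rotate.rotate⟩

end IsCAT0CubeComplex

/-! ### Automorphisms -/

namespace IsAutomorphism

variable {g : Equiv.Perm V} (hg : IsAutomorphism K g)

include hg

lemma inv : IsAutomorphism K g⁻¹ := by
  intro C
  rw [← hg ((g⁻¹ : Equiv.Perm V) '' C), Set.image_image]
  simp

lemma zpow (n : ℤ) : IsAutomorphism K (g ^ n) := by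
  have hmul : ∀ {g h : Equiv.Perm V}, IsAutomorphism K g → IsAutomorphism K h →
      IsAutomorphism K (g * h) := by
    intro g h hg hh C
    rw [← hh C, ← hg (h '' C), Set.image_image]
    rfl
  induction n using Int.induction_on with
  | zero => intro C; simp
  | succ n ih =>
    rw [zpow_add_one]
    exact hmul ih hg
  | pred n ih =>
    rw [zpow_sub_one]
    exact hmul ih hg.inv

lemma adj_iff {x y : V} : (skeleton K).Adj (g x) (g y) ↔ (skeleton K).Adj x y := by
  have := hg {x, y}
  rw [Set.image_pair] at this
  simp [skeleton, this]

lemma dist_eq (x y : V) : (skeleton K).dist (g x) (g y) = (skeleton K).dist x y := by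
  have key : ∀ {g : Equiv.Perm V}, IsAutomorphism K g → ∀ x y,
      (skeleton K).Reachable x y → (skeleton K).dist (g x) (g y) ≤ (skeleton K).dist x y := by
    intro g hg x y h
    obtain ⟨p, hp⟩ := h.exists_walk_length_eq_dist
    let f : skeleton K →g skeleton K := ⟨g, fun h => hg.adj_iff.2 h⟩
    have := SimpleGraph.dist_le (p.map f)
    rwa [SimpleGraph.Walk.length_map, hp] at this
  have hr : (skeleton K).Reachable x y ↔ (skeleton K).Reachable (g x) (g y) := by
    have key : ∀ {g : Equiv.Perm V}, IsAutomorphism K g → ∀ x y,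
      (skeleton K).Reachable x y → (skeleton K).Reachable (g x) (g y) := fun {g} hg x y h =>
        h.map (⟨g, fun h => hg.adj_iff.2 h⟩ : skeleton K →g skeleton K)
    refine ⟨key hg x y, fun h => ?_⟩
    simpa using key hg.inv _ _ h
  by_cases h : (skeleton K).Reachable x y
  · refine (key hg x y h).antisymm ?_
    simpa using key hg.inv _ _ (hr.1 h)
  · rw [SimpleGraph.dist_eq_zero_of_not_reachable h,
      SimpleGraph.dist_eq_zero_of_not_reachable (mt hr.2 h)]

lemma mem_side {a b x : V} : g x ∈ side K (g a) (g b) ↔ x ∈ side K a b := by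
  change (skeleton K).dist (g x) (g a) < (skeleton K).dist (g x) (g b) ↔ _
  rw [hg.dist_eq, hg.dist_eq]
  rfl

lemma image_side (a b : V) : g '' side K a b = side K (g a) (g b) := by
  ext x
  obtain ⟨y, rfl⟩ := g.surjective x
  rw [hg.mem_side, g.injective.mem_set_image]

lemma image_mem_halfSpaces (hK : IsCAT0CubeComplex K) {H : Set V} (hH : H ∈ halfSpaces K) :
    g '' H ∈ halfSpaces K := by
  obtain ⟨a, b, hab, rfl⟩ := hK.mem_halfSpaces_iff.1 hH
  rw [hg.image_side]
  exact hK.side_mem (hg.adj_iff.2 hab)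

end IsAutomorphism

/-! ### Axes -/

lemma translationDistance_le (g : Equiv.Perm V) (x : V) :
    translationDistance K g ≤ (skeleton K).dist x (g x) :=
  Nat.sInf_le ⟨x, rfl⟩

lemma minVertices_nonempty [Nonempty V] (g : Equiv.Perm V) : (minVertices K g).Nonempty := by
  obtain ⟨x, hx⟩ := Nat.sInf_mem (Set.range_nonempty fun x : V => (skeleton K).dist x (g x))
  exact ⟨x, hx⟩

/-- A bi-infinite edge path on which `g` acts as a shift by its translation distance. -/
structure IsPeriodicPath (K : Set (Set V)) (g : Equiv.Perm V) (γ : ℤ → V) : Prop where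
  adj : ∀ i, (skeleton K).Adj (γ i) (γ (i + 1))
  periodic : ∀ i, g (γ i) = γ (i + translationDistance K g)

namespace IsPeriodicPath

variable {g : Equiv.Perm V} {γ : ℤ → V}

lemma shift (h : IsPeriodicPath K g γ) (i : ℤ) : IsPeriodicPath K g (fun m => γ (i + m)) where
  adj m := by
    rw [← add_assoc]
    exact h.adj _
  periodic m := by
    rw [← add_assoc]
    exact h.periodic _

lemma zpow (h : IsPeriodicPath K g γ) (k i : ℤ) :
    (g ^ k) (γ i) = γ (i + k * translationDistance K g) := by
  induction k using Int.induction_on with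
  | zero => simp
  | succ n ih =>
    rw [add_comm, zpow_one_add, Equiv.Perm.mul_apply, ih, h.periodic]
    congr 1
    ring
  | pred n ih =>
    rw [sub_eq_add_neg, add_comm, zpow_add, zpow_neg_one, Equiv.Perm.mul_apply, ih,
      Equiv.Perm.inv_eq_iff_eq, h.periodic]
    congr 1
    ring

end IsPeriodicPath

/-- An edge path of length `translationDistance K g` from `q 0` to `g (q 0)` extends to a periodic
path. -/
lemma exists_periodicPath {g : Equiv.Perm V} (hg : IsAutomorphism K g)
    (hpos : 0 < translationDistance K g) (q : ℕ → V)
    (hq : ∀ r < translationDistance K g, (skeleton K).Adj (q r) (q (r + 1)))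
    (hq0 : q (translationDistance K g) = g (q 0)) :
    ∃ γ : ℤ → V, IsPeriodicPath K g γ ∧
      ∀ r : ℕ, r ≤ translationDistance K g → γ r = q r := by
  set ℓ := translationDistance K g with hℓ
  let γ : ℤ → V := fun m => (g ^ (m / ℓ)) (q (m % ℓ).toNat)
  have key : ∀ (k : ℤ) (r : ℕ), r ≤ ℓ → γ (k * ℓ + r) = (g ^ k) (q r) := by
    have h1 : ∀ (k : ℤ) (r : ℕ), r < ℓ → γ (k * ℓ + r) = (g ^ k) (q r) := by
      intro k r hr
      have h2 : (k * ℓ + r) / (ℓ : ℤ) = k := by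
        rw [add_comm, Int.add_mul_ediv_right _ _ (by omega),
          Int.ediv_eq_zero_of_lt (by omega) (by omega), zero_add]
      have h3 : (k * ℓ + r) % (ℓ : ℤ) = r := by
        rw [add_comm, Int.add_mul_emod_self_right, Int.emod_eq_of_lt (by omega) (by omega)]
      change (g ^ ((k * ℓ + r) / (ℓ : ℤ))) (q ((k * ℓ + r) % (ℓ : ℤ)).toNat) = _
      rw [h2, h3, Int.toNat_natCast]
    intro k r hr
    rcases hr.lt_or_eq with hr | rfl
    · exact h1 k r hr
    · have h2 := h1 (k + 1) 0 hpos
      rw [zpow_add_one, Equiv.Perm.mul_apply, ← hq0] at h2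
      rw [← h2]
      congr 1
      push_cast
      ring
  have hdiv : ∀ m : ℤ, ∃ (k : ℤ) (r : ℕ), r < ℓ ∧ m = k * ℓ + r := by
    intro m
    have h1 := Int.emod_nonneg m (b := (ℓ : ℤ)) (by omega)
    have h2 := Int.emod_lt_of_pos m (b := (ℓ : ℤ)) (by omega)
    refine ⟨m / ℓ, (m % ℓ).toNat, by omega, ?_⟩
    rw [Int.toNat_of_nonneg h1, mul_comm]
    exact (Int.mul_ediv_add_emod m ℓ).symm
  refine ⟨γ, ⟨fun m => ?_, fun m => ?_⟩, fun r hr => ?_⟩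
  · obtain ⟨k, r, hr, rfl⟩ := hdiv m
    have h1 := key k (r + 1) hr
    rw [show k * (ℓ : ℤ) + r + 1 = k * ℓ + ((r + 1 : ℕ) : ℤ) by push_cast; ring, h1,
      key k r hr.le]
    exact (hg.zpow k).adj_iff.2 (hq r hr)
  · obtain ⟨k, r, hr, rfl⟩ := hdiv m
    rw [show k * (ℓ : ℤ) + r + ℓ = (1 + k) * ℓ + r by ring, key _ r hr.le, key _ r hr.le,
      zpow_one_add, Equiv.Perm.mul_apply]
  · simpa using key 0 r hr

lemma exists_last_mem (P : ℤ → Prop) (a : ℤ) (m : ℕ) (ha : P a) (hm : ¬ P (a + m)) :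
    ∃ k : ℕ, k < m ∧ P (a + k) ∧ ¬ P (a + k + 1) := by
  induction m with
  | zero => simp [ha] at hm
  | succ m ih =>
    by_cases h : P (a + m)
    · refine ⟨m, by omega, h, ?_⟩
      convert hm using 2
      push_cast
      ring
    · obtain ⟨k, hk, h⟩ := ih h
      exact ⟨k, by omega, h⟩

/-- The path `γ` enters the half-space `H` on the edge from `γ i` to `γ (i + 1)` and leaves it on
the edge from `γ (i + 1 + n)` to `γ (i + 2 + n)`. -/
structure Recrosses (H : Set V) (γ : ℤ → V) (i : ℤ) (n : ℕ) : Prop where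
  notMem : γ i ∉ H
  enter : γ (i + 1) ∈ H
  mem : γ (i + 1 + n) ∈ H
  leave : γ (i + 2 + n) ∉ H

namespace IsCAT0CubeComplex

variable (hK : IsCAT0CubeComplex K)

include hK

/-- A path that does not recross any hyperplane is geodesic. -/
lemma dist_eq_of_not_recrosses {γ : ℤ → V} (hγ : ∀ i, (skeleton K).Adj (γ i) (γ (i + 1)))
    (a : ℤ) (m : ℕ) (h : ∀ H ∈ halfSpaces K, ∀ (i : ℤ) (n : ℕ), a ≤ i → i + 2 + n ≤ a + m →
      ¬ Recrosses H γ i n) : (skeleton K).dist (γ a) (γ (a + m)) = m := by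
  induction m with
  | zero => simp
  | succ m ih =>
    have h1 := ih fun H hH i n hi hn => h H hH i n hi (by push_cast; omega)
    have hadj := hγ (a + m)
    by_cases hs : γ a ∈ side K (γ (a + m)) (γ (a + m + 1))
    · rw [hK.mem_side_iff hadj] at hs
      push_cast
      rw [← add_assoc, ← hs, h1]
    · exfalso
      have hm := left_mem_side hadj
      obtain ⟨k, hk, h2, h3⟩ := exists_last_mem
        (fun j => γ j ∉ side K (γ (a + m)) (γ (a + m + 1))) a m hs (fun h => h hm)
      refine h _ (hK.side_mem hadj) (a + k) (m - k - 1) (by omega) (by omega)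
        ⟨h2, not_not.1 h3, ?_, ?_⟩
      · convert hm using 2
        omega
      · convert right_notMem_side (K := K) (γ (a + m)) (γ (a + m + 1)) using 3
        omega

lemma neighbour_unique {x y y' : V} (h : (skeleton K).Adj x y) (h' : (skeleton K).Adj x y')
    (hs : side K x y = side K x y') : y = y' := by
  have h1 : y ∉ side K x y' := hs ▸ right_notMem_side x y
  rw [hK.notMem_side_iff h', SimpleGraph.dist_eq_one_iff_adj.2 h.symm] at h1
  exact hK.dist_eq_zero.1 (by omega)

/-- A periodic path never recrosses a hyperplane. Otherwise, take a recrossing with the shortest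
excursion. The excursion stays in the carrier of the hyperplane, so that it can be pushed across.
Pushing one period of it across (and extending periodically) gives another periodic path, on which
the excursion is shorter by a period, unless some power of `g` inverts the hyperplane. -/
theorem not_recrosses {g : Equiv.Perm V} (hg : IsHyperbolic K g) (n : ℕ) :
    ∀ (γ : ℤ → V), IsPeriodicPath K g γ → ∀ H ∈ halfSpaces K, ∀ i, ¬ Recrosses H γ i n := by
  induction n using Nat.strong_induction_on with
  | _ n IH =>
    intro γ₀ hγ₀ H hH i hrec
    obtain ⟨γ, hγ, h0, h1, hn1, hn2⟩ : ∃ γ, IsPeriodicPath K g γ ∧ γ 0 ∉ H ∧ γ 1 ∈ H ∧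
        γ (1 + n) ∈ H ∧ γ (2 + n) ∉ H := by
      refine ⟨_, hγ₀.shift i, by simpa using hrec.notMem, hrec.enter, ?_, ?_⟩
      · simpa only [← add_assoc] using hrec.mem
      · simpa only [← add_assoc] using hrec.leave
    clear hrec hγ₀
    set ℓ := translationDistance K g with hℓ
    have hpos : 0 < ℓ := hg.pos
    -- Shorter excursions are excluded by induction, so this one is geodesic.
    have hgeo : ∀ k : ℕ, k ≤ n →
        (skeleton K).dist (γ (1 + n)) (γ (1 + k)) = n - k := by
      intro k hk
      have := hK.dist_eq_of_not_recrosses hγ.adj (1 + k) (n - k) fun H hH i m hi hm =>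
        IH m (by omega) γ hγ H hH i
      rw [SimpleGraph.dist_comm, ← this]
      congr 2
      omega
    have hHn : H = side K (γ (1 + n)) (γ (2 + n)) := by
      have := hγ.adj (1 + n)
      rw [show (1 + n + 1 : ℤ) = 2 + n by ring] at this
      exact hK.eq_side hH this hn1 hn2
    have hadjn : (skeleton K).Adj (γ (1 + n)) (γ (2 + n)) := by
      convert hγ.adj (1 + n) using 2
      ring
    have hsq : ∀ k : ℕ, k < n → ∀ y, (skeleton K).Adj (γ (1 + k)) y → H = side K (γ (1 + k)) y →
        ∃ y', IsSquare K (γ (1 + k)) y y' (γ (2 + k)) := by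
      intro k hk y hy hHy
      have ha := hγ.adj (1 + k)
      rw [show (1 + k + 1 : ℤ) = 2 + k by ring] at ha
      refine hK.exists_square_of_side_eq hy hadjn (hHy.symm.trans hHn) ha.symm ?_
      have h3 := hgeo k hk.le
      have h4 := hgeo (k + 1) hk
      rw [show (1 + (k + 1 : ℕ) : ℤ) = 2 + k by push_cast; ring] at h4
      omega
    have hex : ∀ k : ℕ, ∃ y, k ≤ n → (skeleton K).Adj (γ (1 + k)) y ∧
        H = side K (γ (1 + k)) y := by
      intro k
      induction k with
      | zero =>
        have := hγ.adj 0
        exact ⟨γ 0, fun _ => ⟨by simpa using this.symm,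
          by simpa using hK.eq_side hH this.symm h1 h0⟩⟩
      | succ k ih =>
        by_cases hk : k + 1 ≤ n
        · obtain ⟨y, hy⟩ := ih
          obtain ⟨hy1, hy2⟩ := hy (by omega)
          obtain ⟨y', hy'⟩ := hsq k (by omega) y hy1 hy2
          refine ⟨y', fun _ => ?_⟩
          rw [show (1 + (k + 1 : ℕ) : ℤ) = 2 + k by push_cast; ring]
          exact ⟨hy'.adj_cd.symm, hy2.trans (hK.side_eq_of_square hy')⟩
        · exact ⟨γ 0, fun h => absurd h hk⟩
    -- `y k` is the vertex opposite to `γ (1 + k)` across the hyperplane.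
    choose y hy using hex
    have hysq : ∀ k : ℕ, k < n → IsSquare K (γ (1 + k)) (y k) (y (k + 1)) (γ (2 + k)) := by
      intro k hk
      obtain ⟨hy1, hy2⟩ := hy k hk.le
      obtain ⟨hy3, hy4⟩ := hy (k + 1) hk
      rw [show (1 + (k + 1 : ℕ) : ℤ) = 2 + k by push_cast; ring] at hy3 hy4
      obtain ⟨y', hy'⟩ := hsq k hk _ hy1 hy2
      obtain rfl := hK.neighbour_unique hy3 hy'.adj_cd.symm
        (by rw [← hy4, hy2, hK.side_eq_of_square hy'])
      exact hy'
    have hy0 : y 0 = γ 0 := by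
      obtain ⟨hy1, hy2⟩ := hy 0 (by omega)
      have h3 := hγ.adj 0
      simp only [Nat.cast_zero, add_zero, zero_add] at hy1 hy2 h3
      exact hK.neighbour_unique hy1 h3.symm (by rw [← hy2, hK.eq_side hH h3.symm h1 h0])
    have hyn : y n = γ (2 + n) := by
      obtain ⟨hy1, hy2⟩ := hy n le_rfl
      exact hK.neighbour_unique hy1 hadjn (by rw [← hy2, hHn])
    -- A recrossing within one period would give a shortcut from `γ 0` to `g (γ 0)`.
    have hle : ℓ ≤ n + 1 := by
      by_contra hlt
      have h3 : ∀ k : ℕ, k ≤ n → (skeleton K).dist (y 0) (y k) ≤ k := by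
        intro k
        induction k with
        | zero => simp
        | succ k ih =>
          intro hk
          have h4 := ih (by omega)
          have h5 := hK.dist_succ_or (y 0) (hysq k hk).adj_bc
          omega
      have h4 : ∀ m : ℕ, (skeleton K).dist (γ 0) (γ (2 + n + m)) ≤ n + m := by
        intro m
        induction m with
        | zero =>
          have := h3 n le_rfl
          rw [hy0, hyn] at this
          simpa using this
        | succ m ih =>
          have h5 := hK.dist_succ_or (γ 0) (hγ.adj (2 + n + m))
          push_cast
          rw [← add_assoc]
          omega
      have h5 := h4 (ℓ - (n + 2))
      have h6 := translationDistance_le (K := K) g (γ 0)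
      rw [hγ.periodic, ← hℓ, show (0 + ℓ : ℤ) = 2 + n + (ℓ - (n + 2) : ℕ) by omega] at h6
      omega
    obtain ⟨k, p, hp, hkp⟩ : ∃ k p : ℕ, p < ℓ ∧ n + 1 = k * ℓ + p :=
      ⟨(n + 1) / ℓ, (n + 1) % ℓ, Nat.mod_lt _ hpos, by
        rw [mul_comm]; exact (Nat.div_add_mod _ _).symm⟩
    have hkpz : (n : ℤ) + 1 = k * ℓ + p := by exact_mod_cast hkp
    have hgk := hg.isAutomorphism.zpow k
    rcases Nat.eq_zero_or_pos p with rfl | hp0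
    -- The edge on which the path leaves `H` is a translate of the edge on which it enters `H`.
    · refine hg.noInversion k ⟨H, hH, ?_⟩
      have h3 := hγ.zpow k 0
      have h4 := hγ.zpow k 1
      have h5 := hγ.adj 0
      rw [zero_add] at h5
      rw [← hℓ, show ((0 : ℤ) + (k : ℤ) * ℓ) = 1 + n by push_cast at hkpz; linarith] at h3
      rw [← hℓ, show ((1 : ℤ) + (k : ℤ) * ℓ) = 2 + n by push_cast at hkpz; linarith] at h4
      conv_lhs => rw [hK.eq_side hH h5.symm h1 h0]
      rw [hgk.image_side, h3, h4, hHn, hK.compl_side hadjn]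
    · have hk1 : 1 ≤ k := by
        rcases Nat.eq_zero_or_pos k with rfl | h
        · omega
        · exact h
      have hkl : ℓ ≤ k * ℓ := Nat.le_mul_of_pos_left ℓ hk1
      -- The new path follows the other side of the carrier for one period before entering `H`.
      obtain ⟨δ, hδ, hδq⟩ := exists_periodicPath hg.isAutomorphism hg.pos
        (fun r => if r < ℓ then y r else γ ℓ) (by
          intro r hr
          rw [← hℓ] at hr
          by_cases hr1 : r + 1 < ℓ
          · simp only [hr, hr1, if_true]
            exact (hysq r (by omega)).adj_bc
          · simp only [hr, hr1, if_true, if_false]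
            rw [show (ℓ : ℤ) = 1 + r by omega]
            exact (hy r (by omega)).1.symm)
        (by simp [← hℓ, hpos, hy0, hγ.periodic])
      rw [← hℓ] at hδq
      have e1 : δ (ℓ - 1) = y (ℓ - 1) := by
        have := hδq (ℓ - 1) (by omega)
        rw [Nat.cast_sub hpos] at this
        simpa [hpos] using this
      have e2 : δ ℓ = γ ℓ := by simpa using hδq ℓ le_rfl
      have hp1 : ((p - 1 : ℕ) : ℤ) = p - 1 := by omega
      have e3 : δ n = (g ^ (k : ℤ)) (y (p - 1)) := by
        have := hδq (p - 1) (by omega)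
        simp only [show p - 1 < ℓ by omega, if_true] at this
        rw [← this, hδ.zpow, ← hℓ]
        congr 1
        linarith
      have e4 : δ (n + 1) = (g ^ (k : ℤ)) (y p) := by
        have := hδq p (by omega)
        simp only [hp, if_true] at this
        rw [← this, hδ.zpow, ← hℓ]
        congr 1
        linarith
      have hs := hysq (p - 1) (by omega)
      rw [show p - 1 + 1 = p by omega] at hs
      have hside : H = side K ((g ^ (k : ℤ)) (y (p - 1))) ((g ^ (k : ℤ)) (y p)) := by
        rw [← hgk.image_side, hK.side_eq_of_square hs.rotate, hgk.image_side, hγ.zpow, hγ.zpow,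
          hHn, ← hℓ]
        congr 2 <;> linarith
      have hadj := hgk.adj_iff.2 hs.adj_bc
      refine IH (n - ℓ) (by omega) δ hδ H hH (ℓ - 1) ⟨?_, ?_, ?_, ?_⟩
      · rw [e1]
        obtain ⟨_, h⟩ := hy (ℓ - 1) (by omega)
        rw [h]
        exact right_notMem_side _ _
      · rw [sub_add_cancel, e2]
        obtain ⟨h, h'⟩ := hy (ℓ - 1) (by omega)
        rw [show (1 + (ℓ - 1 : ℕ) : ℤ) = ℓ by omega] at h h'
        rw [h']
        exact left_mem_side h
      · rw [show ((ℓ : ℤ) - 1 + 1 + (n - ℓ : ℕ)) = n by omega, e3, hside]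
        exact left_mem_side hadj
      · rw [show ((ℓ : ℤ) - 1 + 2 + (n - ℓ : ℕ)) = n + 1 by omega, e4, hside]
        exact right_notMem_side _ _

lemma isAxis_of_isPeriodicPath {g : Equiv.Perm V} (hg : IsHyperbolic K g) {γ : ℤ → V}
    (hγ : IsPeriodicPath K g γ) : IsAxis K g γ := by
  have key : ∀ (i : ℤ) (m : ℕ), (skeleton K).dist (γ i) (γ (i + m)) = m := fun i m =>
    hK.dist_eq_of_not_recrosses hγ.adj i m fun H hH j n _ _ =>
      hK.not_recrosses hg n γ hγ H hH j
  refine ⟨fun i j => ?_, hγ.periodic⟩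
  rcases le_total i j with h | h
  · have := key i (j - i).toNat
    rw [show i + ((j - i).toNat : ℤ) = j by omega] at this
    omega
  · have := key j (i - j).toNat
    rw [show j + ((i - j).toNat : ℤ) = i by omega] at this
    rw [SimpleGraph.dist_comm]
    omega

/-- Haglund's theorem: every vertex with minimal displacement lies on an axis. -/
theorem exists_axis {g : Equiv.Perm V} (hg : IsHyperbolic K g) {x : V}
    (hx : x ∈ minVertices K g) : ∃ γ, IsAxis K g γ ∧ γ 0 = x := by
  obtain ⟨p, hp⟩ := hK.connected.exists_walk_length_eq_dist x (g x)
  rw [show (skeleton K).dist x (g x) = translationDistance K g from hx] at hp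
  obtain ⟨γ, hγ, h⟩ := exists_periodicPath hg.isAutomorphism hg.pos p.getVert
    (fun r hr => p.adj_getVert_succ (hp ▸ hr)) (by rw [← hp]; simp)
  exact ⟨γ, hK.isAxis_of_isPeriodicPath hg hγ, by simpa using h 0 (by omega)⟩

end IsCAT0CubeComplex

/-! ### Cube complexes of discrete distributive lattices -/

section Lattice

variable {W α : Type*} {s : W → Set α}

/-- The cube complex whose vertices are the members of a family `s` of sets, and whose cubes are the
finite intervals `{u | a ⊆ u ⊆ b}` all of whose elements belong to the family. -/
def latticeCubes (s : W → Set α) : Set (Set W) :=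
  {Q | ∃ a b, a ⊆ b ∧ (b \ a).Finite ∧ s '' Q = Set.Icc a b}

/-- The family `s` of sets is closed under unions and intersections, any two members differ by
finitely many elements, and one can pass from a member to a larger one by adding one element at a
time. -/
structure IsDiscreteLattice (s : W → Set α) : Prop where
  inj : Function.Injective s
  exists_union : ∀ x y, ∃ z, s z = s x ∪ s y
  exists_inter : ∀ x y, ∃ z, s z = s x ∩ s y
  finite_sdiff : ∀ x y, (s y \ s x).Finite
  exists_insert : ∀ x y, s x ⊂ s y → ∃ z, ∃ h ∈ s y \ s x, s z = insert h (s x)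

lemma Icc_insert_eq (a : Set α) (h : α) : Set.Icc a (insert h a) = {a, insert h a} := by
  ext u
  simp only [Set.mem_Icc, Set.mem_insert_iff, Set.mem_singleton_iff]
  constructor
  · rintro ⟨h1, h2⟩
    by_cases hu : h ∈ u
    · exact Or.inr (h2.antisymm (Set.insert_subset hu h1))
    · exact Or.inl (((Set.subset_insert_iff_of_notMem hu).1 h2).antisymm h1)
  · rintro (rfl | rfl)
    · exact ⟨subset_rfl, Set.subset_insert _ _⟩
    · exact ⟨Set.subset_insert _ _, subset_rfl⟩

lemma Icc_insert_insert_eq (a : Set α) (h h' : α) : Set.Icc a (insert h (insert h' a)) =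
    {a, insert h a, insert h (insert h' a), insert h' a} := by
  ext u
  simp only [Set.mem_Icc, Set.mem_insert_iff, Set.mem_singleton_iff]
  constructor
  · rintro ⟨h1, h2⟩
    by_cases hu : h ∈ u
    · by_cases hu' : h' ∈ u
      · exact Or.inr (Or.inr (Or.inl (h2.antisymm
          (Set.insert_subset hu (Set.insert_subset hu' h1)))))
      · rw [Set.insert_comm, Set.subset_insert_iff_of_notMem hu'] at h2
        exact Or.inr (Or.inl (h2.antisymm (Set.insert_subset hu h1)))
    · rw [Set.subset_insert_iff_of_notMem hu] at h2
      have : u ∈ Set.Icc a (insert h' a) := ⟨h1, h2⟩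
      rw [Icc_insert_eq] at this
      rcases this with h | h
      · exact Or.inl h
      · exact Or.inr (Or.inr (Or.inr h))
  · rintro (rfl | rfl | rfl | rfl)
    · exact ⟨subset_rfl, (Set.subset_insert _ _).trans (Set.subset_insert _ _)⟩
    · exact ⟨Set.subset_insert _ _, Set.insert_subset_insert (Set.subset_insert _ _)⟩
    · exact ⟨(Set.subset_insert _ _).trans (Set.subset_insert _ _), subset_rfl⟩
    · exact ⟨Set.subset_insert _ _, Set.subset_insert _ _⟩

lemma symmDiff_singleton_eq_insert {a : Set α} {h : α} (hh : h ∉ a) :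
    symmDiff a {h} = insert h a := by
  ext e
  simp only [Set.mem_symmDiff, Set.mem_singleton_iff, Set.mem_insert_iff]
  by_cases he : e = h
  · subst he; tauto
  · tauto

lemma symmDiff_singleton_eq_sdiff {a : Set α} {h : α} (hh : h ∈ a) :
    symmDiff a {h} = a \ {h} := by
  ext e
  simp only [Set.mem_symmDiff, Set.mem_singleton_iff, Set.mem_sdiff]
  by_cases he : e = h
  · subst he; tauto
  · tauto

lemma mem_Icc_sdiff_union_iff {u v S : Set α} :
    u ∈ Set.Icc (v \ S) (v ∪ S) ↔ symmDiff v u ⊆ S := by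
  constructor
  · rintro ⟨h1, h2⟩ e he
    have h1 := @h1 e
    have h2 := @h2 e
    simp only [Set.mem_symmDiff, Set.mem_sdiff, Set.mem_union] at *
    tauto
  · intro h
    constructor <;> intro e he <;> have h := @h e <;>
      simp only [Set.mem_symmDiff, Set.mem_sdiff, Set.mem_union] at * <;> tauto

lemma median_symmDiff {v T : Set α} {a b c : α} (hab : a ≠ b) (hac : a ≠ c) (hbc : b ≠ c) :
    (symmDiff v (T \ {a}) ∩ symmDiff v (T \ {b})) ∪
      ((symmDiff v (T \ {b}) ∩ symmDiff v (T \ {c})) ∪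
        (symmDiff v (T \ {a}) ∩ symmDiff v (T \ {c}))) = symmDiff v T := by
  ext e
  simp only [Set.mem_union, Set.mem_inter_iff, Set.mem_symmDiff, Set.mem_sdiff,
    Set.mem_singleton_iff]
  by_cases hv : e ∈ v <;> by_cases hT : e ∈ T <;> by_cases ha : e = a <;>
    by_cases hb : e = b <;> simp_all

namespace IsDiscreteLattice

variable (hs : IsDiscreteLattice s)

include hs

lemma adj_iff {x y : W} : (skeleton (latticeCubes s)).Adj x y ↔ ∃ h, s y = symmDiff (s x) {h} := by
  constructor
  · rintro ⟨hne, a, b, hab, -, hI⟩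
    rw [Set.image_pair] at hI
    have key : ∀ {x y : W}, x ≠ y → Set.Icc (s x) (s y) = {s x, s y} → s x ⊆ s y →
        ∃ h ∉ s x, s y = insert h (s x) := by
      intro x y hne hI hxy
      obtain ⟨h, hy, hx⟩ := Set.not_subset.1 fun h => hne (hs.inj (hxy.antisymm h))
      refine ⟨h, hx, ?_⟩
      have : insert h (s x) ∈ Set.Icc (s x) (s y) :=
        ⟨Set.subset_insert _ _, Set.insert_subset hy hxy⟩
      rw [hI] at this
      rcases this with h' | h'
      · exact absurd (h' ▸ Set.mem_insert _ _) hx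
      · exact h'.symm
    have ha : a ∈ ({s x, s y} : Set (Set α)) := hI ▸ ⟨subset_rfl, hab⟩
    have hb : b ∈ ({s x, s y} : Set (Set α)) := hI ▸ ⟨hab, subset_rfl⟩
    rcases ha with rfl | rfl <;> rcases hb with hb | hb
    · rw [hb, Set.Icc_self] at hI
      have : s y ∈ ({s x} : Set (Set α)) := hI ▸ Or.inr rfl
      exact absurd (hs.inj this).symm hne
    · rw [hb] at hI hab
      obtain ⟨h, hx, he⟩ := key hne hI.symm hab
      exact ⟨h, by rw [he, symmDiff_singleton_eq_insert hx]⟩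
    · rw [hb] at hI hab
      rw [Set.pair_comm] at hI
      obtain ⟨h, hx, he⟩ := key hne.symm hI.symm hab
      exact ⟨h, by rw [he, symmDiff_singleton_eq_sdiff (Set.mem_insert _ _)]; simp [hx]⟩
    · rw [hb, Set.Icc_self] at hI
      have : s x ∈ ({s y} : Set (Set α)) := hI ▸ Or.inl rfl
      exact absurd (hs.inj this) hne
  · rintro ⟨h, he⟩
    by_cases hx : h ∈ s x
    · rw [symmDiff_singleton_eq_sdiff hx] at he
      have hx' : s x = insert h (s y) := by rw [he]; simp [hx]
      refine ⟨fun hxy => ?_, s y, s x, ?_, hs.finite_sdiff _ _, ?_⟩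
      · subst hxy
        rw [he] at hx
        simp at hx
      · rw [hx']; exact Set.subset_insert _ _
      · rw [hx', Icc_insert_eq, Set.image_pair, hx', Set.pair_comm]
    · rw [symmDiff_singleton_eq_insert hx] at he
      refine ⟨fun hxy => ?_, s x, s y, ?_, hs.finite_sdiff _ _, ?_⟩
      · subst hxy
        rw [he] at hx
        simp at hx
      · rw [he]; exact Set.subset_insert _ _
      · rw [he, Icc_insert_eq, Set.image_pair, he]

lemma adj_of_insert {x y : W} {h : α} (hx : h ∉ s x) (he : s y = insert h (s x)) :
    (skeleton (latticeCubes s)).Adj x y :=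
  hs.adj_iff.2 ⟨h, by rw [he, symmDiff_singleton_eq_insert hx]⟩

lemma isSquare {x y z w : W} {h h' : α} (hne : h ≠ h') (hh : h ∉ s x) (hh' : h' ∉ s x)
    (hy : s y = insert h (s x)) (hw : s w = insert h' (s x))
    (hz : s z = insert h (insert h' (s x))) : IsSquare (latticeCubes s) x y z w where
  mem := by
    refine ⟨s x, s z, ?_, hs.finite_sdiff _ _, ?_⟩
    · rw [hz]
      exact (Set.subset_insert _ _).trans (Set.subset_insert _ _)
    · rw [Set.image_insert_eq, Set.image_insert_eq, Set.image_pair, hz, hy, hw,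
        Icc_insert_insert_eq]
  adj_ab := hs.adj_of_insert hh hy
  adj_bc := hs.adj_of_insert (h := h') (by rw [hy]; simp [hne.symm, hh'])
    (by rw [hz, hy, Set.insert_comm])
  adj_cd := (hs.adj_of_insert (h := h) (by rw [hw]; simp [hne, hh]) (by rw [hz, hw])).symm
  adj_da := (hs.adj_of_insert hh' hw).symm
  ne_ac := by
    rintro rfl
    exact hh (hz ▸ Set.mem_insert _ _)
  ne_bd := by
    rintro rfl
    rw [hy] at hw
    have : h ∈ insert h' (s x) := hw ▸ Set.mem_insert _ _
    rcases this with h1 | h1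
    · exact hne h1
    · exact hh h1

/-- A finite interval of sets is a standard cube: its elements are given by their characteristic
functions on the difference of its endpoints. -/
lemma isCubeComplex : IsCubeComplex (latticeCubes s) where
  vertex_mem v := ⟨s v, s v, subset_rfl, by simp, by simp⟩
  inter_mem := by
    rintro C ⟨a, b, -, hf, hC⟩ D ⟨a', b', -, -, hD⟩ ⟨v, hv, hv'⟩
    have h1 : s v ∈ Set.Icc a b := hC ▸ Set.mem_image_of_mem s hv
    have h2 : s v ∈ Set.Icc a' b' := hD ▸ Set.mem_image_of_mem s hv'
    refine ⟨a ∪ a', b ∩ b', ?_, hf.subset ?_, ?_⟩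
    · exact (Set.union_subset h1.1 h2.1).trans (Set.subset_inter h1.2 h2.2)
    · exact fun e he => ⟨he.1.1, fun h => he.2 (Or.inl h)⟩
    · rw [Set.image_inter hs.inj, hC, hD, Set.Icc_inter_Icc]
      rfl
  isCube := by
    rintro C ⟨a, b, hab, hf, hC⟩
    have : Finite ↥(b \ a) := hf
    let e := (Finite.equivFin ↥(b \ a)).symm
    set n := Nat.card ↥(b \ a) with hn
    let ψ : (Fin n → Bool) → Set α := fun x => a ∪ {h | ∃ i, x i = true ∧ (e i : α) = h}
    have hmem : ∀ x i, (e i : α) ∈ ψ x ↔ x i = true := by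
      intro x i
      constructor
      · rintro (h | ⟨j, hj, h⟩)
        · exact absurd h (e i).2.2
        · rwa [← e.injective (Subtype.ext h)]
      · exact fun h => Or.inr ⟨i, h, rfl⟩
    have hle : ∀ x y, ψ x ⊆ ψ y ↔ ∀ i, x i = true → y i = true := by
      intro x y
      constructor
      · exact fun h i hi => (hmem y i).1 (h ((hmem x i).2 hi))
      · rintro h u (hu | ⟨i, hi, rfl⟩)
        · exact Or.inl hu
        · exact (hmem y i).2 (h i hi)
    have hψinj : Function.Injective ψ := by
      intro x y hxy
      ext i
      have := hmem x i
      rw [hxy, hmem] at this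
      exact Bool.eq_iff_iff.2 this.symm
    have hψI : ∀ x, ψ x ∈ Set.Icc a b := by
      refine fun x => ⟨Set.subset_union_left, Set.union_subset hab ?_⟩
      rintro _ ⟨i, -, rfl⟩
      exact (e i).2.1
    have hψsurj : ∀ u ∈ Set.Icc a b, ∃ x, ψ x = u := by
      classical
      rintro u ⟨h1, h2⟩
      refine ⟨fun i => decide ((e i : α) ∈ u), ?_⟩
      ext h
      constructor
      · rintro (hh | ⟨i, hi, rfl⟩)
        · exact h1 hh
        · simpa using hi
      · intro hh
        by_cases ha : h ∈ a
        · exact Or.inl ha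
        · refine Or.inr ⟨e.symm ⟨h, h2 hh, ha⟩, ?_, ?_⟩ <;> simp [hh]
    have hex : ∀ x, ∃ c ∈ C, s c = ψ x := by
      intro x
      have := hψI x
      rwa [← hC] at this
    choose φ hφC hφ using hex
    have hrange : Set.range φ = C := by
      refine Set.Subset.antisymm (by rintro _ ⟨x, rfl⟩; exact hφC x) fun c hc => ?_
      obtain ⟨x, hx⟩ := hψsurj (s c) (hC ▸ Set.mem_image_of_mem s hc)
      exact ⟨x, hs.inj ((hφ x).trans hx)⟩
    have hface : ∀ (x₀ x₁ : Fin n → Bool), (∀ i, x₀ i = true → x₁ i = true) →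
        ∀ x, ψ x ∈ Set.Icc (ψ x₀) (ψ x₁) ↔ x ∈ cubeFace {i | x₀ i = x₁ i} x₀ := by
      intro x₀ x₁ h01 x
      rw [Set.mem_Icc, hle, hle, ← forall_and]
      refine forall_congr' fun i => ?_
      have := h01 i
      rw [Set.mem_ofPred_eq]
      revert this
      cases x₀ i <;> cases x₁ i <;> cases x i <;> simp
    refine ⟨n, φ, fun x y hxy => hψinj (by rw [← hφ, ← hφ, hxy]), hrange, fun D hD => ⟨?_, ?_⟩⟩
    · rintro ⟨p, q, hpq, -, hI⟩
      have hsub : Set.Icc p q ⊆ Set.Icc a b := by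
        rw [← hI, ← hC]
        exact Set.image_mono hD
      obtain ⟨x₀, rfl⟩ := hψsurj p (hsub ⟨subset_rfl, hpq⟩)
      obtain ⟨x₁, rfl⟩ := hψsurj q (hsub ⟨hpq, subset_rfl⟩)
      refine ⟨{i | x₀ i = x₁ i}, x₀, ?_⟩
      have key : ∀ x, φ x ∈ D ↔ x ∈ cubeFace {i | x₀ i = x₁ i} x₀ := by
        intro x
        rw [← hface x₀ x₁ ((hle _ _).1 hpq), ← hI, ← hφ, hs.inj.mem_set_image]
      ext d
      constructor
      · intro hd
        obtain ⟨x, rfl⟩ := hrange ▸ hD hd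
        exact ⟨x, (key x).1 hd, rfl⟩
      · rintro ⟨x, hx, rfl⟩
        exact (key x).2 hx
    · classical
      rintro ⟨S, c, rfl⟩
      let x₀ : Fin n → Bool := fun i => decide (i ∈ S) && c i
      let x₁ : Fin n → Bool := fun i => !decide (i ∈ S) || c i
      have h01 : ∀ i, x₀ i = true → x₁ i = true := by
        intro i
        simp only [x₀, x₁]
        cases decide (i ∈ S) <;> cases c i <;> simp
      have hfc : cubeFace {i | x₀ i = x₁ i} x₀ = cubeFace S c := by
        ext x
        refine forall_congr' fun i => ?_
        simp only [x₀, x₁, Set.mem_ofPred_eq]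
        by_cases hi : i ∈ S <;> simp [hi]
      refine ⟨ψ x₀, ψ x₁, (hle _ _).2 h01, hf.subset ?_, ?_⟩
      · exact fun h hh => ⟨(hψI x₁).2 hh.1, fun ha => hh.2 ((hψI x₀).1 ha)⟩
      · ext u
        constructor
        · rintro ⟨_, ⟨x, hx, rfl⟩, rfl⟩
          rw [hφ, hface _ _ h01, hfc]
          exact hx
        · intro hu
          obtain ⟨x, rfl⟩ := hψsurj u ⟨(hψI x₀).1.trans hu.1, hu.2.trans (hψI x₁).2⟩
          rw [hface _ _ h01, hfc] at hu
          exact ⟨φ x, ⟨x, hu, rfl⟩, hφ x⟩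

lemma exists_median (x y z : W) :
    ∃ m, s m = (s x ∩ s y) ∪ ((s y ∩ s z) ∪ (s x ∩ s z)) := by
  obtain ⟨a, ha⟩ := hs.exists_inter x y
  obtain ⟨b, hb⟩ := hs.exists_inter y z
  obtain ⟨c, hc⟩ := hs.exists_inter x z
  obtain ⟨d, hd⟩ := hs.exists_union b c
  obtain ⟨m, hm⟩ := hs.exists_union a d
  exact ⟨m, by rw [hm, hd, ha, hb, hc]⟩

/-- The links are flag complexes because the family is closed under medians: a set that differs from
`v` on at least three elements of `S` is the median of three sets that differ from `v` on fewer
elements. -/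
lemma isNonpositivelyCurved : IsNonpositivelyCurved (latticeCubes s) := by
  classical
  intro v A hA hadj hpair
  set S : Set α := {h | ∃ a ∈ A, s a = symmDiff (s v) {h}} with hS
  have hfin : S.Finite := by
    refine (hA.biUnion (t := fun a => symmDiff (s v) (s a)) fun a _ => ?_).subset ?_
    · exact (hs.finite_sdiff a v).union (hs.finite_sdiff v a)
    · rintro h ⟨a, ha, he⟩
      refine Set.mem_biUnion ha ?_
      rw [he, symmDiff_symmDiff_cancel_left]
      rfl
  have key : ∀ T : Finset α, ↑T ⊆ S → ∃ w, s w = symmDiff (s v) T := by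
    intro T
    induction hn : T.card using Nat.strong_induction_on generalizing T with
    | _ n IH =>
      intro hT
      by_cases h2 : 2 < T.card
      · obtain ⟨a, ha, b, hb, c, hc, hab, hac, hbc⟩ := Finset.two_lt_card.1 h2
        have hdel : ∀ a ∈ T, ∃ w, s w = symmDiff (s v) (T.erase a) := fun a ha =>
          IH _ (hn ▸ Finset.card_erase_lt_of_mem ha) _ rfl
            ((Finset.coe_subset.2 (Finset.erase_subset a T)).trans hT)
        obtain ⟨x, hx⟩ := hdel a ha
        obtain ⟨y, hy⟩ := hdel b hb
        obtain ⟨z, hz⟩ := hdel c hc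
        obtain ⟨m, hm⟩ := hs.exists_median x y z
        refine ⟨m, ?_⟩
        rw [hm, hx, hy, hz]
        simp only [Finset.coe_erase]
        exact median_symmDiff hab hac hbc
      · have hc : T.card = 0 ∨ T.card = 1 ∨ T.card = 2 := by omega
        rcases hc with hc | hc | hc
        · rw [Finset.card_eq_zero] at hc
          exact ⟨v, by rw [hc, Finset.coe_empty]; exact (symmDiff_bot (s v)).symm⟩
        · obtain ⟨h, rfl⟩ := Finset.card_eq_one.1 hc
          obtain ⟨a, -, ha⟩ := hT (by simp : h ∈ _)
          exact ⟨a, by simpa using ha⟩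
        · obtain ⟨h, h', hne, rfl⟩ := Finset.card_eq_two.1 hc
          obtain ⟨a, ha, hsa⟩ := hT (by simp : h ∈ _)
          obtain ⟨b, hb, hsb⟩ := hT (by simp : h' ∈ _)
          have hab : a ≠ b := by
            rintro rfl
            exact hne (Set.singleton_injective (symmDiff_right_injective (s v)
              (hsa.symm.trans hsb)))
          obtain ⟨C, ⟨p, q, hpq, -, hI⟩, hvC, hE⟩ := hpair a ha b hb hab
          have haC : a ∈ C := ((Set.ext_iff.1 hE a).1 (by simp)).1
          have hbC : b ∈ C := ((Set.ext_iff.1 hE b).1 (by simp)).1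
          have h1 : s v ∈ Set.Icc p q := hI ▸ Set.mem_image_of_mem s hvC
          have h2 : s a ∈ Set.Icc p q := hI ▸ Set.mem_image_of_mem s haC
          have h3 : s b ∈ Set.Icc p q := hI ▸ Set.mem_image_of_mem s hbC
          -- At each element, this set agrees with one of `s a` and `s b`.
          have h4 : symmDiff (s v) {h, h'} ∈ Set.Icc p q := by
            rw [hsa] at h2
            rw [hsb] at h3
            constructor
            · intro e he
              have h2 := h2.1 he
              have h3 := h3.1 he
              simp only [Set.mem_symmDiff, Set.mem_singleton_iff, Set.mem_insert_iff] at *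
              by_cases heh : e = h
              · subst heh; tauto
              · tauto
            · intro e he
              have h2 := @h2.2 e
              have h3 := @h3.2 e
              simp only [Set.mem_symmDiff, Set.mem_singleton_iff, Set.mem_insert_iff] at *
              by_cases heh : e = h
              · subst heh; tauto
              · tauto
          rw [← hI] at h4
          obtain ⟨w, -, hw⟩ := h4
          exact ⟨w, by simpa using hw⟩
  have hsurj : s '' (s ⁻¹' Set.Icc (s v \ S) (s v ∪ S)) = Set.Icc (s v \ S) (s v ∪ S) := by
    refine Set.image_preimage_eq_of_subset fun u hu => ?_
    have hu' := mem_Icc_sdiff_union_iff.1 hu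
    obtain ⟨w, hw⟩ := key (hfin.subset hu').toFinset (by simpa using hu')
    exact ⟨w, by rw [hw, Set.Finite.coe_toFinset, symmDiff_symmDiff_cancel_left]⟩
  refine ⟨s ⁻¹' Set.Icc (s v \ S) (s v ∪ S), ⟨_, _, ?_, hfin.subset ?_, hsurj⟩, ?_, ?_⟩
  · exact Set.sdiff_subset.trans Set.subset_union_left
  · rintro e ⟨h1 | h1, h2⟩
    · by_contra h3
      exact h2 ⟨h1, h3⟩
    · exact h1
  · exact ⟨Set.sdiff_subset, Set.subset_union_left⟩
  · ext w
    rw [Set.mem_ofPred_eq, Set.mem_preimage, mem_Icc_sdiff_union_iff, hs.adj_iff]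
    constructor
    · intro hw
      obtain ⟨h, hh⟩ := hs.adj_iff.1 (hadj w hw)
      refine ⟨?_, h, hh⟩
      rw [hh, symmDiff_symmDiff_cancel_left, Set.singleton_subset_iff]
      exact ⟨w, hw, hh⟩
    · rintro ⟨h1, h, hh⟩
      rw [hh, symmDiff_symmDiff_cancel_left, Set.singleton_subset_iff] at h1
      obtain ⟨a, ha, he⟩ := h1
      rwa [hs.inj (hh.trans he.symm)]

end IsDiscreteLattice

/-- Along the path, elements are only added. -/
def IsAscending (s : W → Set α) :
    ∀ {x y : W}, (skeleton (latticeCubes s)).Walk x y → Prop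
  | _, _, .nil => True
  | x, _, .cons (v := v) _ p => s x ⊆ s v ∧ IsAscending s p

lemma IsAscending.subset {x y : W} {p : (skeleton (latticeCubes s)).Walk x y}
    (h : IsAscending s p) : s x ⊆ s y := by
  induction p with
  | nil => exact subset_rfl
  | cons _ p ih => exact h.1.trans (ih h.2)

lemma IsAscending.append {x y z : W} {p : (skeleton (latticeCubes s)).Walk x y}
    {q : (skeleton (latticeCubes s)).Walk y z} (hp : IsAscending s p) (hq : IsAscending s q) :
    IsAscending s (p.append q) := by
  induction p with
  | nil => exact hq
  | cons _ p ih => exact ⟨hp.1, ih hp.2 hq⟩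

lemma Homotopic.cons {x y z : V} (h : (skeleton K).Adj x y) {p q : (skeleton K).Walk y z}
    (hpq : Homotopic K p q) : Homotopic K (.cons h p) (.cons h q) :=
  .append (.refl (.cons h .nil)) hpq

lemma homotopic_append_reverse {x y : V} (p : (skeleton K).Walk x y) :
    Homotopic K (p.append p.reverse) .nil := by
  simpa using homotopic_reverse_append p.reverse

lemma homotopic_cons_cons {x y z : V} (h : (skeleton K).Adj x y) (p : (skeleton K).Walk x z) :
    Homotopic K (.cons h (.cons h.symm p)) p :=
  .append (.backtrack h) (.refl p)

namespace IsDiscreteLattice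

variable (hs : IsDiscreteLattice s)

include hs

lemma exists_eq_insert {x y : W} (h : (skeleton (latticeCubes s)).Adj x y) (hxy : s x ⊆ s y) :
    ∃ e ∉ s x, s y = insert e (s x) := by
  obtain ⟨e, he⟩ := hs.adj_iff.1 h
  by_cases hx : e ∈ s x
  · rw [symmDiff_singleton_eq_sdiff hx] at he
    exact absurd rfl (he ▸ hxy hx).2
  · exact ⟨e, hx, by rw [he, symmDiff_singleton_eq_insert hx]⟩

lemma subset_or_subset {x y : W} (h : (skeleton (latticeCubes s)).Adj x y) :
    s x ⊆ s y ∨ s y ⊆ s x := by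
  obtain ⟨e, he⟩ := hs.adj_iff.1 h
  by_cases hx : e ∈ s x
  · rw [symmDiff_singleton_eq_sdiff hx] at he
    exact Or.inr (he ▸ Set.sdiff_subset)
  · rw [symmDiff_singleton_eq_insert hx] at he
    exact Or.inl (he ▸ Set.subset_insert _ _)

lemma ncard_sdiff_lt {x y z : W} {e : α} (hx : e ∉ s x) (he : e ∈ s y) (hz : e ∈ s z)
    (hxz : s x ⊆ s z) : (s y \ s z).ncard < (s y \ s x).ncard :=
  Set.ncard_lt_ncard ⟨Set.sdiff_subset_sdiff_right hxz, fun h => (h ⟨he, hx⟩).2 hz⟩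
    (hs.finite_sdiff x y)

lemma exists_ascending {x y : W} (h : s x ⊆ s y) :
    ∃ p : (skeleton (latticeCubes s)).Walk x y, IsAscending s p := by
  induction hn : (s y \ s x).ncard using Nat.strong_induction_on generalizing x with
  | _ n IH =>
    by_cases hyx : s y ⊆ s x
    · obtain rfl := hs.inj (h.antisymm hyx)
      exact ⟨.nil, trivial⟩
    obtain ⟨z, e, he, hz⟩ := hs.exists_insert x y ⟨h, hyx⟩
    have hez : e ∈ s z := hz ▸ Set.mem_insert _ _
    have hxz : s x ⊆ s z := hz ▸ Set.subset_insert _ _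
    obtain ⟨p, hp⟩ := IH _ (hn ▸ hs.ncard_sdiff_lt he.2 he.1 hez hxz)
      (hz ▸ Set.insert_subset he.1 h) rfl
    exact ⟨.cons (hs.adj_of_insert he.2 hz) p, hxz, hp⟩

/-- Two ascending paths with the same endpoints are homotopic: their first edges span a square, the
fourth vertex of which is a union. -/
lemma homotopic_of_isAscending {x y : W} {p q : (skeleton (latticeCubes s)).Walk x y}
    (hp : IsAscending s p) (hq : IsAscending s q) : Homotopic (latticeCubes s) p q := by
  induction hn : (s y \ s x).ncard using Nat.strong_induction_on generalizing x with
  | _ n IH =>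
    cases p with
    | nil =>
      cases q with
      | nil => exact .refl _
      | cons h q =>
        obtain ⟨e, he, h'⟩ := hs.exists_eq_insert h hq.1
        exact absurd (hq.2.subset (h' ▸ Set.mem_insert _ _)) he
    | @cons _ a _ ha p =>
      cases q with
      | nil =>
        obtain ⟨e, he, h'⟩ := hs.exists_eq_insert ha hp.1
        exact absurd (hp.2.subset (h' ▸ Set.mem_insert _ _)) he
      | @cons _ b _ hb q =>
        obtain ⟨e, he, hea⟩ := hs.exists_eq_insert ha hp.1
        obtain ⟨f, hf, hfb⟩ := hs.exists_eq_insert hb hq.1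
        have hay := hp.2.subset
        have hby := hq.2.subset
        have hea' : e ∈ s a := hea ▸ Set.mem_insert _ _
        have hfb' : f ∈ s b := hfb ▸ Set.mem_insert _ _
        have hla := hn ▸ hs.ncard_sdiff_lt he (hay hea') hea' hp.1
        have hlb := hn ▸ hs.ncard_sdiff_lt hf (hby hfb') hfb' hq.1
        by_cases hef : e = f
        · subst hef
          obtain rfl := hs.inj (hea.trans hfb.symm)
          exact (IH _ hla hp.2 hq.2 rfl).cons ha
        · obtain ⟨c, hc⟩ := hs.exists_union a b
          have hac : s a ⊆ s c := hc ▸ Set.subset_union_left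
          have hbc : s b ⊆ s c := hc ▸ Set.subset_union_right
          obtain ⟨r, hr⟩ := hs.exists_ascending (hc ▸ Set.union_subset hay hby : s c ⊆ s y)
          have hsq := hs.isSquare (z := c) hef he hf hea hfb (by
            rw [hc, hea, hfb]
            ext
            simp
            tauto)
          have h1 := (IH _ hla (p := p) (q := .cons hsq.adj_bc r) hp.2 ⟨hac, hr⟩ rfl).cons ha
          have h2 := (IH _ hlb (p := q) (q := .cons hsq.adj_cd.symm r) hq.2 ⟨hbc, hr⟩ rfl).cons hb
          have h3 : Homotopic (latticeCubes s) (.cons ha (.cons hsq.adj_bc r))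
              (.cons hb (.cons hsq.adj_cd.symm r)) :=
            .append (.square hsq) (.refl r)
          exact (h1.trans h3).trans h2.symm

/-- Every path can be deformed into an ascending path followed by a descending one. -/
lemma exists_homotopic_ascending {x y : W} (p : (skeleton (latticeCubes s)).Walk x y) :
    ∃ (z : W) (u : (skeleton (latticeCubes s)).Walk x z)
      (w : (skeleton (latticeCubes s)).Walk y z), IsAscending s u ∧ IsAscending s w ∧
        Homotopic (latticeCubes s) p (u.append w.reverse) := by
  induction p with
  | nil => exact ⟨_, .nil, .nil, trivial, trivial, .refl _⟩
  | @cons x x' y h p ih =>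
    obtain ⟨z, u, w, hu, hw, hp⟩ := ih
    rcases hs.subset_or_subset h with hx | hx
    · exact ⟨z, .cons h u, w, ⟨hx, hu⟩, hw, hp.cons h⟩
    · obtain ⟨z', hz'⟩ := hs.exists_union x z
      obtain ⟨r, hr⟩ := hs.exists_ascending (hz' ▸ Set.subset_union_left : s x ⊆ s z')
      obtain ⟨t, ht⟩ := hs.exists_ascending (hz' ▸ Set.subset_union_right : s z ⊆ s z')
      refine ⟨z', r, w.append t, hr, hw.append ht, ?_⟩
      have h1 : Homotopic (latticeCubes s) (u.append t) (.cons h.symm r) :=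
        hs.homotopic_of_isAscending (hu.append ht) ⟨hx, hr⟩
      have h2 : Homotopic (latticeCubes s) (u.append (t.append t.reverse)) (u.append .nil) :=
        .append (.refl u) (homotopic_append_reverse t)
      rw [SimpleGraph.Walk.append_nil, SimpleGraph.Walk.append_assoc] at h2
      have h3 : Homotopic (latticeCubes s) u (.cons h.symm (r.append t.reverse)) :=
        h2.symm.trans (.append h1 (.refl t.reverse))
      have h4 : Homotopic (latticeCubes s) (u.append w.reverse)
          (.cons h.symm ((r.append t.reverse).append w.reverse)) :=
        .append h3 (.refl w.reverse)
      have h5 := ((hp.trans h4).cons h).trans (homotopic_cons_cons h _)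
      rwa [SimpleGraph.Walk.reverse_append, SimpleGraph.Walk.append_assoc]

lemma isSimplyConnected [Nonempty W] : IsSimplyConnected (latticeCubes s) := by
  refine ⟨⟨fun x y => ?_⟩, fun x p => ?_⟩
  · obtain ⟨z, hz⟩ := hs.exists_union x y
    obtain ⟨p, -⟩ := hs.exists_ascending (hz ▸ Set.subset_union_left : s x ⊆ s z)
    obtain ⟨q, -⟩ := hs.exists_ascending (hz ▸ Set.subset_union_right : s y ⊆ s z)
    exact ⟨p.append q.reverse⟩
  · obtain ⟨z, u, w, hu, hw, hp⟩ := hs.exists_homotopic_ascending p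
    exact hp.trans ((Homotopic.append (hs.homotopic_of_isAscending hu hw) (.refl _)).trans
      (homotopic_append_reverse w))

/-- The cube complex of a discrete distributive lattice of sets is CAT(0). -/
theorem isCAT0CubeComplex [Nonempty W] : IsCAT0CubeComplex (latticeCubes s) :=
  ⟨hs.isCubeComplex, hs.isNonpositivelyCurved, hs.isSimplyConnected⟩

end IsDiscreteLattice

end Lattice

/-! ### The half-space axis and the minimal set -/

lemma IsAxis.isPeriodicPath {g : Equiv.Perm V} {γ : ℤ → V} (h : IsAxis K g γ) :
    IsPeriodicPath K g γ :=
  ⟨fun i => SimpleGraph.dist_eq_one_iff_adj.1 (by rw [h.1]; omega), h.2⟩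

/-- The half-spaces of the positive half-space axis that contain `x`. -/
def posPart (K : Set (Set V)) (g : Equiv.Perm V) (x : V) : Set (Set V) :=
  {H | H ∈ posHalfSpaceAxis K g ∧ x ∈ H}

/-- The half-spaces containing exactly one of `x` and `y` all belong to the half-space axis. -/
def AgreeOffAxis (K : Set (Set V)) (g : Equiv.Perm V) (x y : V) : Prop :=
  ∀ H ∈ halfSpaces K, H ∉ posHalfSpaceAxis K g → Hᶜ ∉ posHalfSpaceAxis K g → (x ∈ H ↔ y ∈ H)

lemma mem_zpow_neg_image {g : Equiv.Perm V} (n : ℤ) {x : V} {H : Set V} :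
    x ∈ (g ^ (-n)) '' H ↔ (g ^ n) x ∈ H := by
  rw [zpow_neg]
  constructor
  · rintro ⟨y, hy, rfl⟩
    simpa using hy
  · exact fun h => ⟨_, h, by simp⟩

lemma posHalfSpaceAxis_subset {g : Equiv.Perm V} : posHalfSpaceAxis K g ⊆ halfSpaces K := by
  rintro H ⟨γ, _, i, hH⟩
  exact hH.1

namespace IsCAT0CubeComplex

variable (hK : IsCAT0CubeComplex K) {g : Equiv.Perm V} (hg : IsHyperbolic K g)

include hK in
lemma mem_of_axis {γ : ℤ → V} (hγ : IsAxis K g γ) {i : ℤ} {H : Set V}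
    (hH : H ∈ interval K (γ i) (γ (i + 1))) (j : ℤ) : γ j ∈ H ↔ i + 1 ≤ j := by
  rw [hK.eq_side hH.1 (hγ.isPeriodicPath.adj i).symm hH.2.1 hH.2.2]
  change (skeleton K).dist (γ j) (γ (i + 1)) < (skeleton K).dist (γ j) (γ i) ↔ _
  rw [hγ.1, hγ.1]
  omega

include hK hg

lemma image_mem_interval {γ : ℤ → V} (hγ : IsAxis K g γ) {i : ℤ} {H : Set V}
    (hH : H ∈ interval K (γ i) (γ (i + 1))) (k : ℤ) :
    (g ^ k) '' H ∈ interval K (γ (i + k * translationDistance K g))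
      (γ (i + k * translationDistance K g + 1)) := by
  refine ⟨(hg.isAutomorphism.zpow k).image_mem_halfSpaces hK hH.1, ?_, ?_⟩
  · rw [show i + k * translationDistance K g + 1 = i + 1 + k * translationDistance K g by ring,
      ← hγ.isPeriodicPath.zpow, (g ^ k).injective.mem_set_image]
    exact hH.2.1
  · rw [← hγ.isPeriodicPath.zpow, (g ^ k).injective.mem_set_image]
    exact hH.2.2

lemma image_injective {H : Set V} (hH : H ∈ posHalfSpaceAxis K g) :
    Function.Injective fun k : ℤ => (g ^ k) '' H := by
  obtain ⟨γ, hγ, i, hi⟩ := hH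
  have key : ∀ k k' : ℤ, (g ^ k) '' H = (g ^ k') '' H → k ≤ k' := by
    intro k k' h
    have h1 := hK.mem_of_axis hγ (hK.image_mem_interval hg hγ hi k)
    have h2 := hK.mem_of_axis hγ (hK.image_mem_interval hg hγ hi k')
    rw [h] at h1
    have h3 := (h1 _).1 ((h2 (i + k' * translationDistance K g + 1)).2 le_rfl)
    have h4 : k * (translationDistance K g : ℤ) ≤ k' * translationDistance K g := by linarith
    exact le_of_mul_le_mul_right h4 (by exact_mod_cast hg.pos)
  exact fun k k' h => (key k k' h).antisymm (key k' k h.symm)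

/-- Every forward orbit eventually stays in every half-space of the positive half-space axis: a
translate of the half-space containing a given vertex of an axis but not `x` is one of the finitely
many half-spaces that separate the two. -/
lemma finite_notMem {H : Set V} (hH : H ∈ posHalfSpaceAxis K g) (x : V) :
    {n : ℕ | (g ^ (n : ℤ)) x ∉ H}.Finite := by
  obtain ⟨γ, hγ, i, hi⟩ := id hH
  refine Set.Finite.of_finite_image (f := fun n : ℕ => (g ^ (-(n : ℤ))) '' H)
    ((hK.interval_finite x (γ (i + 1))).subset ?_) fun n _ m _ h => ?_
  · rintro _ ⟨n, hn, rfl⟩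
    have h1 := hK.image_mem_interval hg hγ hi (-n)
    refine ⟨h1.1, (hK.mem_of_axis hγ h1 _).2 ?_, fun h => hn (mem_zpow_neg_image _ |>.1 h)⟩
    have : 0 ≤ (n : ℤ) * translationDistance K g := by positivity
    linarith
  · have := hK.image_injective hg hH h
    omega

/-- Every backward orbit eventually leaves every half-space of the positive half-space axis. -/
lemma finite_mem {H : Set V} (hH : H ∈ posHalfSpaceAxis K g) (x : V) :
    {n : ℕ | (g ^ (-(n : ℤ))) x ∈ H}.Finite := by
  obtain ⟨γ, hγ, i, hi⟩ := id hH
  refine Set.Finite.of_finite_image (f := fun n : ℕ => (g ^ (n : ℤ)) '' H)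
    ((hK.interval_finite (γ i) x).subset ?_) fun n _ m _ h => ?_
  · rintro _ ⟨n, hn, rfl⟩
    have h1 := hK.image_mem_interval hg hγ hi n
    refine ⟨h1.1, ?_, fun h => ?_⟩
    · have := mem_zpow_neg_image (g := g) (-(n : ℤ)) (x := x) (H := H)
      rw [neg_neg] at this
      exact this.2 hn
    · have h2 := (hK.mem_of_axis hγ h1 _).1 h
      have : 0 ≤ (n : ℤ) * translationDistance K g := by positivity
      linarith
  · have := hK.image_injective hg hH h
    omega

/-- The forward orbit of a vertex eventually stays in `H`, hence not in `Hᶜ`. -/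
lemma compl_notMem_posHalfSpaceAxis {H : Set V} (hH : H ∈ posHalfSpaceAxis K g) :
    Hᶜ ∉ posHalfSpaceAxis K g := by
  intro hH'
  obtain ⟨x⟩ := hK.connected.nonempty
  obtain ⟨n, hn⟩ := ((hK.finite_notMem hg hH x).union
    (hK.finite_notMem hg hH' x)).exists_notMem
  simp only [Set.mem_union, Set.mem_ofPred_eq, Set.mem_compl_iff] at hn
  tauto

lemma interval_subset {x : V} (hx : x ∈ minVertices K g) :
    interval K x (g x) ⊆ posHalfSpaceAxis K g := by
  rintro H ⟨hH, h1, h2⟩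
  obtain ⟨γ, hγ, rfl⟩ := hK.exists_axis hg hx
  rw [hγ.2] at h1
  obtain ⟨k, -, h3, h4⟩ := exists_last_mem (fun j => γ j ∉ H) 0 _ h2 (not_not.2 h1)
  exact ⟨γ, hγ, 0 + k, hH, not_not.1 h4, h3⟩

lemma apply_mem {x : V} (hx : x ∈ minVertices K g) {H : Set V} (hH : H ∈ posHalfSpaceAxis K g)
    (h : x ∈ H) : g x ∈ H := by
  by_contra h'
  exact hK.compl_notMem_posHalfSpaceAxis hg hH
    (hK.interval_subset hg hx ⟨hK.compl_mem (posHalfSpaceAxis_subset hH), h', not_not.2 h⟩)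

omit hK in
lemma zpow_mem_minVertices {x : V} (hx : x ∈ minVertices K g) (k : ℤ) :
    (g ^ k) x ∈ minVertices K g := by
  change (skeleton K).dist _ _ = _
  rw [← Equiv.Perm.mul_apply, ← zpow_one_add, add_comm, zpow_add_one, Equiv.Perm.mul_apply,
    (hg.isAutomorphism.zpow k).dist_eq]
  exact hx

lemma zpow_mem {x : V} (hx : x ∈ minVertices K g) {H : Set V} (hH : H ∈ posHalfSpaceAxis K g)
    (h : x ∈ H) (n : ℕ) : (g ^ (n : ℤ)) x ∈ H := by
  induction n with
  | zero => simpa using h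
  | succ n ih =>
    rw [Nat.cast_succ, add_comm, zpow_one_add, Equiv.Perm.mul_apply]
    exact hK.apply_mem hg (zpow_mem_minVertices hg hx n) hH ih

/-- Crossing a half-space of the positive half-space axis changes nothing else. -/
lemma posPart_eq_insert {x x' : V} (h : (skeleton K).Adj x x')
    (hH : side K x' x ∈ posHalfSpaceAxis K g) :
    posPart K g x' = insert (side K x' x) (posPart K g x) ∧ AgreeOffAxis K g x x' := by
  constructor
  · ext G
    constructor
    · rintro ⟨hG, hx'⟩
      by_cases hx : x ∈ G
      · exact Or.inr ⟨hG, hx⟩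
      · exact Or.inl (hK.eq_side (posHalfSpaceAxis_subset hG) h.symm hx' hx)
    · rintro (rfl | ⟨hG, hx⟩)
      · exact ⟨hH, left_mem_side h.symm⟩
      · refine ⟨hG, by_contra fun hx' => ?_⟩
        have h1 := hK.eq_side (posHalfSpaceAxis_subset hG) h hx hx'
        rw [← hK.compl_side h, ← h1] at hH
        exact hK.compl_notMem_posHalfSpaceAxis hg hG hH
  · intro G hG hG1 hG2
    by_cases hx : x ∈ G <;> by_cases hx' : x' ∈ G
    · simp [hx, hx']
    · refine absurd ?_ hG2
      rwa [hK.eq_side hG h hx hx', hK.compl_side h]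
    · refine absurd ?_ hG1
      rwa [hK.eq_side hG h.symm hx' hx]
    · simp [hx, hx']

/-- If some half-space of the positive half-space axis contains `y` but not `x`, then one can move
from `x` towards `y` inside the minimal set, by crossing such a half-space. It is found among the
maximal half-spaces that contain `g x` and `y` but not `x`. -/
lemma exists_move_up {x y : V} (hx : x ∈ minVertices K g) (hy : y ∈ minVertices K g) {H : Set V}
    (hH : H ∈ posHalfSpaceAxis K g) (hyH : y ∈ H) (hxH : x ∉ H) :
    ∃ x' ∈ minVertices K g, (skeleton K).Adj x x' ∧ side K x' x ∈ posHalfSpaceAxis K g ∧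
      y ∈ side K x' x := by
  classical
  have hex : ∃ n : ℕ, (g ^ (n : ℤ)) x ∈ H := by
    obtain ⟨n, hn⟩ := (hK.finite_notMem hg hH x).exists_notMem
    exact ⟨n, not_not.1 hn⟩
  -- Translate `H` so that the orbit of `x` enters it between `x` and `g x`.
  have hne : (interval K x (g x) ∩ {G | y ∈ G}).Nonempty := by
    have h1 := Nat.find_spec hex
    obtain ⟨n, hn⟩ : ∃ n, Nat.find hex = n + 1 := Nat.exists_eq_succ_of_ne_zero fun h => by
      rw [h] at h1
      exact hxH (by simpa using h1)
    have h2 := Nat.find_min hex (m := n) (by omega)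
    rw [hn, Nat.cast_succ, zpow_add_one, Equiv.Perm.mul_apply] at h1
    exact ⟨(g ^ (-(n : ℤ))) '' H, ⟨(hg.isAutomorphism.zpow _).image_mem_halfSpaces hK
      (posHalfSpaceAxis_subset hH), (mem_zpow_neg_image _).2 h1,
      fun h => h2 ((mem_zpow_neg_image _).1 h)⟩,
      (mem_zpow_neg_image _).2 (hK.zpow_mem hg hy hH hyH n)⟩
  obtain ⟨G, ⟨hG, hyG⟩, hmax⟩ := ((hK.interval_finite x (g x)).inter_of_left _).exists_maximal hne
  rcases hK.adjacent_or_exists_ssuperset hG.1 hG.2.2 with ⟨x', hadj, rfl⟩ | ⟨G', hG', hGG', hxG'⟩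
  · refine ⟨x', ?_, hadj, hK.interval_subset hg hx hG, hyG⟩
    refine le_antisymm ?_ (translationDistance_le g x')
    have h1 := hK.connected.dist_triangle (u := x') (v := g x) (w := g x')
    have h2 := (hK.mem_side_iff hadj.symm _).1 hG.2.1
    have h3 : (skeleton K).dist x (g x) = _ := hx
    rw [hg.isAutomorphism.dist_eq, SimpleGraph.dist_eq_one_iff_adj.2 hadj] at h1
    rw [SimpleGraph.dist_comm, SimpleGraph.dist_comm (v := x)] at h2
    omega
  · exact absurd (hmax ⟨⟨hG', hGG'.1 hG.2.1, hxG'⟩, hGG'.1 hyG⟩ hGG'.1) hGG'.2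

/-- The analogue of `exists_move_up` for half-spaces containing `x` but not `y`. -/
lemma exists_move_down {x y : V} (hx : x ∈ minVertices K g) (hy : y ∈ minVertices K g)
    {H : Set V} (hH : H ∈ posHalfSpaceAxis K g) (hyH : y ∉ H) (hxH : x ∈ H) :
    ∃ x' ∈ minVertices K g, (skeleton K).Adj x' x ∧ side K x x' ∈ posHalfSpaceAxis K g ∧
      y ∉ side K x x' := by
  classical
  have hex : ∃ n : ℕ, (g ^ (-(n : ℤ))) x ∉ H := by
    obtain ⟨n, hn⟩ := (hK.finite_mem hg hH x).exists_notMem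
    exact ⟨n, hn⟩
  have hx1 : g⁻¹ x ∈ minVertices K g := by
    simpa using zpow_mem_minVertices hg hx (-1)
  have hI : interval K (g⁻¹ x) x ⊆ posHalfSpaceAxis K g := by
    simpa using hK.interval_subset hg hx1
  have hne : (interval K (g⁻¹ x) x ∩ {G | y ∉ G}).Nonempty := by
    have h1 := Nat.find_spec hex
    obtain ⟨n, hn⟩ : ∃ n, Nat.find hex = n + 1 := Nat.exists_eq_succ_of_ne_zero fun h => by
      rw [h] at h1
      exact h1 (by simpa using hxH)
    have h2 := not_not.1 (Nat.find_min hex (m := n) (by omega))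
    rw [hn, Nat.cast_succ, neg_add, zpow_add, Equiv.Perm.mul_apply, zpow_neg_one] at h1
    have hmem := fun z => mem_zpow_neg_image (g := g) (-(n : ℤ)) (x := z) (H := H)
    simp only [neg_neg] at hmem
    refine ⟨(g ^ (n : ℤ)) '' H, ⟨(hg.isAutomorphism.zpow _).image_mem_halfSpaces hK
      (posHalfSpaceAxis_subset hH), (hmem _).2 h2, fun h => h1 ((hmem _).1 h)⟩,
      fun h => hyH ?_⟩
    have h3 := hK.zpow_mem hg (zpow_mem_minVertices hg hy (-(n : ℤ))) hH ((hmem y).1 h) n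
    rwa [← Equiv.Perm.mul_apply, ← zpow_add, add_neg_cancel, zpow_zero] at h3
  obtain ⟨G, ⟨hG, hyG⟩, hmin⟩ := ((hK.interval_finite (g⁻¹ x) x).inter_of_left _).exists_minimal hne
  rcases hK.adjacent_or_exists_ssuperset (hK.compl_mem hG.1) (not_not.2 hG.2.1) with
    ⟨x', hadj, he⟩ | ⟨G', hG', hGG', hxG'⟩
  · have he' : G = side K x x' := by rw [← hK.compl_side hadj.symm, ← he, compl_compl]
    subst he'
    refine ⟨x', ?_, hadj.symm, hI hG, hyG⟩
    refine le_antisymm ?_ (translationDistance_le g x')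
    have h1 := hK.connected.dist_triangle (u := g⁻¹ x') (v := g⁻¹ x) (w := x')
    have h2 := (hK.notMem_side_iff hadj _).1 hG.2.2
    have h3 := hg.isAutomorphism.inv.dist_eq x' x
    have h4 := hg.isAutomorphism.dist_eq (g⁻¹ x') x'
    have h5 : (skeleton K).dist (g⁻¹ x) (g (g⁻¹ x)) = _ := hx1
    rw [show g (g⁻¹ x') = x' by simp] at h4
    rw [show g (g⁻¹ x) = x by simp] at h5
    rw [SimpleGraph.dist_eq_one_iff_adj.2 hadj.symm] at h3
    omega
  · have h1 : G'ᶜ ⊆ G := Set.compl_subset_comm.1 hGG'.1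
    refine absurd (hmin ⟨⟨hK.compl_mem hG', hxG', fun h => h (hGG'.1 hG.2.2)⟩,
      fun h => hyG (h1 h)⟩ h1) fun h => hGG'.2 ?_
    exact Set.subset_compl_comm.1 h

omit hg in
lemma finite_posPart_sdiff (x y : V) : (posPart K g y \ posPart K g x).Finite :=
  (hK.interval_finite x y).subset fun _ hG =>
    ⟨posHalfSpaceAxis_subset hG.1.1, hG.1.2, fun h => hG.2 ⟨hG.1.1, h⟩⟩

/-- The joins of the minimal set, taken without leaving the vertices that agree with `x` off the
half-space axis. -/
lemma exists_posPart_union {x y : V} (hx : x ∈ minVertices K g) (hy : y ∈ minVertices K g) :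
    ∃ z ∈ minVertices K g, posPart K g z = posPart K g x ∪ posPart K g y ∧
      AgreeOffAxis K g x z := by
  induction hn : (posPart K g y \ posPart K g x).ncard using Nat.strong_induction_on
    generalizing x with
  | _ n IH =>
    by_cases hyx : posPart K g y ⊆ posPart K g x
    · exact ⟨x, hx, (Set.union_eq_left.2 hyx).symm, fun _ _ _ _ => Iff.rfl⟩
    obtain ⟨H, hHy, hHx⟩ := Set.not_subset.1 hyx
    obtain ⟨x', hx', hadj, hs, hys⟩ := hK.exists_move_up hg hx hy hHy.1 hHy.2
      fun h => hHx ⟨hHy.1, h⟩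
    obtain ⟨h1, h2⟩ := hK.posPart_eq_insert hg hadj hs
    have hlt : (posPart K g y \ posPart K g x').ncard < n := by
      rw [← hn]
      refine Set.ncard_lt_ncard ⟨fun G hG => ⟨hG.1, fun h => hG.2 ?_⟩, fun h => ?_⟩
        (hK.finite_posPart_sdiff x y)
      · rw [h1]
        exact Or.inr h
      · refine (h ⟨⟨hs, hys⟩, fun h => right_notMem_side _ _ h.2⟩).2 ?_
        rw [h1]
        exact Or.inl rfl
    obtain ⟨z, hz, h3, h4⟩ := IH _ hlt hx' rfl
    refine ⟨z, hz, ?_, fun G hG hG1 hG2 => (h2 G hG hG1 hG2).trans (h4 G hG hG1 hG2)⟩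
    have : side K x' x ∈ posPart K g y := ⟨hs, hys⟩
    rw [h3, h1, Set.insert_union, Set.insert_eq_of_mem (Set.mem_union_right _ this)]

/-- The meets of the minimal set. -/
lemma exists_posPart_inter {x y : V} (hx : x ∈ minVertices K g) (hy : y ∈ minVertices K g) :
    ∃ z ∈ minVertices K g, posPart K g z = posPart K g x ∩ posPart K g y := by
  induction hn : (posPart K g x \ posPart K g y).ncard using Nat.strong_induction_on
    generalizing x with
  | _ n IH =>
    by_cases hxy : posPart K g x ⊆ posPart K g y
    · exact ⟨x, hx, (Set.inter_eq_left.2 hxy).symm⟩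
    obtain ⟨H, hHx, hHy⟩ := Set.not_subset.1 hxy
    obtain ⟨x', hx', hadj, hs, hys⟩ := hK.exists_move_down hg hx hy hHx.1
      (fun h => hHy ⟨hHx.1, h⟩) hHx.2
    obtain ⟨h1, -⟩ := hK.posPart_eq_insert hg hadj hs
    have hsy : side K x x' ∉ posPart K g y := fun h => hys h.2
    have hlt : (posPart K g x' \ posPart K g y).ncard < n := by
      rw [← hn]
      refine Set.ncard_lt_ncard ⟨fun G hG => ⟨?_, hG.2⟩, fun h => ?_⟩
        (hK.finite_posPart_sdiff y x)
      · rw [h1]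
        exact Or.inr hG.1
      · refine right_notMem_side x x' (h ⟨?_, hsy⟩).1.2
        rw [h1]
        exact Or.inl rfl
    obtain ⟨z, hz, h3⟩ := IH _ hlt hx' rfl
    exact ⟨z, hz, by rw [h3, h1, Set.insert_inter_of_notMem hsy]⟩

omit hg in
lemma eq_of_posPart_eq {x y : V} (h : posPart K g x = posPart K g y)
    (ho : AgreeOffAxis K g x y) : x = y := by
  refine hK.ext_halfSpaces fun H hH => ?_
  have key : ∀ G ∈ posHalfSpaceAxis K g, x ∈ G ↔ y ∈ G := fun G hG =>
    ⟨fun hx => (h ▸ (⟨hG, hx⟩ : G ∈ posPart K g x) : G ∈ posPart K g y).2,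
      fun hy => (h ▸ (⟨hG, hy⟩ : G ∈ posPart K g y) : G ∈ posPart K g x).2⟩
  by_cases h1 : H ∈ posHalfSpaceAxis K g
  · exact key H h1
  by_cases h2 : Hᶜ ∈ posHalfSpaceAxis K g
  · exact not_iff_not.1 (key _ h2)
  · exact ho H hH h1 h2

end IsCAT0CubeComplex

/-! ### Cubes given by flips -/

/-- The vertex of the standard cube obtained from `c` by changing the coordinates in `T`. -/
def flipSet {n : ℕ} (c : Fin n → Bool) (T : Finset (Fin n)) : Fin n → Bool :=
  fun i => if i ∈ T then !(c i) else c i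

lemma flipSet_empty {n : ℕ} (c : Fin n → Bool) : flipSet c ∅ = c := by
  ext i
  simp [flipSet]

lemma flipSet_insert {n : ℕ} (c : Fin n → Bool) {T : Finset (Fin n)} {i : Fin n} (hi : i ∉ T) :
    flipSet c (insert i T) = flipAt (flipSet c T) i := by
  ext j
  by_cases hj : j = i
  · subst hj
    simp [flipSet, flipAt_self, hi]
  · simp [flipSet, flipAt_of_ne _ hj, hj]

lemma exists_eq_flipSet {n : ℕ} (c x : Fin n → Bool) : ∃ T, x = flipSet c T := by
  classical
  refine ⟨Finset.univ.filter fun i => x i ≠ c i, ?_⟩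
  ext i
  simp only [flipSet, Finset.mem_filter, Finset.mem_univ, true_and]
  cases x i <;> cases c i <;> simp

lemma flipSet_injective {n : ℕ} (c : Fin n → Bool) : Function.Injective (flipSet c) := by
  intro T T' h
  ext i
  have := congrFun h i
  simp only [flipSet] at this
  by_cases h1 : i ∈ T <;> by_cases h2 : i ∈ T' <;> simp_all

/-- A cube in the infinite-dimensional cube of all subsets of `α` is an interval: along parallel
edges the same element is added or removed. -/
lemma range_eq_Icc_of_flips {α : Type*} {n : ℕ} {ψ : (Fin n → Bool) → Set α}
    (hinj : Function.Injective ψ) (hflip : ∀ a i, ∃ h, ψ (flipAt a i) = symmDiff (ψ a) {h}) :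
    ∃ a b, a ⊆ b ∧ (b \ a).Finite ∧ Set.range ψ = Set.Icc a b := by
  classical
  set c : Fin n → Bool := fun _ => false with hc
  choose h hh using fun i => hflip c i
  have h_inj : Function.Injective h := by
    intro i j hij
    apply flipAt_injective c
    apply hinj
    rw [hh, hh, hij]
  have step : ∀ T : Finset (Fin n), ∀ i ∉ T,
      ψ (flipSet c (insert i T)) = symmDiff (ψ (flipSet c T)) {h i} := by
    intro T
    induction T using Finset.induction_on with
    | empty =>
      intro i _
      rw [flipSet_insert _ (Finset.notMem_empty i), flipSet_empty, hh]
    | insert j T hj ih =>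
      intro i hi
      have hij : i ≠ j := fun h => hi (h ▸ Finset.mem_insert_self _ _)
      have hiT : i ∉ T := fun h => hi (Finset.mem_insert_of_mem h)
      have hj' : j ∉ insert i T := by simp [hij.symm, hj]
      obtain ⟨p, hp⟩ := hflip (flipSet c (insert j T)) i
      obtain ⟨q, hq⟩ := hflip (flipSet c (insert i T)) j
      rw [← flipSet_insert _ hi] at hp
      rw [← flipSet_insert _ hj', Finset.insert_comm, hp, ih j hj, ih i hiT, symmDiff_assoc,
        symmDiff_assoc] at hq
      have hpq := symmDiff_right_injective _ hq
      rw [hp]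
      congr 2
      by_contra hne
      have hpj : p ≠ h j := by
        rintro rfl
        rw [ih j hj, symmDiff_assoc, symmDiff_self, symmDiff_bot] at hp
        have := flipSet_injective c (hinj hp)
        exact hj (this ▸ by simp)
      -- `h j` lies in exactly one of `{h j}` and `{p}`, so it must be `q`; then `p` is `h i`.
      have h1 := (Set.ext_iff.1 hpq (h j)).1 (by simp [Set.mem_symmDiff, hpj.symm])
      have h2 := (Set.ext_iff.1 hpq p).1 (by simp [Set.mem_symmDiff, hpj])
      have hji : h j ≠ h i := fun h => hij (h_inj h).symm
      simp only [Set.mem_symmDiff, Set.mem_singleton_iff] at h1 h2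
      rcases h1 with ⟨h1, _⟩ | ⟨h1, _⟩
      · exact hji h1
      · rcases h2 with ⟨h2, _⟩ | ⟨h2, _⟩
        · exact hne h2
        · exact hpj (h2.trans h1.symm)
  have key : ∀ T : Finset (Fin n), ψ (flipSet c T) = symmDiff (ψ c) (h '' T) := by
    intro T
    induction T using Finset.induction_on with
    | empty =>
      rw [flipSet_empty, Finset.coe_empty, Set.image_empty]
      exact (symmDiff_bot _).symm
    | insert i T hi ih =>
      have hnot : h i ∉ h '' (T : Set (Fin n)) := by
        rintro ⟨j, hj, hij⟩
        exact hi (h_inj hij ▸ hj)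
      rw [step T i hi, ih, symmDiff_assoc, symmDiff_singleton_eq_insert hnot, Finset.coe_insert,
        Set.image_insert_eq]
  refine ⟨ψ c \ Set.range h, ψ c ∪ Set.range h, Set.sdiff_subset.trans Set.subset_union_left,
    (Set.finite_range h).subset ?_, ?_⟩
  · rintro e ⟨h1 | h1, h2⟩
    · exact by_contra fun h3 => h2 ⟨h1, h3⟩
    · exact h1
  · ext u
    rw [mem_Icc_sdiff_union_iff]
    constructor
    · rintro ⟨x, rfl⟩
      obtain ⟨T, rfl⟩ := exists_eq_flipSet c x
      rw [key, symmDiff_symmDiff_cancel_left]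
      exact Set.image_subset_range _ _
    · intro hu
      refine ⟨flipSet c (Finset.univ.filter fun i => h i ∈ symmDiff (ψ c) u), ?_⟩
      rw [key]
      have : h '' ((Finset.univ.filter fun i => h i ∈ symmDiff (ψ c) u : Finset (Fin n)) :
          Set (Fin n)) = symmDiff (ψ c) u := by
        ext e
        constructor
        · rintro ⟨i, hi, rfl⟩
          simpa using hi
        · intro he
          obtain ⟨i, rfl⟩ := hu he
          exact ⟨i, by simpa using he, rfl⟩
      rw [this, symmDiff_symmDiff_cancel_left]

/-! ### The essential minimal set as the complex of a lattice -/

/-- The half-spaces of the positive half-space axis in the ultrafilter `q`. -/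
def essPosPart (K : Set (Set V)) (g : Equiv.Perm V) (q : EssMinVertex K g) : Set (Set V) :=
  {H | H ∈ posHalfSpaceAxis K g ∧ H ∈ q.1.1}

lemma essPosPart_eq {g : Equiv.Perm V} {q : EssMinVertex K g} {x : V}
    (h : q.1.1 = projection (halfSpaceAxis K g) x) : essPosPart K g q = posPart K g x := by
  ext H
  change _ ∧ _ ↔ _ ∧ _
  rw [h]
  exact ⟨fun hH => ⟨hH.1, hH.2.2⟩, fun hH => ⟨hH.1, Or.inl hH.1, hH.2⟩⟩

lemma compl_mem_halfSpaceAxis {g : Equiv.Perm V} {H : Set V} (h : H ∈ halfSpaceAxis K g) :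
    Hᶜ ∈ halfSpaceAxis K g := by
  rcases h with h | h
  · exact Or.inr (by rwa [compl_compl])
  · exact Or.inl h

lemma projection_eq_iff {g : Equiv.Perm V} {x y : V} :
    projection (halfSpaceAxis K g) x = projection (halfSpaceAxis K g) y ↔
      posPart K g x = posPart K g y := by
  constructor
  · intro h
    ext H
    constructor <;> rintro ⟨hH, hx⟩
    · exact ⟨hH, (h ▸ (⟨Or.inl hH, hx⟩ : H ∈ projection (halfSpaceAxis K g) x) :
        H ∈ projection (halfSpaceAxis K g) y).2⟩
    · exact ⟨hH, (h ▸ (⟨Or.inl hH, hx⟩ : H ∈ projection (halfSpaceAxis K g) y) :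
        H ∈ projection (halfSpaceAxis K g) x).2⟩
  · intro h
    have key : ∀ G ∈ posHalfSpaceAxis K g, x ∈ G ↔ y ∈ G := fun G hG =>
      ⟨fun hx => ((Set.ext_iff.1 h G).1 ⟨hG, hx⟩).2, fun hy => ((Set.ext_iff.1 h G).2 ⟨hG, hy⟩).2⟩
    ext H
    refine and_congr_right fun hH => ?_
    rcases hH with hH | hH
    · exact key H hH
    · exact not_iff_not.1 (key _ hH)

lemma essPosPart_injective (K : Set (Set V)) (g : Equiv.Perm V) :
    Function.Injective (essPosPart K g) := by
  intro p q h
  obtain ⟨x, -, hσ⟩ := p.2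
  obtain ⟨y, -, hτ⟩ := q.2
  rw [essPosPart_eq hσ, essPosPart_eq hτ, ← projection_eq_iff] at h
  exact Subtype.ext (Subtype.ext (hσ.trans (h.trans hτ.symm)))

namespace IsCAT0CubeComplex

variable (hK : IsCAT0CubeComplex K) {g : Equiv.Perm V} (hg : IsHyperbolic K g)

include hK

lemma halfSpaceAxis_subset : halfSpaceAxis K g ⊆ halfSpaces K := by
  rintro H (h | h)
  · exact posHalfSpaceAxis_subset h
  · simpa using hK.compl_mem (posHalfSpaceAxis_subset h)

/-- The projection of a vertex is an ultrafilter; the descending chain condition holds because only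
finitely many half-spaces separate two vertices. -/
lemma isPrincipalUltrafilter (x : V) :
    IsPrincipalUltrafilter (halfSpaceAxis K g) (projection (halfSpaceAxis K g) x) where
  subset _ h := h.1
  choice H hH :=
    ⟨fun h h' => h'.2 h.2, fun h => ⟨hH, by_contra fun hx => h ⟨compl_mem_halfSpaceAxis hH, hx⟩⟩⟩
  inter_nonempty _ h _ h' := ⟨x, h.2, h'.2⟩
  descending := by
    rw [Set.isWF_iff_no_descending_seq]
    intro f hf hmem
    have hne : ∃ y, y ∉ f 0 := by
      obtain ⟨a, b, hab, he⟩ := hK.mem_halfSpaces_iff.1 (hK.halfSpaceAxis_subset (hmem 0).1)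
      exact ⟨b, he ▸ right_notMem_side a b⟩
    obtain ⟨y, hy⟩ := hne
    refine Set.infinite_range_of_injective hf.injective ((hK.interval_finite y x).subset ?_)
    rintro _ ⟨n, rfl⟩
    exact ⟨hK.halfSpaceAxis_subset (hmem n).1, (hmem n).2, fun h => hy (hf.antitone n.zero_le h)⟩

/-- The vertex of the essential minimal set given by a vertex of the minimal set. -/
lemma exists_essMinVertex {x : V} (hx : x ∈ minVertices K g) :
    ∃ q : EssMinVertex K g, q.1.1 = projection (halfSpaceAxis K g) x :=
  ⟨⟨⟨_, hK.isPrincipalUltrafilter x⟩, x, hx, rfl⟩, rfl⟩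

lemma sageevAdj_of_adj {σ τ : SageevVertex (halfSpaceAxis K g)} {x y : V}
    (hσ : σ.1 = projection (halfSpaceAxis K g) x) (hτ : τ.1 = projection (halfSpaceAxis K g) y)
    (h : (skeleton K).Adj x y) (hne : σ ≠ τ) : SageevAdj σ τ := by
  have hside : side K x y ∈ halfSpaceAxis K g := by
    by_contra hs
    apply hne
    apply Subtype.ext
    rw [hσ, hτ]
    ext H
    refine and_congr_right fun hH => ?_
    by_cases hx : x ∈ H <;> by_cases hy : y ∈ H
    · simp [hx, hy]
    · exact absurd (hK.eq_side (hK.halfSpaceAxis_subset hH) h hx hy ▸ hH) hs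
    · have hH' := compl_mem_halfSpaceAxis hH
      exact absurd (hK.eq_side (hK.halfSpaceAxis_subset hH') h hx (not_not.2 hy) ▸ hH') hs
    · simp [hx, hy]
  have key : ∀ {x y : V}, (skeleton K).Adj x y → side K x y ∈ halfSpaceAxis K g →
      projection (halfSpaceAxis K g) x \ projection (halfSpaceAxis K g) y = {side K x y} := by
    intro x y h hs
    ext H
    constructor
    · rintro ⟨hx, hy⟩
      exact hK.eq_side (hK.halfSpaceAxis_subset hx.1) h hx.2 fun h => hy ⟨hx.1, h⟩
    · rintro rfl
      exact ⟨⟨hs, left_mem_side h⟩, fun h => right_notMem_side x y h.2⟩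
  refine ⟨side K x y, by rw [hσ, hτ, key h hside], ?_⟩
  rw [hσ, hτ, hK.compl_side h]
  exact key h.symm (hK.compl_side h ▸ compl_mem_halfSpaceAxis hside)

include hg

lemma isDiscreteLattice : IsDiscreteLattice (essPosPart K g) where
  inj := essPosPart_injective K g
  exists_union := by
    intro p q
    obtain ⟨x, hx, hσ⟩ := p.2
    obtain ⟨y, hy, hτ⟩ := q.2
    obtain ⟨z, hz, h, -⟩ := hK.exists_posPart_union hg hx hy
    obtain ⟨r, hr⟩ := hK.exists_essMinVertex hz
    exact ⟨r, by rw [essPosPart_eq hr, essPosPart_eq hσ, essPosPart_eq hτ, h]⟩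
  exists_inter := by
    intro p q
    obtain ⟨x, hx, hσ⟩ := p.2
    obtain ⟨y, hy, hτ⟩ := q.2
    obtain ⟨z, hz, h⟩ := hK.exists_posPart_inter hg hx hy
    obtain ⟨r, hr⟩ := hK.exists_essMinVertex hz
    exact ⟨r, by rw [essPosPart_eq hr, essPosPart_eq hσ, essPosPart_eq hτ, h]⟩
  finite_sdiff := by
    intro p q
    obtain ⟨x, hx, hσ⟩ := p.2
    obtain ⟨y, hy, hτ⟩ := q.2
    rw [essPosPart_eq hσ, essPosPart_eq hτ]
    exact hK.finite_posPart_sdiff x y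
  exists_insert := by
    intro p q h
    obtain ⟨x, hx, hσ⟩ := p.2
    obtain ⟨y, hy, hτ⟩ := q.2
    rw [essPosPart_eq hσ, essPosPart_eq hτ] at h
    obtain ⟨H, hHy, hHx⟩ := Set.not_subset.1 h.2
    obtain ⟨x', hx', hadj, hs, hys⟩ := hK.exists_move_up hg hx hy hHy.1 hHy.2
      fun h => hHx ⟨hHy.1, h⟩
    obtain ⟨r, hr⟩ := hK.exists_essMinVertex hx'
    refine ⟨r, side K x' x, ?_, ?_⟩
    · rw [essPosPart_eq hσ, essPosPart_eq hτ]
      exact ⟨⟨hs, hys⟩, fun h => right_notMem_side _ _ h.2⟩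
    · rw [essPosPart_eq hσ, essPosPart_eq hr, (hK.posPart_eq_insert hg hadj hs).1]

lemma exists_symmDiff_of_sageevAdj {p q : EssMinVertex K g} (h : SageevAdj p.1 q.1) :
    ∃ H, essPosPart K g q = symmDiff (essPosPart K g p) {H} := by
  obtain ⟨H, h1, h2⟩ := h
  have hH : H ∈ p.1.1 \ q.1.1 := h1 ▸ rfl
  have hH' : Hᶜ ∈ q.1.1 \ p.1.1 := h2 ▸ rfl
  have k1 : ∀ G, G ∈ p.1.1 → G ∉ q.1.1 → G = H := fun G h h' =>
    (h1 ▸ (⟨h, h'⟩ : G ∈ p.1.1 \ q.1.1) : G ∈ ({H} : Set (Set V)))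
  have k2 : ∀ G, G ∈ q.1.1 → G ∉ p.1.1 → G = Hᶜ := fun G h h' =>
    (h2 ▸ (⟨h, h'⟩ : G ∈ q.1.1 \ p.1.1) : G ∈ ({Hᶜ} : Set (Set V)))
  rcases p.1.2.subset hH.1 with hA | hA
  · refine ⟨H, ?_⟩
    have hA' := hK.compl_notMem_posHalfSpaceAxis hg hA
    rw [symmDiff_singleton_eq_sdiff (show H ∈ essPosPart K g p from ⟨hA, hH.1⟩)]
    ext G
    constructor
    · rintro ⟨hG, hGq⟩
      refine ⟨⟨hG, by_contra fun hGp => hA' (k2 G hGq hGp ▸ hG)⟩, ?_⟩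
      rintro rfl
      exact hH.2 hGq
    · rintro ⟨⟨hG, hGp⟩, hne⟩
      exact ⟨hG, by_contra fun hGq => hne (k1 G hGp hGq)⟩
  · refine ⟨Hᶜ, ?_⟩
    have hA' : H ∉ posHalfSpaceAxis K g := by
      have := hK.compl_notMem_posHalfSpaceAxis hg hA
      rwa [compl_compl] at this
    rw [symmDiff_singleton_eq_insert (fun h => hH'.2 h.2)]
    ext G
    constructor
    · rintro ⟨hG, hGq⟩
      by_cases hGp : G ∈ p.1.1
      · exact Or.inr ⟨hG, hGp⟩
      · exact Or.inl (k2 G hGq hGp)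
    · rintro (rfl | ⟨hG, hGp⟩)
      · exact ⟨hA, hH'.1⟩
      · exact ⟨hG, by_contra fun hGq => hA' (k1 G hGp hGq ▸ hG)⟩

/-- The vertices of the minimal set over an interval of the lattice that agree off the half-space
axis form a cube of `K`: they span squares by the quadrangle condition, and the flag condition at
the bottom vertex yields a cube, which has no other vertices. -/
lemma exists_cube {a b : Set (Set V)} (hab : a ⊆ b) (hfin : (b \ a).Finite)
    (hI : ∀ u ∈ Set.Icc a b, ∃ x ∈ minVertices K g, posPart K g x = u) :
    ∃ C ∈ K, C ⊆ minVertices K g ∧ (∀ x ∈ C, posPart K g x ∈ Set.Icc a b) ∧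
      Set.InjOn (posPart K g) C ∧ ∀ u ∈ Set.Icc a b, ∃ x ∈ C, posPart K g x = u := by
  classical
  obtain ⟨x₀, hx₀, ha⟩ := hI a ⟨subset_rfl, hab⟩
  have hlift : ∀ u, ∃ x, u ∈ Set.Icc a b →
      x ∈ minVertices K g ∧ posPart K g x = u ∧ AgreeOffAxis K g x₀ x := by
    intro u
    by_cases hu : u ∈ Set.Icc a b
    · obtain ⟨y, hy, rfl⟩ := hI u hu
      obtain ⟨z, hz, h1, h2⟩ := hK.exists_posPart_union hg hx₀ hy
      exact ⟨z, fun _ => ⟨hz, by rw [h1, ha]; exact Set.union_eq_right.2 hu.1, h2⟩⟩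
    · exact ⟨x₀, fun h => absurd h hu⟩
  choose X hX using hlift
  have huniq : ∀ u ∈ Set.Icc a b, ∀ x, posPart K g x = u → AgreeOffAxis K g x₀ x → x = X u := by
    intro u hu x hx ho
    obtain ⟨-, h1, h2⟩ := hX u hu
    exact hK.eq_of_posPart_eq (hx.trans h1.symm)
      fun H hH hH1 hH2 => (ho H hH hH1 hH2).symm.trans (h2 H hH hH1 hH2)
  have hX0 : X a = x₀ := (huniq a ⟨subset_rfl, hab⟩ x₀ ha fun _ _ _ _ => Iff.rfl).symm
  have hXinj : ∀ u ∈ Set.Icc a b, ∀ v ∈ Set.Icc a b, X u = X v → u = v := by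
    intro u hu v hv h
    rw [← (hX u hu).2.1, h, (hX v hv).2.1]
  have hadj : ∀ u ∈ Set.Icc a b, ∀ h ∈ b, h ∉ u → (skeleton K).Adj (X u) (X (insert h u)) := by
    intro u hu h hb hh
    have hu' : insert h u ∈ Set.Icc a b :=
      ⟨hu.1.trans (Set.subset_insert _ _), Set.insert_subset hb hu.2⟩
    obtain ⟨h1, h2, h3⟩ := hX u hu
    obtain ⟨h4, h5, h6⟩ := hX _ hu'
    have h7 : h ∈ posPart K g (X (insert h u)) := by
      rw [h5]
      exact Set.mem_insert _ _
    obtain ⟨x', -, hx', hs, hys⟩ := hK.exists_move_up hg h1 h4 h7.1 h7.2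
      fun h' => hh (h2 ▸ ⟨h7.1, h'⟩)
    obtain ⟨h8, h9⟩ := hK.posPart_eq_insert hg hx' hs
    have h10 : side K x' (X u) = h := by
      have h11 : side K x' (X u) ∈ insert h u := h5 ▸ ⟨hs, hys⟩
      rcases h11 with h11 | h11
      · exact h11
      · exact absurd (h2.symm.subset h11).2 (right_notMem_side _ _)
    rw [h10, h2] at h8
    rwa [← huniq _ hu' x' h8
      fun H hH hH1 hH2 => (h3 H hH hH1 hH2).trans (h9 H hH hH1 hH2)]
  have hsq : ∀ u ∈ Set.Icc a b, ∀ h ∈ b, ∀ h' ∈ b, h ∉ u → h' ∉ u → h ≠ h' →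
      IsSquare K (X u) (X (insert h u)) (X (insert h' (insert h u))) (X (insert h' u)) := by
    intro u hu h hb h' hb' hh hh' hne
    have hu1 : insert h u ∈ Set.Icc a b :=
      ⟨hu.1.trans (Set.subset_insert _ _), Set.insert_subset hb hu.2⟩
    have hu2 : insert h' u ∈ Set.Icc a b :=
      ⟨hu.1.trans (Set.subset_insert _ _), Set.insert_subset hb' hu.2⟩
    have hu3 : insert h' (insert h u) ∈ Set.Icc a b :=
      ⟨hu1.1.trans (Set.subset_insert _ _), Set.insert_subset hb' hu1.2⟩
    have a1 := hadj u hu h hb hh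
    have a2 := hadj u hu h' hb' hh'
    have a3 := hadj _ hu1 h' hb' (by simp [hne.symm, hh'])
    have a4 := hadj _ hu2 h hb (by simp [hne, hh])
    rw [Set.insert_comm] at a4
    set t := X (insert h' (insert h u)) with ht
    have d1 := SimpleGraph.dist_eq_one_iff_adj.2 a3.symm
    have d2 := SimpleGraph.dist_eq_one_iff_adj.2 a4.symm
    have d0 : (skeleton K).dist t (X u) ≠ 0 := fun h0 => by
      have := hXinj _ hu3 _ hu (hK.dist_eq_zero.1 h0)
      exact hh (this ▸ by simp)
    have d3 := hK.dist_succ_or t a1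
    obtain ⟨w, hw, hd⟩ := hK.quadrangle (x := t) a1.symm a2.symm (by omega) (by omega) fun he => by
      have := hXinj _ hu1 _ hu2 he
      have h1 : h ∈ insert h' u := this ▸ Set.mem_insert _ _
      rcases h1 with h1 | h1
      · exact hne h1
      · exact hh h1
    obtain rfl : t = w := hK.dist_eq_zero.1 (by omega)
    exact hw.reverse.rotate.rotate
  have haI : a ∈ Set.Icc a b := ⟨subset_rfl, hab⟩
  -- The flag condition at `x₀`.
  obtain ⟨C, hC, hx₀C, hA⟩ := hK.nonpositivelyCurved x₀ ((fun h => X (insert h a)) '' (b \ a))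
    (hfin.image _) (by
      rintro _ ⟨h, hh, rfl⟩
      rw [← hX0]
      exact hadj a haI h hh.1 hh.2) (by
      rintro _ ⟨h, hh, rfl⟩ _ ⟨h', hh', rfl⟩ hne
      have := pair_mem_link hK.isLocallyCAT0.triangleFree
        (hsq a haI h hh.1 h' hh'.1 hh.2 hh'.2 (fun he => hne (by rw [he])))
      rwa [hX0] at this)
  obtain ⟨n, φ, hφ⟩ := hK.isCubeComplex.exists_param hC
  rw [← hφ.range] at hx₀C
  obtain ⟨c, hc⟩ := hx₀C
  have hflip : ∀ i, ∃ h, h ∈ b \ a ∧ φ (flipAt c i) = X (insert h a) := by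
    intro i
    have : φ (flipAt c i) ∈ (fun h => X (insert h a)) '' (b \ a) := by
      rw [hA]
      refine ⟨hφ.range ▸ Set.mem_range_self _, ?_⟩
      rw [← hc]
      exact (hφ.adj_iff _ _).2 ⟨i, rfl⟩
    obtain ⟨h, hh, he⟩ := this
    exact ⟨h, hh, he.symm⟩
  choose h hh hφh using hflip
  have h_inj : Function.Injective h := by
    intro i j hij
    apply flipAt_injective c
    apply hφ.inj
    rw [hφh, hφh, hij]
  have h_surj : ∀ e ∈ b \ a, ∃ i, h i = e := by
    intro e he
    have : X (insert e a) ∈ (fun h => X (insert h a)) '' (b \ a) := ⟨e, he, rfl⟩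
    rw [hA, ← hφ.range] at this
    obtain ⟨⟨x, hx⟩, hadj'⟩ := this
    rw [← hx, ← hc] at hadj'
    obtain ⟨i, rfl⟩ := (hφ.adj_iff _ _).1 hadj'
    rw [hφh] at hx
    have := hXinj _ ⟨Set.subset_insert _ _, Set.insert_subset (hh i).1 hab⟩ _
      ⟨Set.subset_insert _ _, Set.insert_subset he.1 hab⟩ hx
    have h1 : h i ∈ insert e a := this ▸ Set.mem_insert _ _
    rcases h1 with h1 | h1
    · exact ⟨i, h1⟩
    · exact absurd h1 (hh i).2
  have hmemI : ∀ T : Finset (Fin n), a ∪ h '' T ∈ Set.Icc a b := by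
    refine fun T => ⟨Set.subset_union_left, Set.union_subset hab ?_⟩
    rintro _ ⟨i, -, rfl⟩
    exact (hh i).1
  have hnot : ∀ (T : Finset (Fin n)) (i : Fin n), i ∉ T → h i ∉ a ∪ h '' T := by
    rintro T i hi (h1 | ⟨j, hj, h1⟩)
    · exact (hh i).2 h1
    · exact hi (h_inj h1 ▸ hj)
  have hins : ∀ (T : Finset (Fin n)) (i : Fin n),
      a ∪ h '' (insert i T : Finset (Fin n)) = insert (h i) (a ∪ h '' T) := by
    intro T i
    rw [Finset.coe_insert, Set.image_insert_eq, Set.union_insert]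
  -- Three vertices of a square determine the fourth, so the two cubes agree.
  have key : ∀ T : Finset (Fin n), φ (flipSet c T) = X (a ∪ h '' T) ∧
      ∀ i ∉ T, φ (flipSet c (insert i T)) = X (a ∪ h '' (insert i T : Finset (Fin n))) := by
    intro T
    induction T using Finset.induction_on with
    | empty =>
      refine ⟨by rw [flipSet_empty, hc]; simp [hX0], fun i hi => ?_⟩
      rw [flipSet_insert _ hi, flipSet_empty, hφh, hins]
      simp
    | insert j T hj ih =>
      obtain ⟨ih0, ih1⟩ := ih
      refine ⟨ih1 j hj, fun i hi => ?_⟩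
      have hij : i ≠ j := fun h => hi (h ▸ Finset.mem_insert_self _ _)
      have hiT : i ∉ T := fun h => hi (Finset.mem_insert_of_mem h)
      have s1 := hφ.isSquare (flipSet c T) hij.symm
      rw [← flipSet_insert _ hj, ← flipSet_insert _ hi, ← flipSet_insert _ hiT, ih0, ih1 j hj,
        ih1 i hiT, hins, hins] at s1
      have s2 := hsq _ (hmemI T) (h j) (hh j).1 (h i) (hh i).1 (hnot T j hj) (hnot T i hiT)
        (fun he => hij (h_inj he).symm)
      rw [hins, hins]
      exact hK.isCubeComplex.square_unique s1.rotate.rotate.rotate s2.rotate.rotate.rotate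
  have hCX : ∀ x, x ∈ C ↔ ∃ u ∈ Set.Icc a b, X u = x := by
    intro x
    rw [← hφ.range]
    constructor
    · rintro ⟨y, rfl⟩
      obtain ⟨T, rfl⟩ := exists_eq_flipSet c y
      exact ⟨_, hmemI T, (key T).1.symm⟩
    · rintro ⟨u, hu, rfl⟩
      refine ⟨flipSet c (Finset.univ.filter fun i => h i ∈ u), ?_⟩
      rw [(key _).1]
      congr 1
      ext e
      constructor
      · rintro (he | ⟨i, hi, rfl⟩)
        · exact hu.1 he
        · simpa using hi
      · intro he
        by_cases hea : e ∈ a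
        · exact Or.inl hea
        · obtain ⟨i, rfl⟩ := h_surj e ⟨hu.2 he, hea⟩
          exact Or.inr ⟨i, by simpa using he, rfl⟩
  refine ⟨C, hC, fun x hx => ?_, fun x hx => ?_, fun x hx y hy hxy => ?_, fun u hu => ?_⟩
  · obtain ⟨u, hu, rfl⟩ := (hCX x).1 hx
    exact (hX u hu).1
  · obtain ⟨u, hu, rfl⟩ := (hCX x).1 hx
    rw [(hX u hu).2.1]
    exact hu
  · obtain ⟨u, hu, rfl⟩ := (hCX x).1 hx
    obtain ⟨v, hv, rfl⟩ := (hCX y).1 hy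
    rw [(hX u hu).2.1, (hX v hv).2.1] at hxy
    rw [hxy]
  · exact ⟨X u, (hCX _).2 ⟨u, hu, rfl⟩, (hX u hu).2.1⟩

/-- The cubes of the essential minimal set are the finite intervals of the lattice. -/
theorem essMinSet_eq_latticeCubes : essMinSet K g = latticeCubes (essPosPart K g) := by
  ext Q
  constructor
  · rintro ⟨⟨n, φ, hφ, hrange, hadj⟩, -⟩
    have hex : ∀ x, ∃ q ∈ Q, q.1 = φ x := fun x => by
      have : φ x ∈ Subtype.val '' Q := hrange ▸ Set.mem_range_self x
      exact this
    choose q hqQ hq using hex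
    have hQ : Set.range q = Q := by
      refine Set.Subset.antisymm (by rintro _ ⟨x, rfl⟩; exact hqQ x) fun p hp => ?_
      obtain ⟨x, hx⟩ : p.1 ∈ Set.range φ := hrange ▸ Set.mem_image_of_mem _ hp
      exact ⟨x, Subtype.ext ((hq x).trans hx)⟩
    obtain ⟨a, b, hab, hf, hI⟩ := range_eq_Icc_of_flips (ψ := fun x => essPosPart K g (q x))
      (fun x y h => hφ (by rw [← hq, ← hq, essPosPart_injective K g h]))
      (fun x i => hK.exists_symmDiff_of_sageevAdj hg (by
        rw [hq, hq]
        exact hadj _ _ ((existsUnique_ne_iff _ _).2 ⟨i, rfl⟩)))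
    refine ⟨a, b, hab, hf, ?_⟩
    rw [← hI, ← hQ, ← Set.range_comp]
    rfl
  · rintro ⟨a, b, hab, hf, hI⟩
    obtain ⟨C, hC, hCM, h1, h2, h3⟩ := hK.exists_cube hg hab hf (by
      intro u hu
      rw [← hI] at hu
      obtain ⟨p, -, rfl⟩ := hu
      obtain ⟨x, hx, hσ⟩ := p.2
      exact ⟨x, hx, (essPosPart_eq hσ).symm⟩)
    obtain ⟨n, φ, hφ⟩ := hK.isCubeComplex.exists_param hC
    have hφC : ∀ x, φ x ∈ C := fun x => hφ.range ▸ Set.mem_range_self x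
    choose q hq using fun x => hK.exists_essMinVertex (hCM (hφC x))
    have hqs : ∀ x, essPosPart K g (q x) = posPart K g (φ x) := fun x => essPosPart_eq (hq x)
    have hqinj : Function.Injective q := by
      intro x y hxy
      apply hφ.inj
      apply h2 (hφC x) (hφC y)
      rw [← hqs, ← hqs, hxy]
    have hQ : Set.range q = Q := by
      ext p
      rw [← (essPosPart_injective K g).mem_set_image (s := Q), hI]
      constructor
      · rintro ⟨x, rfl⟩
        rw [hqs]
        exact h1 _ (hφC x)
      · intro hp
        obtain ⟨y, hy, he⟩ := h3 _ hp
        obtain ⟨x, rfl⟩ := hφ.range ▸ hy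
        exact ⟨x, essPosPart_injective K g ((hqs x).trans he)⟩
    refine ⟨⟨n, fun x => (q x).1, fun x y h => hqinj (Subtype.ext h), ?_, ?_⟩, C, hC, hCM, ?_⟩
    · rw [← hQ]
      exact Set.range_comp Subtype.val q
    · intro x y hxy
      obtain ⟨i, rfl⟩ := (existsUnique_ne_iff _ _).1 hxy
      refine hK.sageevAdj_of_adj (hq _) (hq _) ((hφ.adj_iff _ _).2 ⟨i, rfl⟩) fun h => ?_
      exact flipAt_ne x i (hqinj (Subtype.ext h)).symm
    · rw [← hQ, ← hφ.range, ← Set.range_comp, ← Set.range_comp]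
      congr 1
      ext1 x
      exact hq x

end IsCAT0CubeComplex

end CubeCpx

theorem mainTheorem10 {V : Type*} (K : Set (Set V)) (hK : CubeCpx.IsCAT0CubeComplex K)
    (g : Equiv.Perm V) (hg : CubeCpx.IsHyperbolic K g) :
    CubeCpx.IsCAT0CubeComplex (CubeCpx.essMinSet K g) := by
  have : Nonempty V := hK.connected.nonempty
  obtain ⟨x, hx⟩ := CubeCpx.minVertices_nonempty (K := K) g
  have : Nonempty (CubeCpx.EssMinVertex K g) := ⟨(hK.exists_essMinVertex hx).choose⟩
  rw [hK.essMinSet_eq_latticeCubes hg]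
  exact (hK.isDiscreteLattice hg).isCAT0CubeComplex
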